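/- **Setting.** Let $V'$ be a complex vector space of dimension $m$ with a non-degenerate symmetric bilinear form $\langle\,,\rangle$; put $V=V'\oplus\mathbb C$ and $\mathbf P_\infty=\mathbf P(V')\subset\mathbf P(V)=\mathbf P^m$. All topological notions are for the Zariski topology. Let $X\subset\mathbf P^m$ be an irreducible projective variety, $X\not\subset\mathbf P_\infty$, and $X_\infty=X\cap\mathbf P_\infty$. For $x\in X$ let $\hat T_x\subset V$ be the tangent space of the affine cone over $X$ at $x$, and let $N'_x\subset V'$ be the orthogonal space of $\hat T_x\cap V'$. Let $U\subset X$ be the open set of the smooth points $x$ of $X$ such that $\hat T_x\not\subset V'$ and the line $x$ is not contained in $N'_x$ (the largest orthogonally general open subset). Let $N_U=\{(x,y)\in\mathbf P^m\times\mathbf P^m: x\in U,\ y\in\mathbf P(x+N'_x)\}$, a smooth variety of dimension $m$; let $N_X$ be its closure, $\pi$ the second projection, and $Y_X$ the closure of the set of points of $N_U$ where the differential of $\pi|_{N_U}$ is not an isomorphism. For $D\subset X$ let $N_X|_D$ denote the closure of $\{(x,y)\in N_U:x\in D\}$. $X$ is *isotropically focally degenerate* if $\pi:N_X\to\mathbf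 P^m$ is not dominant; $X$ is *weakly focally degenerate* if $\pi$ is dominant and some irreducible component $Z$ of $Y_X$ has an image $\pi(Z)$ that is not a hypersurface of $\mathbf P^m$. **Isotropic projective inverse focal construction.** Let $\Sigma\subsetneq\mathbf P_\infty$ be an irreducible closed proper subvariety, with affine cone $\hat\Sigma\subset V'$, such that at each smooth point $O\neq0$ of $\hat\Sigma$ the space $(T_O\hat\Sigma)^\perp\subset V'$ is totally isotropic. Let $r$ be an algebraic (possibly multivalued, possibly with poles) function on $\hat\Sigma$, homogeneous of degree $2$, i.e. one whose graph is an irreducible closed subset $R\subsetneq\hat\Sigma\times\mathbb C$ that dominates $\hat\Sigma$ and is stable under $(O,\rho)\mapsto(cO,c^2\rho)$, $c\in\mathbb C^*$. For a smooth point $(O,\rho)$ of $R$ let $$A_{(O,\rho)}=\{x\in V':\ \langle O,x\rangle=\rho,\ \ \langle v,x\rangle=\tfrac12\sigma\ \text{ for all }(v,\sigma)\in T_{(O,\rho)}R\}.$$ The pair $(\Sigma,r)$ is *admissible* if $\langle x,x\rangle=\rho$ for all smooth points $(O,\rho)$ of $R$ and all $x\in A_{(O,\rho)}$. The variety *obtained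 from* the admissible pair $(\Sigma,r)$ is the closure in $\mathbf P_\infty$ of the set of the points $[x]$ with $0\neq x\in A_{(O,\rho)}$, $(O,\rho)$ a smooth point of $R$. A variety obtained in this way from some admissible pair is called *projectively isotropically degenerate*. **Proposition.** (1) Let $X$ be weakly focally degenerate, let $Z$ be an irreducible component of $Y_X$ with $\Sigma:=\pi(Z)\subset\mathbf P_\infty$, and suppose that the first projection maps $Z$ onto an irreducible component $\Delta$ of $X_\infty$. Then $Z=N_X|_\Delta$, and $\Delta$ is projectively isotropically degenerate; more precisely, $\Delta$ is obtained from an admissible pair $(\Sigma,r)$ with this $\Sigma$ via the isotropic projective inverse focal construction. (2) Conversely, let $\Delta$ be an irreducible component of $X_\infty$ with $\Delta\cap U\neq\emptyset$, let $X$ be not isotropically focally degenerate, and suppose that $\Delta$ is obtained from an admissible pair $(\Sigma,r)$ via the isotropic projective inverse focal construction. Then $X$ is weakly focally degenerate of the type in (1): $Z=N_X|_\Delta$ is an irreducible component of $Y_X$ which projects onto $\Delta$, and $\pi(Z)=\Sigma\subset\mathbf P_\infty$, which is not a hypersurface of $\mathbf P^m$. -/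

import Mathlib

open scoped LinearAlgebra.Projectivization Topology

namespace Focal

universe u

/-- The polynomial functions on a complex vector space `E`: the algebra of functions generated by
the linear forms. -/
def polyFun (E : Type u) [AddCommGroup E] [Module ℂ E] : Subalgebra ℂ (E → ℂ) :=
  Algebra.adjoin ℂ {f | ∃ φ : Module.Dual ℂ E, f = fun v => φ v}

/-- A polynomial function has a directional derivative in every direction, linear in the
direction. -/
theorem exists_lineDeriv {E : Type u} [AddCommGroup E] [Module ℂ E] {f : E → ℂ}
    (hf : f ∈ polyFun E) (p : E) : ∃ L : E →ₗ[ℂ] ℂ, ∀ v, lineDeriv ℂ f p v = L v := by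
  suffices h : ∃ L : E →ₗ[ℂ] ℂ, ∀ v, HasLineDerivAt ℂ f (L v) p v by
    obtain ⟨L, hL⟩ := h
    exact ⟨L, fun v => (hL v).lineDeriv⟩
  induction hf using Algebra.adjoin_induction with
  | mem g hg =>
    obtain ⟨φ, rfl⟩ := hg
    refine ⟨φ, fun v => ?_⟩
    have h : HasDerivAt (fun t : ℂ => φ p + t * φ v) (φ v) 0 := by
      simpa using ((hasDerivAt_id (0 : ℂ)).mul_const (φ v)).const_add (φ p)
    simpa [HasLineDerivAt] using h
  | algebraMap c =>
    exact ⟨0, fun v => by simpa [HasLineDerivAt] using hasDerivAt_const (0 : ℂ) c⟩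
  | add g h _ _ ihg ihh =>
    obtain ⟨L, hL⟩ := ihg
    obtain ⟨M, hM⟩ := ihh
    exact ⟨L + M, fun v => HasDerivAt.add (hL v) (hM v)⟩
  | mul g h _ _ ihg ihh =>
    obtain ⟨L, hL⟩ := ihg
    obtain ⟨M, hM⟩ := ihh
    refine ⟨h p • L + g p • M, fun v => ?_⟩
    have key := HasDerivAt.mul (hL v) (hM v)
    have e : (h p • L + g p • M) v
        = L v * h (p + (0 : ℂ) • v) + g (p + (0 : ℂ) • v) * M v := by
      simp [mul_comm]
    rw [e]
    exact key

/-- The Zariski topology of a finite dimensional complex vector space. -/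
@[reducible] noncomputable def zariski (E : Type u) [AddCommGroup E] [Module ℂ E] : TopologicalSpace E :=
  TopologicalSpace.generateFrom {U | ∃ f ∈ polyFun E, U = {v | f v ≠ 0}}

/-- The Zariski topology of the projective space `ℙ(E)`: the quotient topology of the Zariski
topology of `E ∖ {0}`, so that a set is closed iff its punctured affine cone is closed in
`E ∖ {0}`. -/
@[reducible] noncomputable def zariskiProj (E : Type u) [AddCommGroup E] [Module ℂ E] : TopologicalSpace (ℙ ℂ E) :=
  TopologicalSpace.coinduced (fun v : {v : E // v ≠ 0} => Projectivization.mk ℂ v.1 v.2)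
    (TopologicalSpace.induced Subtype.val (zariski E))

/-- The Zariski topology of `ℙ(E) × ℙ(E)` (not the product topology): the quotient topology of the
Zariski topology of `(E ∖ {0}) × (E ∖ {0}) ⊆ E × E`. -/
@[reducible] noncomputable def zariskiBiproj (E : Type u) [AddCommGroup E] [Module ℂ E] :
    TopologicalSpace (ℙ ℂ E × ℙ ℂ E) :=
  TopologicalSpace.coinduced
    (fun v : {v : E × E // v.1 ≠ 0 ∧ v.2 ≠ 0} =>
      (Projectivization.mk ℂ v.1.1 v.2.1, Projectivization.mk ℂ v.1.2 v.2.2))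
    (TopologicalSpace.induced Subtype.val (zariski (E × E)))

/-- `C` is an irreducible component of the subset `S`. -/
def IsComponent {α : Type u} (t : TopologicalSpace α) (S C : Set α) : Prop :=
  Maximal (fun T : Set α => @IsIrreducible α t T ∧ T ⊆ S) C

/-- The Zariski tangent space at `p` of (the Zariski closure of) `S`: the common kernel of the
differentials at `p` of the polynomial functions vanishing on `S`. -/
def tangentSpace {E : Type u} [AddCommGroup E] [Module ℂ E] (S : Set E) (p : E) :
    Submodule ℂ E where
  carrier := {v | ∀ f ∈ polyFun E, (∀ q ∈ S, f q = 0) → lineDeriv ℂ f p v = 0}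
  add_mem' := by
    intro a b ha hb f hf h0
    obtain ⟨L, hL⟩ := exists_lineDeriv hf p
    have h1 := ha f hf h0
    have h2 := hb f hf h0
    rw [hL] at h1 h2 ⊢
    rw [map_add, h1, h2, add_zero]
  zero_mem' := by
    intro f hf _
    obtain ⟨L, hL⟩ := exists_lineDeriv hf p
    rw [hL, map_zero]
  smul_mem' := by
    intro c a ha f hf h0
    obtain ⟨L, hL⟩ := exists_lineDeriv hf p
    have h1 := ha f hf h0
    rw [hL] at h1 ⊢
    rw [map_smul, h1, smul_zero]

/-- `p` is a smooth point of the irreducible closed set `S`: the dimension of the tangent space at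
`p` is the smallest one that occurs on `S` (which is the dimension of `S`). -/
def IsSmoothPt {E : Type u} [AddCommGroup E] [Module ℂ E] (S : Set E) (p : E) : Prop :=
  p ∈ S ∧ ∀ q ∈ S,
    Module.finrank ℂ (tangentSpace S p) ≤ Module.finrank ℂ (tangentSpace S q)

/-- The affine cone (with its vertex) over a subset of `ℙ(E)`. -/
def cone {E : Type u} [AddCommGroup E] [Module ℂ E] (S : Set (ℙ ℂ E)) : Set E :=
  {v | ∀ h : v ≠ 0, Projectivization.mk ℂ v h ∈ S}

/-- The affine bicone (without vertices) over a subset of `ℙ(E) × ℙ(E)`. -/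
def bicone {E : Type u} [AddCommGroup E] [Module ℂ E] (S : Set (ℙ ℂ E × ℙ ℂ E)) : Set (E × E) :=
  {v | ∃ (h₁ : v.1 ≠ 0) (h₂ : v.2 ≠ 0),
    (Projectivization.mk ℂ v.1 h₁, Projectivization.mk ℂ v.2 h₂) ∈ S}

/-- A hypersurface of `ℙ(E)`: the zero locus of one nonzero homogeneous polynomial of positive
degree. -/
def IsHypersurface {E : Type u} [AddCommGroup E] [Module ℂ E] (S : Set (ℙ ℂ E)) : Prop :=
  ∃ f ∈ polyFun E, ∃ d : ℕ, 0 < d ∧ f ≠ 0 ∧ (∀ (c : ℂ) (v : E), f (c • v) = c ^ d * f v) ∧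
    S = {p | f p.rep = 0}

section Normal

variable {V' : Type u} [AddCommGroup V'] [Module ℂ V']

/-- The inclusion of the hyperplane at infinity `ℙ(V')` in `ℙ(V)`, where `V = V' ⊕ ℂ`. -/
noncomputable def atInfinity (V' : Type u) [AddCommGroup V'] [Module ℂ V'] : ℙ ℂ V' → ℙ ℂ (V' × ℂ) :=
  Projectivization.map (LinearMap.inl ℂ V' ℂ) LinearMap.inl_injective

/-- `T̂_x ∩ V'`, for `T̂_x ⊆ V` the tangent space at `x` of the affine cone over `X`. -/
def tangentDirections (X : Set (ℙ ℂ (V' × ℂ))) (x : V' × ℂ) : Submodule ℂ V' :=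
  (tangentSpace (cone X) x).comap (LinearMap.inl ℂ V' ℂ)

/-- The space of normal directions at `x`: the annihilator of `T̂_x ∩ V'` for the scalar
product `B`. -/
def normalDirections (B : LinearMap.BilinForm ℂ V') (X : Set (ℙ ℂ (V' × ℂ))) (x : V' × ℂ) :
    Submodule ℂ V' :=
  B.orthogonal (tangentDirections X x)

/-- The (linear space underlying the projective) normal space at `x`, spanned by `x` and the normal
directions. -/
def normalSpace (B : LinearMap.BilinForm ℂ V') (X : Set (ℙ ℂ (V' × ℂ))) (x : V' × ℂ) :
    Submodule ℂ (V' × ℂ) :=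
  Submodule.span ℂ {x} ⊔ (normalDirections B X x).map (LinearMap.inl ℂ V' ℂ)

/-- The largest orthogonally general open subset `U` of `X`: the smooth points of `X` at which `X`
is transversal to the hyperplane at infinity (`T̂_x ⊄ V'`) and to the quadric at infinity
(the line `x` is not a normal direction). -/
def orthGeneral (B : LinearMap.BilinForm ℂ V') (X : Set (ℙ ℂ (V' × ℂ))) :
    Set (ℙ ℂ (V' × ℂ)) :=
  {p | IsSmoothPt (cone X) p.rep ∧
    (∃ v ∈ tangentSpace (cone X) p.rep, v.2 ≠ 0) ∧
    p.rep ∉ (normalDirections B X p.rep).map (LinearMap.inl ℂ V' ℂ)}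

/-- The projective normal bundle `N_U` of `U = orthGeneral B X`. -/
def normalBundle (B : LinearMap.BilinForm ℂ V') (X : Set (ℙ ℂ (V' × ℂ))) :
    Set (ℙ ℂ (V' × ℂ) × ℙ ℂ (V' × ℂ)) :=
  {p | p.1 ∈ orthGeneral B X ∧ p.2.rep ∈ normalSpace B X p.1.rep}

/-- The projective normal variety `N_X`, the closure of `N_U`. -/
def normalVariety (B : LinearMap.BilinForm ℂ V') (X : Set (ℙ ℂ (V' × ℂ))) :
    Set (ℙ ℂ (V' × ℂ) × ℙ ℂ (V' × ℂ)) :=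
  @closure _ (zariskiBiproj (V' × ℂ)) (normalBundle B X)

/-- The restriction of `N_X` to a subvariety `D` of `X`: the closure of the restriction of the
bundle `N_U` to `D ∩ U`. -/
def normalRestriction (B : LinearMap.BilinForm ℂ V') (X D : Set (ℙ ℂ (V' × ℂ))) :
    Set (ℙ ℂ (V' × ℂ) × ℙ ℂ (V' × ℂ)) :=
  @closure _ (zariskiBiproj (V' × ℂ)) {p | p ∈ normalBundle B X ∧ p.1 ∈ D}

/-- The ramification locus `Y_X` of the second projection `π : N_X → ℙ(V)`: the closure of the set of
points of the smooth variety `N_U` (which has the dimension of `ℙ(V)`) where the differential of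
`π` is not an isomorphism, i.e. not surjective; this is read on the affine cones. -/
def ramification (B : LinearMap.BilinForm ℂ V') (X : Set (ℙ ℂ (V' × ℂ))) :
    Set (ℙ ℂ (V' × ℂ) × ℙ ℂ (V' × ℂ)) :=
  @closure _ (zariskiBiproj (V' × ℂ))
    {p | p ∈ normalBundle B X ∧
      (tangentSpace (bicone (normalBundle B X)) (p.1.rep, p.2.rep)).map
        (LinearMap.snd ℂ (V' × ℂ) (V' × ℂ)) ≠ ⊤}

/-- The closure of the second projection `π(Z)` of `Z` (which is `π(Z)` if `Z` is closed, since
`ℙ(V)` is complete). -/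
def focalImage (Z : Set (ℙ ℂ (V' × ℂ) × ℙ ℂ (V' × ℂ))) : Set (ℙ ℂ (V' × ℂ)) :=
  @closure _ (zariskiProj (V' × ℂ)) (Prod.snd '' Z)

/-- The closure of the first projection of `Z` (which is the first projection if `Z` is closed). -/
def baseImage (Z : Set (ℙ ℂ (V' × ℂ) × ℙ ℂ (V' × ℂ))) : Set (ℙ ℂ (V' × ℂ)) :=
  @closure _ (zariskiProj (V' × ℂ)) (Prod.fst '' Z)

/-- `X` is isotropically focally degenerate: `π : N_X → ℙ(V)` is not dominant. -/
def IsIsotropicallyFocallyDegenerate (B : LinearMap.BilinForm ℂ V')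
    (X : Set (ℙ ℂ (V' × ℂ))) : Prop :=
  focalImage (normalVariety B X) ≠ Set.univ

/-- `X` is weakly focally degenerate: `π` is dominant, and some component of `Y_X` does not map to a
hypersurface. -/
def IsWeaklyFocallyDegenerate (B : LinearMap.BilinForm ℂ V') (X : Set (ℙ ℂ (V' × ℂ))) : Prop :=
  ¬ IsIsotropicallyFocallyDegenerate B X ∧
    ∃ Z, IsComponent (zariskiBiproj (V' × ℂ)) (ramification B X) Z ∧
      ¬ IsHypersurface (focalImage Z)

/-- `D` (a subset of the hyperplane at infinity) is an irreducible component of `X_∞`. -/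
def IsComponentAtInfinity (X : Set (ℙ ℂ (V' × ℂ))) (D : Set (ℙ ℂ V')) : Prop :=
  IsComponent (zariskiProj (V' × ℂ)) (X ∩ Set.range (atInfinity V')) (atInfinity V' '' D)

/-- `X` is weakly focally degenerate, with a component `S` of the focal locus contained in the
hyperplane at infinity, image of a component `Z` of `Y_X` which projects onto a component `D`
of `X_∞`. -/
structure IsDegenerateAtInfinity (B : LinearMap.BilinForm ℂ V') (X : Set (ℙ ℂ (V' × ℂ)))
    (Z : Set (ℙ ℂ (V' × ℂ) × ℙ ℂ (V' × ℂ))) (S D : Set (ℙ ℂ V')) : Prop where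
  weakly : IsWeaklyFocallyDegenerate B X
  component : IsComponent (zariskiBiproj (V' × ℂ)) (ramification B X) Z
  focal : focalImage Z = atInfinity V' '' S
  base : baseImage Z = atInfinity V' '' D
  base_component : IsComponentAtInfinity X D

/-- `R ⊆ V' × ℂ` is the graph of an algebraic (possibly multivalued, possibly with poles) function
`r` on the affine cone over `S`, homogeneous of degree two: an irreducible closed subset of
`cone S × ℂ`, proper (so that `r` has finitely many values at a general point), dominating
`cone S`, and stable under `(O, r) ↦ (c O, c² r)`. -/
structure IsAlgebraicSection (S : Set (ℙ ℂ V')) (R : Set (V' × ℂ)) : Prop where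
  closed : IsClosed[zariski (V' × ℂ)] R
  irreducible : @IsIrreducible _ (zariski (V' × ℂ)) R
  dominant : @closure _ (zariski V') (Prod.fst '' R) = cone S
  proper : R ≠ cone S ×ˢ Set.univ
  homogeneous : ∀ (c : ℂ) (O : V') (r : ℂ), c ≠ 0 → (O, r) ∈ R → (c • O, c ^ 2 * r) ∈ R

/-- The affine subspace of `V'` given by the equations `⟨O, x⟩ = r` and `⟨∂O/∂s, x⟩ = ½ ∂r/∂s`, where
`(∂O/∂s, ∂r/∂s)` runs through the tangent vectors to the graph `R` of `r` at `p = (O, r)`. -/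
def isotropicFibre (B : LinearMap.BilinForm ℂ V') (R : Set (V' × ℂ)) (p : V' × ℂ) : Set V' :=
  {x | B p.1 x = p.2 ∧ ∀ v ∈ tangentSpace R p, B v.1 x = v.2 / 2}

/-- `D` is obtained from the admissible pair `(S, r)`, with `R` the graph of `r`, via the isotropic
projective inverse focal construction. -/
structure IsIsotropicInverseFocal (B : LinearMap.BilinForm ℂ V') (S : Set (ℙ ℂ V'))
    (R : Set (V' × ℂ)) (D : Set (ℙ ℂ V')) : Prop where
  closed : IsClosed[zariskiProj V'] S
  irreducible : @IsIrreducible _ (zariskiProj V') S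
  proper : S ≠ Set.univ
  /-- the projective tangent spaces of `S` have a totally isotropic annihilator -/
  isotropic : ∀ O : V', O ≠ 0 → IsSmoothPt (cone S) O →
    ∀ w ∈ B.orthogonal (tangentSpace (cone S) O),
      ∀ w' ∈ B.orthogonal (tangentSpace (cone S) O), B w w' = 0
  isSection : IsAlgebraicSection S R
  admissible : ∀ p, IsSmoothPt R p → ∀ x ∈ isotropicFibre B R p, B x x = p.2
  /-- `D` is the variety swept out by the subspaces -/
  eq_closure : D = @closure _ (zariskiProj V')
    {q | ∃ p, IsSmoothPt R p ∧ ∃ x ∈ isotropicFibre B R p, ∃ hx : x ≠ 0,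
      q = Projectivization.mk ℂ x hx}

/-- `D` is projectively isotropically degenerate. -/
def IsProjIsotropicallyDegenerate (B : LinearMap.BilinForm ℂ V') (D : Set (ℙ ℂ V')) : Prop :=
  ∃ S R, IsIsotropicInverseFocal B S R D

end Normal

end Focal

/-! Everything is read on affine cones. Put m = dim V', let N be the cone over the normal bundle, of
dimension m + 2, and N' its restriction to the general points of Δ, of dimension m + 1. The link
between ramification and the inverse construction is the set P (`focalPairs`) of pairs (x, O) with x
a general point of the cone over Δ and O - x normal at x. Up to closure the second projection of P
is that of N', and P is irreducible with all tangent spaces of dimension m: T_xΔ̂ and the normal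
directions are orthogonal complements. The equality T_xΔ̂ = T̂_x ∩ V' uses transversality at x and
Seidenberg's theorem that minimal primes over a differential ideal are differential.

Part (1). Near a point of N, ramification is the vanishing of one determinant. The component Z lies
in N', a proper irreducible subset of N, so Krull's principal ideal theorem forces Z = N' up to
closure (`zcl_bicone_eq`). On P, both x and every dx are tangent, hence orthogonal to O - x. Thus
⟨O, x⟩ = ⟨x, x⟩, and differentiating ⟨x, O - x⟩ = 0 gives ⟨dO, x⟩ = ⟨x, dx⟩. With ρ = ⟨x, x⟩ and R
the closure of the points (O, ρ), these are the equations of the fibre A_(O,ρ), once generic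
smoothness shows that the tangent vectors of R come from P (`gen_mem_fibrePairs`). The total space A
of the fibres over smooth points of R (`fibrePairs`) is irreducible of dimension m as well: a
nonempty fibre excludes vertical tangent vectors of R, so the dimension of a fibre is m - dim R.
Hence P is dense in A, and ⟨x, x⟩ = ρ holds on all of A. Since A_(O,ρ) is a translate of the
orthogonal space of the tangent directions of Σ̂, the quadratic form vanishes on that space; this
isotropy spreads from general points to all smooth points. Finally Σ = P_∞ is impossible, because P
would dominate V' and one tangent vector of X transversal to V' would make π unramified.

Part (2). Differentiating ⟨O, x⟩ = ρ and ⟨x, x⟩ = ρ on A, together with ⟨dO, x⟩ = dρ/2, gives ⟨dx, O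
- x⟩ = 0. So (x, O) lies in P for a general point of A; forgetting ρ is injective on tangent
vectors, and equality of dimensions makes A dense in P (`zcl_focalPairs`). Therefore π(N') is Σ. An
unramified point of N' would give π(N') dimension at least m, contrary to Σ ≠ P_∞. So N' is ramified
everywhere; as it has codimension one in N and π is dominant, it is a component of the ramification
locus.

The dimension of an irreducible set is taken to be its smallest tangent space dimension (`gdim`).
The general tools are Cramer's rule for extending tangent vectors to polynomial fields, generic
smoothness (from formal smoothness of field extensions in characteristic zero), and the density of
an irreducible subset of full dimension (`zcl_eq_of_gdim_le`). -/

open scoped LinearAlgebra.Projectivization Topology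

namespace Focal

universe u v w x

set_option linter.unusedSectionVars false
set_option linter.unusedSimpArgs false

/-! ### Polynomial maps and their differentials. -/

section Poly

variable {E : Type u} [AddCommGroup E] [Module ℂ E] {F : Type v} [AddCommGroup F] [Module ℂ F]
  {G : Type w} [AddCommGroup G] [Module ℂ G] {H : Type x} [AddCommGroup H] [Module ℂ H]

/-- Polynomial maps between complex vector spaces. -/
def IsPoly (f : E → F) : Prop := ∀ φ : Module.Dual ℂ F, (fun x => φ (f x)) ∈ polyFun E

/-- `L` is the differential of `f` at `p`, tested on lines and linear forms. -/
def HasPD (f : E → F) (p : E) (L : E →ₗ[ℂ] F) : Prop :=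
  ∀ (φ : Module.Dual ℂ F) (v : E), HasLineDerivAt ℂ (fun x => φ (f x)) (φ (L v)) p v

open Classical in
/-- The differential of `f` at `p`. -/
noncomputable def pd (f : E → F) (p : E) : E →ₗ[ℂ] F :=
  if h : ∃ L, HasPD f p L then h.choose else 0

theorem HasPD.unique {f : E → F} {p : E} {L M : E →ₗ[ℂ] F} (hL : HasPD f p L)
    (hM : HasPD f p M) : L = M := by
  ext v
  rw [← sub_eq_zero, ← Module.forall_dual_apply_eq_zero_iff ℂ]
  intro φ
  rw [map_sub, sub_eq_zero]
  exact (hL φ v).unique (hM φ v)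

theorem HasPD.pd_eq {f : E → F} {p : E} {L : E →ₗ[ℂ] F} (hL : HasPD f p L) : pd f p = L := by
  have h : ∃ L, HasPD f p L := ⟨L, hL⟩
  rw [pd, dif_pos h]
  exact h.choose_spec.unique hL

theorem hasPD_scalar {f : E → ℂ} {p : E} {L : E →ₗ[ℂ] ℂ} :
    HasPD f p L ↔ ∀ v, HasLineDerivAt ℂ f (L v) p v := by
  refine ⟨fun h v => h LinearMap.id v, fun h φ v => ?_⟩
  have e : ∀ z : ℂ, φ z = z * φ 1 := fun z => by
    conv_lhs => rw [← mul_one z, ← smul_eq_mul, map_smul, smul_eq_mul]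
  have := HasDerivAt.mul_const (h v) (φ 1)
  simpa only [HasLineDerivAt, e (f _), e (L v)] using this

theorem isPoly_scalar {f : E → ℂ} : IsPoly f ↔ f ∈ polyFun E := by
  refine ⟨fun h => h LinearMap.id, fun h φ => ?_⟩
  have e : (fun x => φ (f x)) = φ 1 • f := by
    ext x
    conv_lhs => rw [← mul_one (f x), ← smul_eq_mul, map_smul, smul_eq_mul, mul_comm]
    simp
  rw [e]
  exact Subalgebra.smul_mem _ h _

theorem isPoly_linear (L : E →ₗ[ℂ] F) : IsPoly L :=
  fun φ => Algebra.subset_adjoin ⟨φ ∘ₗ L, rfl⟩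

theorem hasPD_linear (L : E →ₗ[ℂ] F) (p : E) : HasPD L p L := by
  intro φ v
  have h : HasDerivAt (fun t : ℂ => φ (L p) + t * φ (L v)) (φ (L v)) 0 := by
    simpa using ((hasDerivAt_id (0 : ℂ)).mul_const (φ (L v))).const_add (φ (L p))
  simpa [HasLineDerivAt] using h

theorem isPoly_const (c : F) : IsPoly (fun _ : E => c) :=
  fun φ => Subalgebra.algebraMap_mem (polyFun E) (φ c)

theorem hasPD_const (c : F) (p : E) : HasPD (fun _ : E => c) p 0 := by
  intro φ v
  simpa [HasLineDerivAt] using hasDerivAt_const (0 : ℂ) (φ c)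

theorem isPoly_id : IsPoly (fun x : E => x) := isPoly_linear LinearMap.id

theorem IsPoly.add {f g : E → F} (hf : IsPoly f) (hg : IsPoly g) :
    IsPoly (fun x => f x + g x) := fun φ => by
  simpa only [map_add] using! Subalgebra.add_mem _ (hf φ) (hg φ)

theorem HasPD.add {f g : E → F} {p : E} {L M : E →ₗ[ℂ] F} (hf : HasPD f p L) (hg : HasPD g p M) :
    HasPD (fun x => f x + g x) p (L + M) := fun φ v => by
  simpa only [map_add, LinearMap.add_apply] using! HasDerivAt.add (hf φ v) (hg φ v)

theorem isPoly_mul {f g : E → ℂ} (hf : IsPoly f) (hg : IsPoly g) :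
    IsPoly (fun x => f x * g x) :=
  isPoly_scalar.2 (Subalgebra.mul_mem _ (isPoly_scalar.1 hf) (isPoly_scalar.1 hg))

theorem IsPoly.smul {c : E → ℂ} {f : E → F} (hc : IsPoly c) (hf : IsPoly f) :
    IsPoly (fun x => c x • f x) := fun φ => by
  simpa only [map_smul, smul_eq_mul] using isPoly_scalar.1 (isPoly_mul hc (isPoly_scalar.2 (hf φ)))

theorem IsPoly.neg {f : E → F} (hf : IsPoly f) : IsPoly (fun x => - f x) := by
  simpa using (isPoly_const (E := E) (-1 : ℂ)).smul hf

theorem IsPoly.sub {f g : E → F} (hf : IsPoly f) (hg : IsPoly g) :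
    IsPoly (fun x => f x - g x) := by
  simpa [sub_eq_add_neg] using hf.add hg.neg

theorem isPoly_sum {ι : Type*} (s : Finset ι) {f : ι → E → F} (hf : ∀ i ∈ s, IsPoly (f i)) :
    IsPoly (fun x => ∑ i ∈ s, f i x) := fun φ => by
  have := Subalgebra.sum_mem (polyFun E) (fun i hi => hf i hi φ)
  convert! this using 1
  ext x
  simp

theorem isPoly_prod {ι : Type*} (s : Finset ι) {f : ι → E → ℂ} (hf : ∀ i ∈ s, IsPoly (f i)) :
    IsPoly (fun x => ∏ i ∈ s, f i x) := by
  rw [isPoly_scalar]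
  have := Subalgebra.prod_mem (polyFun E) (fun i hi => isPoly_scalar.1 (hf i hi))
  convert! this using 1
  ext x
  simp

theorem isPoly_pow {f : E → ℂ} (hf : IsPoly f) (n : ℕ) : IsPoly (fun x => f x ^ n) :=
  isPoly_scalar.2 (Subalgebra.pow_mem _ (isPoly_scalar.1 hf) n)

theorem IsPoly.comp {g : F → G} {f : E → F} (hg : IsPoly g) (hf : IsPoly f) :
    IsPoly (fun x => g (f x)) := by
  intro φ
  have h := hg φ
  change (fun x => (fun y => φ (g y)) (f x)) ∈ _
  generalize (fun y => φ (g y)) = q at h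
  induction h using Algebra.adjoin_induction with
  | mem q hq => obtain ⟨ψ, rfl⟩ := hq; exact hf ψ
  | algebraMap c => exact Subalgebra.algebraMap_mem (polyFun E) c
  | add a b _ _ ha hb => exact Subalgebra.add_mem _ ha hb
  | mul a b _ _ ha hb => exact Subalgebra.mul_mem _ ha hb

theorem hasPD_prodMk {f : E → F} {g : E → G} {p : E} {L : E →ₗ[ℂ] F} {M : E →ₗ[ℂ] G}
    (hf : HasPD f p L) (hg : HasPD g p M) : HasPD (fun x => (f x, g x)) p (L.prod M) := by
  intro φ v
  have h := HasDerivAt.add (hf (φ ∘ₗ LinearMap.inl ℂ F G) v) (hg (φ ∘ₗ LinearMap.inr ℂ F G) v)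
  have e : ∀ a b, φ (a, b) = φ (a, 0) + φ (0, b) := fun a b => by rw [← map_add]; simp
  have e1 : (fun x => φ (f x, g x)) = fun x => φ (f x, 0) + φ (0, g x) := funext fun x => e _ _
  rw [e1, LinearMap.prod_apply, show (Function.prod L M) v = (L v, M v) from rfl, e]
  exact h

theorem IsPoly.prodMk {f : E → F} {g : E → G} (hf : IsPoly f) (hg : IsPoly g) :
    IsPoly (fun x => (f x, g x)) := by
  have := ((isPoly_linear (LinearMap.inl ℂ F G)).comp hf).add
    ((isPoly_linear (LinearMap.inr ℂ F G)).comp hg)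
  simpa using this

theorem isPoly_fst : IsPoly (fun x : E × F => x.1) := isPoly_linear (LinearMap.fst ℂ E F)

theorem isPoly_snd : IsPoly (fun x : E × F => x.2) := isPoly_linear (LinearMap.snd ℂ E F)

theorem IsPoly.fst {f : E → F × G} (hf : IsPoly f) : IsPoly (fun x => (f x).1) :=
  isPoly_fst.comp hf

theorem IsPoly.snd {f : E → F × G} (hf : IsPoly f) : IsPoly (fun x => (f x).2) :=
  isPoly_snd.comp hf

theorem isPoly_pi {ι : Type*} [Finite ι] {f : E → ι → ℂ} (hf : ∀ i, IsPoly (fun x => f x i)) :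
    IsPoly f := by
  classical
  cases nonempty_fintype ι
  have := isPoly_sum (E := E) (Finset.univ : Finset ι)
    (f := fun i x => f x i • (Pi.single i (1 : ℂ) : ι → ℂ)) (fun i _ => (hf i).smul (isPoly_const _))
  convert! this using 1
  ext x i
  simp [Finset.sum_apply, Pi.single_apply]

theorem isPoly_of_basis {ι : Type*} [Finite ι] (b : Module.Basis ι ℂ F) {f : E → F}
    (hf : ∀ i, IsPoly (fun x => b.repr (f x) i)) : IsPoly f := by
  have : IsPoly (fun x => b.equivFun.symm.toLinearMap (b.equivFun (f x))) :=
    (isPoly_linear _).comp (isPoly_pi hf)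
  simpa only [LinearEquiv.coe_toLinearMap, LinearEquiv.symm_apply_apply] using this

theorem isPoly_bilin [FiniteDimensional ℂ F] (b : F →ₗ[ℂ] G →ₗ[ℂ] H) {f : E → F} {g : E → G}
    (hf : IsPoly f) (hg : IsPoly g) : IsPoly (fun x => b (f x) (g x)) := by
  let e := Module.finBasis ℂ F
  have := isPoly_sum (E := E) Finset.univ
    (f := fun i x => (e.coord i (f x)) • b (e i) (g x))
    (fun i _ => ((isPoly_linear (e.coord i)).comp hf).smul ((isPoly_linear (b (e i))).comp hg))
  convert! this using 1
  ext x
  conv_lhs => rw [← e.sum_repr (f x)]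
  simp only [map_sum, map_smul, LinearMap.sum_apply, LinearMap.smul_apply, e.coord_apply]

theorem hasLineDerivAt_mul {a b : E → ℂ} {p v : E} {A B : ℂ} (ha : HasLineDerivAt ℂ a A p v)
    (hb : HasLineDerivAt ℂ b B p v) :
    HasLineDerivAt ℂ (fun x => a x * b x) (b p * A + a p * B) p v := by
  have h := HasDerivAt.mul ha hb
  rw [zero_smul, add_zero, mul_comm A] at h
  exact h

theorem hasPD_bilin_aux (b : F →ₗ[ℂ] G →ₗ[ℂ] H) (p : F × G) :
    HasPD (fun x : F × G => b x.1 x.2) p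
      ((b.flip p.2) ∘ₗ LinearMap.fst ℂ F G + (b p.1) ∘ₗ LinearMap.snd ℂ F G) := by
  intro φ v
  have h : HasDerivAt (fun t : ℂ => φ (b p.1 p.2) + t * (φ (b v.1 p.2) + φ (b p.1 v.2))
      + t * t * φ (b v.1 v.2)) (φ (b v.1 p.2) + φ (b p.1 v.2)) 0 := by
    have h1 := ((hasDerivAt_id (0 : ℂ)).mul_const (φ (b v.1 p.2) + φ (b p.1 v.2))).const_add
      (φ (b p.1 p.2))
    have h2 := (((hasDerivAt_id (0 : ℂ)).mul (hasDerivAt_id (0 : ℂ))).mul_const (φ (b v.1 v.2)))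
    simpa using! h1.add h2
  simp only [HasLineDerivAt]
  convert! h using 1
  · ext t
    simp
    ring
  · simp

theorem HasPD.polyComp {g : F → G} {f : E → F} {p : E} {L : E →ₗ[ℂ] F} {M : F →ₗ[ℂ] G}
    (hgp : IsPoly g) (hg : HasPD g (f p) M) (hf : HasPD f p L) :
    HasPD (fun x => g (f x)) p (M ∘ₗ L) := by
  intro φ v
  have key : ∀ q ∈ polyFun F, ∃ N : F →ₗ[ℂ] ℂ, HasPD q (f p) N ∧
      HasPD (fun x => q (f x)) p (N ∘ₗ L) := by
    intro q hq
    simp only [hasPD_scalar]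
    induction hq using Algebra.adjoin_induction with
    | mem q hq =>
      obtain ⟨ψ, rfl⟩ := hq
      exact ⟨ψ, hasPD_scalar.1 (hasPD_linear ψ _), hf ψ⟩
    | algebraMap c =>
      exact ⟨0, hasPD_scalar.1 (hasPD_const c _), hasPD_scalar.1 (hasPD_const c _)⟩
    | add a b _ _ ha hb =>
      obtain ⟨A, hA, hA'⟩ := ha
      obtain ⟨B, hB, hB'⟩ := hb
      exact ⟨A + B, fun v => HasDerivAt.add (hA v) (hB v),
        fun v => HasDerivAt.add (hA' v) (hB' v)⟩
    | mul a b _ _ ha hb =>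
      obtain ⟨A, hA, hA'⟩ := ha
      obtain ⟨B, hB, hB'⟩ := hb
      exact ⟨b (f p) • A + a (f p) • B, fun v => hasLineDerivAt_mul (hA v) (hB v),
        fun v => hasLineDerivAt_mul (hA' v) (hB' v)⟩
  obtain ⟨N, hN, hN'⟩ := key _ (hgp φ)
  have : N = φ ∘ₗ M := hN.unique (hasPD_scalar.2 (fun v => hg φ v))
  subst this
  exact hasPD_scalar.1 hN' v

theorem IsPoly.hasPD_scalar_pd {f : E → ℂ} (hf : IsPoly f) (p : E) : HasPD f p (pd f p) := by
  obtain ⟨L, hL⟩ : ∃ L, HasPD f p L := by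
    simp only [hasPD_scalar]
    have hf := isPoly_scalar.1 hf
    induction hf using Algebra.adjoin_induction with
    | mem q hq =>
      obtain ⟨ψ, rfl⟩ := hq
      exact ⟨ψ, hasPD_scalar.1 (hasPD_linear ψ _)⟩
    | algebraMap c => exact ⟨0, hasPD_scalar.1 (hasPD_const c _)⟩
    | add a b ha' hb' ha hb =>
      obtain ⟨A, hA⟩ := ha (isPoly_scalar.2 ha')
      obtain ⟨B, hB⟩ := hb (isPoly_scalar.2 hb')
      exact ⟨A + B, fun v => HasDerivAt.add (hA v) (hB v)⟩
    | mul a b ha' hb' ha hb =>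
      obtain ⟨A, hA⟩ := ha (isPoly_scalar.2 ha')
      obtain ⟨B, hB⟩ := hb (isPoly_scalar.2 hb')
      exact ⟨b p • A + a p • B, fun v => hasLineDerivAt_mul (hA v) (hB v)⟩
  rwa [hL.pd_eq]

theorem HasPD.smul {c : E → ℂ} {f : E → F} {p : E} {L : E →ₗ[ℂ] ℂ} {M : E →ₗ[ℂ] F}
    (hc : HasPD c p L) (hf : HasPD f p M) :
    HasPD (fun x => c x • f x) p (L.smulRight (f p) + c p • M) := by
  intro φ v
  have h := HasDerivAt.mul (hasPD_scalar.1 hc v) (hf φ v)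
  simp only [HasLineDerivAt]
  convert! h using 1
  · ext t; simp
  · simp

theorem hasPD_sum {ι : Type*} (s : Finset ι) {f : ι → E → F} {p : E} {L : ι → E →ₗ[ℂ] F}
    (hf : ∀ i ∈ s, HasPD (f i) p (L i)) : HasPD (fun x => ∑ i ∈ s, f i x) p (∑ i ∈ s, L i) := by
  classical
  induction s using Finset.induction_on with
  | empty => simpa using hasPD_const (0 : F) p
  | insert a s ha ih =>
    simp only [Finset.sum_insert ha]
    exact (hf a (by simp)).add (ih fun i hi => hf i (by simp [hi]))

variable [FiniteDimensional ℂ F]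

theorem IsPoly.hasPD {f : E → F} (hf : IsPoly f) (p : E) : HasPD f p (pd f p) := by
  obtain ⟨L, hL⟩ : ∃ L, HasPD f p L := by
    let e := Module.finBasis ℂ F
    have := hasPD_sum (E := E) (p := p) Finset.univ (f := fun i x => (e.coord i (f x)) • e i)
      (fun i _ => (IsPoly.hasPD_scalar_pd ((isPoly_linear (e.coord i)).comp hf) p).smul
        (hasPD_const (e i) p))
    have h2 : (fun x => ∑ i, (e.coord i (f x)) • e i) = f := by
      ext x; exact e.sum_repr (f x)
    rw [h2] at this
    exact ⟨_, this⟩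
  rwa [hL.pd_eq]

theorem pd_comp [FiniteDimensional ℂ G] {g : F → G} {f : E → F} (hg : IsPoly g) (hf : IsPoly f)
    (p : E) :
    pd (fun x => g (f x)) p = (pd g (f p)) ∘ₗ (pd f p) :=
  (HasPD.polyComp hg (hg.hasPD _) (hf.hasPD _)).pd_eq

theorem hasPD_bilin (b : F →ₗ[ℂ] G →ₗ[ℂ] H) {f : E → F} {g : E → G} {p : E} {L : E →ₗ[ℂ] F}
    {M : E →ₗ[ℂ] G} (hf : HasPD f p L) (hg : HasPD g p M) :
    HasPD (fun x => b (f x) (g x)) p ((b.flip (g p)) ∘ₗ L + (b (f p)) ∘ₗ M) := by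
  have h := HasPD.polyComp (g := fun x : F × G => b x.1 x.2) (f := fun x => (f x, g x)) (p := p)
    (isPoly_bilin b isPoly_fst isPoly_snd) (hasPD_bilin_aux b (f p, g p)) (hasPD_prodMk hf hg)
  have e : ((b.flip (g p)) ∘ₗ L + (b (f p)) ∘ₗ M) = ((b.flip (g p)) ∘ₗ LinearMap.fst ℂ F G
      + (b (f p)) ∘ₗ LinearMap.snd ℂ F G) ∘ₗ L.prod M := by
    ext v
    simp
  rw [e]
  exact h

end Poly

/-! ### Differentials of polynomials along polynomial vector fields; tangent vectors in terms of
`pd`. -/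

section Poly2

variable {E : Type u} [AddCommGroup E] [Module ℂ E] [FiniteDimensional ℂ E]
  {F : Type v} [AddCommGroup F] [Module ℂ F] [FiniteDimensional ℂ F]

theorem pd_linear (L : E →ₗ[ℂ] F) (p : E) : pd L p = L := (hasPD_linear L p).pd_eq

theorem pd_const (c : F) (p : E) : pd (fun _ : E => c) p = 0 := (hasPD_const c p).pd_eq

theorem pd_add {f g : E → F} (hf : IsPoly f) (hg : IsPoly g) (p : E) :
    pd (fun x => f x + g x) p = pd f p + pd g p := ((hf.hasPD p).add (hg.hasPD p)).pd_eq

theorem pd_smul {c : E → ℂ} {f : E → F} (hc : IsPoly c) (hf : IsPoly f) (p : E) (v : E) :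
    pd (fun x => c x • f x) p v = pd c p v • f p + c p • pd f p v := by
  rw [((hc.hasPD p).smul (hf.hasPD p)).pd_eq]
  simp

theorem pd_mul {f g : E → ℂ} (hf : IsPoly f) (hg : IsPoly g) (p : E) (v : E) :
    pd (fun x => f x * g x) p v = pd f p v * g p + f p * pd g p v := by
  simpa using pd_smul hf hg p v

theorem isPoly_pd_apply {f : E → ℂ} (hf : IsPoly f) (v : E) : IsPoly (fun x => pd f x v) := by
  have hf' := isPoly_scalar.1 hf
  induction hf' using Algebra.adjoin_induction with
  | mem q hq =>
    obtain ⟨ψ, rfl⟩ := hq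
    simp only [pd_linear ψ]
    exact isPoly_const _
  | algebraMap c =>
    have : (algebraMap ℂ (E → ℂ) c) = fun _ => c := rfl
    simp only [this, pd_const]
    exact isPoly_const _
  | add a b ha' hb' ha hb =>
    have ha' := isPoly_scalar.2 ha'
    have hb' := isPoly_scalar.2 hb'
    have : (fun x => pd (a + b) x v) = fun x => pd a x v + pd b x v := by
      ext x; exact congrArg (· v) (pd_add ha' hb' x)
    rw [this]
    exact (ha ha').add (hb hb')
  | mul a b ha' hb' ha hb =>
    have ha' := isPoly_scalar.2 ha'
    have hb' := isPoly_scalar.2 hb'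
    have : (fun x => pd (a * b) x v) = fun x => pd a x v * b x + a x * pd b x v := by
      ext x; exact pd_mul ha' hb' x v
    rw [this]
    exact (isPoly_mul (ha ha') hb').add (isPoly_mul ha' (hb hb'))

theorem isPoly_pd {f : E → ℂ} (hf : IsPoly f) : IsPoly (fun x => (pd f x : Module.Dual ℂ E)) := by
  let e := Module.finBasis ℂ E
  refine isPoly_of_basis e.dualBasis fun i => ?_
  simpa using isPoly_pd_apply hf (e i)

theorem isPoly_pd_field {f : E → ℂ} (hf : IsPoly f) {u : E → E} (hu : IsPoly u) :
    IsPoly (fun x => pd f x (u x)) :=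
  isPoly_bilin (LinearMap.id : Module.Dual ℂ E →ₗ[ℂ] Module.Dual ℂ E) (isPoly_pd hf) hu

omit [FiniteDimensional ℂ E] in
theorem mem_tangentSpace {S : Set E} {p v : E} :
    v ∈ tangentSpace S p ↔ ∀ f : E → ℂ, IsPoly f → (∀ q ∈ S, f q = 0) → pd f p v = 0 := by
  change (∀ f ∈ polyFun E, (∀ q ∈ S, f q = 0) → lineDeriv ℂ f p v = 0) ↔ _
  refine forall_congr' fun f => ?_
  rw [← isPoly_scalar]
  refine forall_congr' fun hf => ?_
  rw [(hasPD_scalar.1 (hf.hasPD p) v).lineDeriv]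

end Poly2

/-! ### Linear systems with polynomial coefficients. -/

section Cramer

variable {E : Type u} [AddCommGroup E] [Module ℂ E]
  {F : Type v} [AddCommGroup F] [Module ℂ F] [FiniteDimensional ℂ F]

theorem isPoly_det {ι : Type*} [Fintype ι] [DecidableEq ι] {M : E → Matrix ι ι ℂ}
    (hM : ∀ i j, IsPoly (fun x => M x i j)) : IsPoly (fun x => (M x).det) := by
  simp only [Matrix.det_apply']
  exact isPoly_sum _ fun σ _ => isPoly_mul (isPoly_const _)
    (isPoly_prod _ fun i _ => hM _ _)

theorem isPoly_adjugate {ι : Type*} [Fintype ι] [DecidableEq ι] {M : E → Matrix ι ι ℂ}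
    (hM : ∀ i j, IsPoly (fun x => M x i j)) (i j : ι) :
    IsPoly (fun x => (M x).adjugate i j) := by
  simp only [Matrix.adjugate_apply]
  refine isPoly_det fun k l => ?_
  by_cases h : k = j
  · subst h
    simpa using isPoly_const _
  · simpa [Matrix.updateRow_ne h] using hM k l

/-- Linear independence of polynomial maps is an open condition. -/
theorem exists_isPoly_linearIndependent {ι : Type*} [Finite ι] {v : ι → E → F}
    (hv : ∀ i, IsPoly (v i)) {p₀ : E} (h : LinearIndependent ℂ (fun i => v i p₀)) :
    ∃ d : E → ℂ, IsPoly d ∧ d p₀ = 1 ∧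
      ∀ p, d p ≠ 0 → LinearIndependent ℂ (fun i => v i p) := by
  classical
  cases nonempty_fintype ι
  have hinj : LinearMap.ker (Fintype.linearCombination ℂ (fun i => v i p₀)) = ⊥ := by
    rw [LinearMap.ker_eq_bot]
    exact h.fintypeLinearCombination_injective
  obtain ⟨L, hL⟩ := LinearMap.exists_leftInverse_of_injective _ hinj
  have hL' : ∀ j, L (v j p₀) = Pi.single j 1 := fun j => by
    have := LinearMap.congr_fun hL (Pi.single j 1)
    simpa using this
  -- `L` inverts the family at `p₀` and is then kept fixed, so the determinant of this square matrix
  -- is polynomial, equals 1 at `p₀`, and detects independence elsewhere.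
  let M : E → Matrix ι ι ℂ := fun p j i => L (v j p) i
  refine ⟨fun p => (M p).det, isPoly_det fun i j => ?_, ?_, fun p hp => ?_⟩
  · exact (isPoly_linear (LinearMap.proj j ∘ₗ L)).comp (hv i)
  · have : M p₀ = 1 := by
      ext i j
      simp [M, hL', Matrix.one_apply, Pi.single_apply, eq_comm]
    simp [this]
  · have h1 : LinearIndependent ℂ (M p).row :=
      Matrix.linearIndependent_rows_of_det_ne_zero hp
    exact LinearIndependent.of_comp L h1

theorem exists_dual_basis {ι : Type*} [Finite ι] [DecidableEq ι] {φ : ι → Module.Dual ℂ F}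
    (h : LinearIndependent ℂ φ) : ∃ e : ι → F, ∀ i j, φ i (e j) = if i = j then 1 else 0 := by
  cases nonempty_fintype ι
  have hinj : LinearMap.ker (Fintype.linearCombination ℂ φ) = ⊥ := by
    rw [LinearMap.ker_eq_bot]
    exact h.fintypeLinearCombination_injective
  obtain ⟨L, hL⟩ := LinearMap.exists_leftInverse_of_injective _ hinj
  have hL' : ∀ j, L (φ j) = Pi.single j 1 := fun j => by
    have := LinearMap.congr_fun hL (Pi.single j 1)
    simpa using this
  refine ⟨fun j => (Module.evalEquiv ℂ F).symm (LinearMap.proj j ∘ₗ L), fun i j => ?_⟩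
  rw [Module.apply_evalEquiv_symm_apply]
  simp [hL', Pi.single_apply, eq_comm]

/-- Cramer's rule: a solution at `p₀` of a homogeneous linear system with polynomial coefficients,
independent at `p₀`, extends to a polynomial solution. -/
theorem exists_poly_solution {ι : Type*} [Finite ι] {φ : ι → E → Module.Dual ℂ F}
    (hφ : ∀ i, IsPoly (φ i)) {p₀ : E} (h : LinearIndependent ℂ (fun i => φ i p₀)) {v₀ : F}
    (hv₀ : ∀ i, φ i p₀ v₀ = 0) :
    ∃ v : E → F, IsPoly v ∧ v p₀ = v₀ ∧ (∀ p i, φ i p (v p) = 0) ∧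
      ∀ p, ¬ LinearIndependent ℂ (fun i => φ i p) → v p = 0 := by
  classical
  cases nonempty_fintype ι
  obtain ⟨e, he⟩ := exists_dual_basis h
  let M : E → Matrix ι ι ℂ := fun p i j => φ i p (e j)
  have hφv : ∀ i (w : F), IsPoly (fun p => φ i p w) := fun i w =>
    (isPoly_linear (Module.Dual.eval ℂ F w)).comp (hφ i)
  have hM : ∀ i j, IsPoly (fun p => M p i j) := fun i j => hφv i (e j)
  have hc : ∀ i, IsPoly (fun p => φ i p v₀) := fun i => hφv i v₀
  let y : E → ι → ℂ := fun p => (M p).adjugate.mulVec (fun i => φ i p v₀)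
  have hy : ∀ i, IsPoly (fun p => y p i) := fun i => by
    simp only [y, Matrix.mulVec, dotProduct]
    exact isPoly_sum _ fun j _ => isPoly_mul (isPoly_adjugate hM i j) (hc j)
  -- The Cramer solution is `det M • v₀ - ∑ yⱼ eⱼ` with `y` the adjugate applied to the values on
  -- `v₀`. The additional factor `det M` makes it vanish wherever the forms become dependent.
  refine ⟨fun p => (M p).det • ((M p).det • v₀ - ∑ j, y p j • e j),
    (isPoly_det hM).smul (((isPoly_det hM).smul (isPoly_const _)).sub
      (isPoly_sum _ fun j _ => (hy j).smul (isPoly_const _))), ?_, ?_, ?_⟩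
  · have h1 : M p₀ = 1 := by
      ext i j
      simp [M, he, Matrix.one_apply]
    simp [y, h1, hv₀]
  · intro p i
    have h2 : (M p).mulVec (y p) = (M p).det • (fun i => φ i p v₀) := by
      simp only [y, Matrix.mulVec_mulVec, Matrix.mul_adjugate, Matrix.smul_mulVec,
        Matrix.one_mulVec]
    have h3 := congrFun h2 i
    simp only [Matrix.mulVec, dotProduct, M, Pi.smul_apply, smul_eq_mul] at h3
    simp only [map_smul, map_sub, map_sum, smul_eq_mul]
    rw [show ∑ x, y p x * (φ i p) (e x) = (M p).det * (φ i p) v₀ by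
      rw [← h3]; exact Finset.sum_congr rfl fun _ _ => mul_comm _ _]
    simp
  · intro p hp
    have : (M p).det = 0 := by
      by_contra hd
      apply hp
      exact LinearIndependent.of_comp (LinearMap.pi (fun j => Module.Dual.eval ℂ F (e j)))
        (Matrix.linearIndependent_rows_of_det_ne_zero hd)
    simp [this]

theorem finrank_iInf_ker {ι : Type*} [Fintype ι] {φ : ι → Module.Dual ℂ F}
    (h : LinearIndependent ℂ φ) :
    Module.finrank ℂ (LinearMap.ker (LinearMap.pi φ)) + Fintype.card ι = Module.finrank ℂ F := by
  classical
  obtain ⟨e, he⟩ := exists_dual_basis h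
  have hs : LinearMap.range (LinearMap.pi φ) = ⊤ := by
    rw [LinearMap.range_eq_top]
    intro c
    refine ⟨∑ j, c j • e j, ?_⟩
    ext i
    simp [he]
  have := LinearMap.finrank_range_add_finrank_ker (LinearMap.pi φ)
  rw [hs, finrank_top, Module.finrank_pi] at this
  omega

end Cramer

/-! ### Tangent spaces, Zariski closure, genericity and dimension. -/

section Tangent

variable {E : Type u} [AddCommGroup E] [Module ℂ E] [FiniteDimensional ℂ E]
  {F : Type v} [AddCommGroup F] [Module ℂ F] [FiniteDimensional ℂ F]

/-- Finitely many independent equations cut out the tangent space at a point. -/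
theorem exists_tangent_equations (S : Set E) (p₀ : E) :
    ∃ (b : Set (Module.Dual ℂ E)) (f : b → E → ℂ), Finite b ∧ (∀ i, IsPoly (f i)) ∧
      (∀ i, ∀ q ∈ S, f i q = 0) ∧ LinearIndependent ℂ (fun i => pd (f i) p₀) ∧
      tangentSpace S p₀ = LinearMap.ker (LinearMap.pi (fun i => pd (f i) p₀)) := by
  let s : Set (Module.Dual ℂ E) := {φ | ∃ f : E → ℂ, IsPoly f ∧ (∀ q ∈ S, f q = 0) ∧ pd f p₀ = φ}
  obtain ⟨b, hbs, hspan, hli⟩ := exists_linearIndependent ℂ s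
  choose f hf using fun i : b => hbs i.2
  have hfi : (fun i => pd (f i) p₀) = ((↑) : b → Module.Dual ℂ E) := funext fun i => (hf i).2.2
  refine ⟨b, f, hli.finite, fun i => (hf i).1, fun i => (hf i).2.1, hfi ▸ hli, ?_⟩
  ext v
  rw [mem_tangentSpace, LinearMap.mem_ker]
  constructor
  · intro h
    ext i
    exact h _ (hf i).1 (hf i).2.1
  · intro h g hg hg0
    have hmem : (pd g p₀ : Module.Dual ℂ E) ∈ Submodule.span ℂ b := by
      rw [hspan]
      exact Submodule.subset_span ⟨g, hg, hg0, rfl⟩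
    have hle : Submodule.span ℂ b ≤ LinearMap.ker (Module.Dual.eval ℂ E v) := by
      rw [Submodule.span_le]
      intro φ hφ
      have := congrFun h ⟨φ, hφ⟩
      simp only [LinearMap.pi_apply, Pi.zero_apply, (hf ⟨φ, hφ⟩).2.2] at this
      simpa using this
    simpa using hle hmem

theorem tangentSpace_le_ker {S : Set E} {ι : Type*} {f : ι → E → ℂ} (hf : ∀ i, IsPoly (f i))
    (hf0 : ∀ i, ∀ q ∈ S, f i q = 0) (p : E) :
    tangentSpace S p ≤ LinearMap.ker (LinearMap.pi (fun i => pd (f i) p)) := by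
  intro v hv
  rw [LinearMap.mem_ker]
  ext i
  exact mem_tangentSpace.1 hv _ (hf i) (hf0 i)

/-- A tangent vector at a smooth point extends to a polynomial tangent vector field. -/
theorem exists_tangent_field {S : Set E} {p₀ : E} (hp : IsSmoothPt S p₀) {u₀ : E}
    (hu : u₀ ∈ tangentSpace S p₀) :
    ∃ u : E → E, IsPoly u ∧ u p₀ = u₀ ∧ ∀ p ∈ S, u p ∈ tangentSpace S p := by
  obtain ⟨b, f, hb, hf, hf0, hli, heq⟩ := exists_tangent_equations S p₀
  have := Fintype.ofFinite b
  have hu' : ∀ i, pd (f i) p₀ u₀ = 0 := fun i => by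
    rw [heq, LinearMap.mem_ker] at hu
    exact congrFun hu i
  obtain ⟨u, hup, hu0, hker, hdep⟩ := exists_poly_solution
    (φ := fun i x => (pd (f i) x : Module.Dual ℂ E)) (fun i => isPoly_pd (hf i)) hli hu'
  refine ⟨u, hup, hu0, fun p hpS => ?_⟩
  -- Where the equations stay independent their kernel has the dimension it has at `p₀`, which is
  -- minimal on `S`, so it is the whole tangent space. Elsewhere the Cramer field is zero.
  by_cases hd : LinearIndependent ℂ (fun i => (pd (f i) p : Module.Dual ℂ E))
  · have h1 := finrank_iInf_ker hli
    have h2 := finrank_iInf_ker hd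
    have h3 := hp.2 p hpS
    rw [heq] at h3
    have h4 := Submodule.eq_of_le_of_finrank_le (tangentSpace_le_ker hf hf0 p) (by
      have h5 : Module.finrank ℂ (LinearMap.ker (LinearMap.pi (fun i => pd (f i) p)))
        = Module.finrank ℂ (LinearMap.ker (LinearMap.pi (fun i => pd (f i) p₀))) := by
        have := h1.trans h2.symm
        exact (Nat.add_right_cancel this).symm
      rw [h5]
      exact h3)
    rw [h4, LinearMap.mem_ker]
    ext i
    exact hker p i
  · rw [hdep p hd]
    exact Submodule.zero_mem _

/-- Upper semicontinuity of the dimension of the tangent space. -/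
theorem exists_isPoly_finrank_le (S : Set E) (p₀ : E) :
    ∃ d : E → ℂ, IsPoly d ∧ d p₀ = 1 ∧ ∀ p, d p ≠ 0 →
      Module.finrank ℂ (tangentSpace S p) ≤ Module.finrank ℂ (tangentSpace S p₀) := by
  obtain ⟨b, f, hb, hf, hf0, hli, heq⟩ := exists_tangent_equations S p₀
  have := Fintype.ofFinite b
  obtain ⟨d, hd, hd0, hdl⟩ := exists_isPoly_linearIndependent
    (v := fun i x => (pd (f i) x : Module.Dual ℂ E)) (fun i => isPoly_pd (hf i)) hli
  refine ⟨d, hd, hd0, fun p hp => ?_⟩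
  have h1 := finrank_iInf_ker hli
  have h2 := finrank_iInf_ker (hdl p hp)
  rw [heq]
  refine (Submodule.finrank_mono (tangentSpace_le_ker hf hf0 p)).trans ?_
  exact (Nat.add_right_cancel (h2.trans h1.symm)).le

theorem tangentSpace_mono {S T : Set E} (h : S ⊆ T) (p : E) :
    tangentSpace S p ≤ tangentSpace T p := fun _ hv =>
  mem_tangentSpace.2 fun f hf h0 => mem_tangentSpace.1 hv f hf fun q hq => h0 q (h hq)

theorem pd_mem_tangentSpace {S : Set E} {T : Set F} {g : E → F} (hg : IsPoly g)
    (hgT : ∀ p ∈ S, g p ∈ T) {p v : E} (hv : v ∈ tangentSpace S p) :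
    pd g p v ∈ tangentSpace T (g p) :=
  mem_tangentSpace.2 fun f hf h0 => by
    have := mem_tangentSpace.1 hv (fun x => f (g x)) (hf.comp hg) fun q hq => h0 _ (hgT q hq)
    rwa [pd_comp hf hg] at this

/-- The Zariski closure. -/
def zcl (S : Set E) : Set E := {p | ∀ f : E → ℂ, IsPoly f → (∀ q ∈ S, f q = 0) → f p = 0}

/-- Irreducibility, tested on polynomials. -/
def Irr (S : Set E) : Prop := S.Nonempty ∧ ∀ f g : E → ℂ, IsPoly f → IsPoly g →
  (∃ p ∈ S, f p ≠ 0) → (∃ p ∈ S, g p ≠ 0) → ∃ p ∈ S, f p ≠ 0 ∧ g p ≠ 0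

/-- `P` holds on a nonempty principal open subset of `S`. -/
def Gen (S : Set E) (P : E → Prop) : Prop :=
  ∃ h : E → ℂ, IsPoly h ∧ (∃ p ∈ S, h p ≠ 0) ∧ ∀ p ∈ S, h p ≠ 0 → P p

theorem subset_zcl (S : Set E) : S ⊆ zcl S := fun p hp _ _ h => h p hp

theorem zcl_mono {S T : Set E} (h : S ⊆ T) : zcl S ⊆ zcl T :=
  fun _ hp f hf h0 => hp f hf fun q hq => h0 q (h hq)

theorem zcl_zcl (S : Set E) : zcl (zcl S) = zcl S :=
  (subset_zcl _).antisymm' fun _ hp f hf h0 => hp f hf fun _ hq => hq f hf h0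

theorem zcl_subset_zcl {S T : Set E} (h : S ⊆ zcl T) : zcl S ⊆ zcl T :=
  (zcl_mono h).trans (zcl_zcl T).subset

theorem vanish_zcl {S : Set E} {f : E → ℂ} (hf : IsPoly f) :
    (∀ q ∈ zcl S, f q = 0) ↔ ∀ q ∈ S, f q = 0 :=
  ⟨fun h q hq => h q (subset_zcl S hq), fun h _ hq => hq f hf h⟩

theorem exists_ne_zcl {S : Set E} {f : E → ℂ} (hf : IsPoly f) :
    (∃ q ∈ zcl S, f q ≠ 0) ↔ ∃ q ∈ S, f q ≠ 0 := by
  have := (vanish_zcl (S := S) hf).not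
  push Not at this
  exact this

theorem mem_zcl_of_map {S : Set E} {T : Set F} {g : E → F} (hg : IsPoly g)
    (hgT : ∀ p ∈ S, g p ∈ zcl T) {p : E} (hp : p ∈ zcl S) : g p ∈ zcl T :=
  fun f hf h0 => hp (fun x => f (g x)) (hf.comp hg) fun q hq => hgT q hq f hf h0

theorem tangentSpace_zcl (S : Set E) (p : E) : tangentSpace (zcl S) p = tangentSpace S p := by
  ext v
  rw [mem_tangentSpace, mem_tangentSpace]
  refine forall_congr' fun f => forall_congr' fun hf => ?_
  rw [vanish_zcl hf]

theorem tangentSpace_congr {S T : Set E} (h : zcl S = zcl T) (p : E) :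
    tangentSpace S p = tangentSpace T p := by
  rw [← tangentSpace_zcl S, h, tangentSpace_zcl]

theorem Irr.zcl {S : Set E} (h : Irr S) : Irr (zcl S) := by
  refine ⟨h.1.mono (subset_zcl S), fun f g hf hg hf' hg' => ?_⟩
  obtain ⟨p, hp, h1⟩ := h.2 f g hf hg ((exists_ne_zcl hf).1 hf') ((exists_ne_zcl hg).1 hg')
  exact ⟨p, subset_zcl S hp, h1⟩

theorem Irr.of_zcl_eq {S T : Set E} (h : Irr S) (hST : Focal.zcl S = Focal.zcl T) : Irr T := by
  have hne : T.Nonempty := by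
    obtain ⟨p, hp⟩ := h.1
    by_contra hT
    rw [Set.not_nonempty_iff_eq_empty] at hT
    have := hST ▸ subset_zcl S hp
    subst hT
    exact one_ne_zero (this (fun _ => 1) (isPoly_const 1) (by simp))
  refine ⟨hne, fun f g hf hg hf' hg' => ?_⟩
  have h1 := (exists_ne_zcl hf).2 hf'
  have h2 := (exists_ne_zcl hg).2 hg'
  rw [← hST] at h1 h2
  have h3 := h.zcl.2 f g hf hg h1 h2
  obtain ⟨p, hp, hp'⟩ := h3
  have h4 : ∃ q ∈ Focal.zcl T, f q * g q ≠ 0 := ⟨p, hST ▸ hp, mul_ne_zero hp'.1 hp'.2⟩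
  obtain ⟨q, hq, hq'⟩ := (exists_ne_zcl (isPoly_mul hf hg)).1 h4
  exact ⟨q, hq, left_ne_zero_of_mul hq', right_ne_zero_of_mul hq'⟩

theorem Irr.image {S : Set E} (h : Irr S) {g : E → F} (hg : IsPoly g) : Irr (g '' S) := by
  refine ⟨h.1.image g, ?_⟩
  rintro a b ha hb ⟨_, ⟨p, hp, rfl⟩, hap⟩ ⟨_, ⟨q, hq, rfl⟩, hbq⟩
  obtain ⟨r, hr, h1, h2⟩ := h.2 _ _ (ha.comp hg) (hb.comp hg) ⟨p, hp, hap⟩ ⟨q, hq, hbq⟩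
  exact ⟨g r, ⟨r, hr, rfl⟩, h1, h2⟩

theorem Gen.mono {S : Set E} {P Q : E → Prop} (h : Gen S P) (hPQ : ∀ p ∈ S, P p → Q p) :
    Gen S Q := by
  obtain ⟨f, hf, hne, h⟩ := h
  exact ⟨f, hf, hne, fun p hp h1 => hPQ p hp (h p hp h1)⟩

theorem Gen.and {S : Set E} (hS : Irr S) {P Q : E → Prop} (hP : Gen S P) (hQ : Gen S Q) :
    Gen S (fun p => P p ∧ Q p) := by
  obtain ⟨f, hf, hfne, hfP⟩ := hP
  obtain ⟨g, hg, hgne, hgQ⟩ := hQ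
  obtain ⟨p, hp, h1, h2⟩ := hS.2 f g hf hg hfne hgne
  exact ⟨fun x => f x * g x, isPoly_mul hf hg, ⟨p, hp, mul_ne_zero h1 h2⟩, fun q hq hq' =>
    ⟨hfP q hq (left_ne_zero_of_mul hq'), hgQ q hq (right_ne_zero_of_mul hq')⟩⟩

theorem Gen.exists {S : Set E} {P : E → Prop} (h : Gen S P) : ∃ p ∈ S, P p := by
  obtain ⟨f, _, ⟨p, hp, hfp⟩, h⟩ := h
  exact ⟨p, hp, h p hp hfp⟩

theorem Gen.of_forall {S : Set E} (hS : S.Nonempty) {P : E → Prop} (h : ∀ p ∈ S, P p) : Gen S P :=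
  ⟨fun _ => 1, isPoly_const 1, hS.imp fun _ hp => ⟨hp, one_ne_zero⟩, fun p hp _ => h p hp⟩

theorem Gen.vanish {S : Set E} (hS : Irr S) {f : E → ℂ} (hf : IsPoly f)
    (h : Gen S (fun p => f p = 0)) : ∀ p ∈ S, f p = 0 := by
  intro p hp
  by_contra hne
  obtain ⟨g, hg, hgne, hg0⟩ := h
  obtain ⟨q, hq, h1, h2⟩ := hS.2 f g hf hg ⟨p, hp, hne⟩ hgne
  exact h1 (hg0 q hq h2)

theorem Gen.zcl_eq {S : Set E} (hS : Irr S) {P : E → Prop} (h : Gen S P) :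
    zcl {p | p ∈ S ∧ P p} = zcl S := by
  refine (zcl_mono fun p hp => hp.1).antisymm fun p hp f hf h0 => hp f hf ?_
  exact Gen.vanish hS hf (h.mono fun q hq hPq => h0 q ⟨hq, hPq⟩)

theorem Gen.of_zcl {S : Set E} {P : E → Prop} (h : Gen (zcl S) P) : Gen S P := by
  obtain ⟨f, hf, hne, h⟩ := h
  exact ⟨f, hf, (exists_ne_zcl hf).1 hne, fun p hp h1 => h p (subset_zcl S hp) h1⟩

theorem Gen.of_image {S : Set E} {g : E → F} (hg : IsPoly g) {P : F → Prop}
    (h : Gen (g '' S) P) : Gen S (fun p => P (g p)) := by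
  obtain ⟨f, hf, ⟨_, ⟨p, hp, rfl⟩, hfp⟩, h⟩ := h
  exact ⟨fun x => f (g x), hf.comp hg, ⟨p, hp, hfp⟩, fun q hq h1 => h _ ⟨q, hq, rfl⟩ h1⟩

/-- The smallest dimension of a tangent space at a point of `S`. -/
noncomputable def gdim (S : Set E) : ℕ :=
  sInf {n | ∃ p ∈ S, Module.finrank ℂ (tangentSpace S p) = n}

theorem gdim_le {S : Set E} {p : E} (hp : p ∈ S) :
    gdim S ≤ Module.finrank ℂ (tangentSpace S p) := Nat.sInf_le ⟨p, hp, rfl⟩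

theorem isSmoothPt_iff {S : Set E} {p : E} :
    IsSmoothPt S p ↔ p ∈ S ∧ Module.finrank ℂ (tangentSpace S p) = gdim S := by
  constructor
  · rintro ⟨hp, h⟩
    refine ⟨hp, le_antisymm ?_ (gdim_le hp)⟩
    obtain ⟨q, hq, hq'⟩ := Nat.sInf_mem (s := {n | ∃ p ∈ S,
      Module.finrank ℂ (tangentSpace S p) = n}) ⟨_, p, hp, rfl⟩
    rw [gdim, ← hq']
    exact h q hq
  · rintro ⟨hp, h⟩
    exact ⟨hp, fun q hq => h ▸ gdim_le hq⟩

theorem exists_isSmoothPt {S : Set E} (hS : S.Nonempty) : ∃ p, IsSmoothPt S p := by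
  obtain ⟨p, hp⟩ := hS
  obtain ⟨q, hq, hq'⟩ := Nat.sInf_mem (s := {n | ∃ p ∈ S,
      Module.finrank ℂ (tangentSpace S p) = n}) ⟨_, p, hp, rfl⟩
  exact ⟨q, isSmoothPt_iff.2 ⟨hq, hq'⟩⟩

theorem IsSmoothPt.nhd {S : Set E} {p₀ : E} (h : IsSmoothPt S p₀) :
    ∃ d : E → ℂ, IsPoly d ∧ d p₀ = 1 ∧ ∀ p ∈ S, d p ≠ 0 → IsSmoothPt S p := by
  obtain ⟨d, hd, hd0, hle⟩ := exists_isPoly_finrank_le S p₀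
  exact ⟨d, hd, hd0, fun p hp hdp => ⟨hp, fun q hq => (hle p hdp).trans (h.2 q hq)⟩⟩

theorem gen_isSmoothPt {S : Set E} (hS : S.Nonempty) : Gen S (IsSmoothPt S) := by
  obtain ⟨p, hp⟩ := exists_isSmoothPt hS
  obtain ⟨d, hd, hd0, h⟩ := hp.nhd
  exact ⟨d, hd, ⟨p, hp.1, hd0 ▸ one_ne_zero⟩, h⟩

/-- The minimum over the closure is attained on a nonempty open subset, which meets `S`; passing to
the closure does not change tangent spaces. -/
theorem gdim_zcl {S : Set E} (hS : Irr S) : gdim (zcl S) = gdim S := by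
  obtain ⟨p, hp, h⟩ := (gen_isSmoothPt hS.zcl.1).of_zcl.exists
  obtain ⟨q, hq⟩ := exists_isSmoothPt hS.1
  have h1 := gdim_le (subset_zcl S hq.1)
  have h2 := gdim_le hp
  have h3 := (isSmoothPt_iff.1 h).2
  have h4 := (isSmoothPt_iff.1 hq).2
  rw [tangentSpace_zcl] at h1 h3
  omega

theorem gdim_congr {S T : Set E} (hS : Irr S) (h : zcl S = zcl T) : gdim S = gdim T := by
  rw [← gdim_zcl hS, h, gdim_zcl (hS.of_zcl_eq h)]

theorem IsSmoothPt.to_zcl {S : Set E} (hS : Irr S) {p : E} 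
    (h : IsSmoothPt S p) : IsSmoothPt (zcl S) p := by
  rw [isSmoothPt_iff] at h ⊢
  exact ⟨subset_zcl S h.1, by rw [tangentSpace_zcl, h.2, gdim_zcl hS]⟩

end Tangent

/-! ### The Zariski topology in terms of polynomials. -/

section Topology

variable {E : Type u} [AddCommGroup E] [Module ℂ E] [FiniteDimensional ℂ E]

theorem zariski_basis : @TopologicalSpace.IsTopologicalBasis E (zariski E)
    {U | ∃ f ∈ polyFun E, U = {v | f v ≠ 0}} := by
  let _ := zariski E
  refine ⟨?_, ?_, rfl⟩
  · rintro _ ⟨f, hf, rfl⟩ _ ⟨g, hg, rfl⟩ x hx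
    refine ⟨{v | (f * g) v ≠ 0}, ⟨f * g, Subalgebra.mul_mem _ hf hg, rfl⟩, ?_, ?_⟩
    · exact mul_ne_zero hx.1 hx.2
    · intro y hy
      exact ⟨left_ne_zero_of_mul hy, right_ne_zero_of_mul hy⟩
  · refine Set.eq_univ_of_forall fun x => ?_
    exact ⟨_, ⟨1, Subalgebra.one_mem _, rfl⟩, by simp⟩

theorem isOpen_zariski_iff {U : Set E} : IsOpen[zariski E] U ↔
    ∀ p ∈ U, ∃ f : E → ℂ, IsPoly f ∧ f p ≠ 0 ∧ ∀ q, f q ≠ 0 → q ∈ U := by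
  let _ := zariski E
  rw [zariski_basis.isOpen_iff]
  refine forall₂_congr fun p _ => ?_
  constructor
  · rintro ⟨_, ⟨f, hf, rfl⟩, hp, hU⟩
    exact ⟨f, isPoly_scalar.2 hf, hp, fun q hq => hU hq⟩
  · rintro ⟨f, hf, hp, hU⟩
    exact ⟨_, ⟨f, isPoly_scalar.1 hf, rfl⟩, hp, fun q hq => hU q hq⟩

theorem isClosed_zariski_iff {S : Set E} : IsClosed[zariski E] S ↔ zcl S ⊆ S := by
  let _ := zariski E
  rw [← isOpen_compl_iff, isOpen_zariski_iff]
  constructor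
  · intro h p hp
    by_contra hpS
    obtain ⟨f, hf, hfp, hU⟩ := h p hpS
    refine hfp (hp f hf fun q hq => ?_)
    by_contra hne
    exact hU q hne hq
  · intro h p hp
    have : p ∉ zcl S := fun h' => hp (h h')
    simp only [zcl, Set.mem_ofPred_eq] at this
    push Not at this
    obtain ⟨f, hf, h0, hne⟩ := this
    exact ⟨f, hf, hne, fun q hq hqS => hq (h0 q hqS)⟩

theorem closure_zariski (S : Set E) : @closure E (zariski E) S = zcl S := by
  let _ := zariski E
  apply Set.Subset.antisymm
  · refine closure_minimal (subset_zcl S) (isClosed_zariski_iff.2 (zcl_zcl S).subset)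
  · exact (zcl_mono subset_closure).trans (isClosed_zariski_iff.1 isClosed_closure)

theorem isIrreducible_zariski_iff {S : Set E} : @IsIrreducible E (zariski E) S ↔ Irr S := by
  let _ := zariski E
  refine and_congr_right fun _ => ?_
  constructor
  · intro h f g hf hg hf' hg'
    obtain ⟨p, hp, h1, h2⟩ := h {v | f v ≠ 0} {v | g v ≠ 0}
      (zariski_basis.isOpen ⟨f, isPoly_scalar.1 hf, rfl⟩)
      (zariski_basis.isOpen ⟨g, isPoly_scalar.1 hg, rfl⟩) hf' hg'
    exact ⟨p, hp, h1, h2⟩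
  · rintro h U V hU hV ⟨p, hp, hpU⟩ ⟨q, hq, hqV⟩
    obtain ⟨f, hf, hfp, hfU⟩ := isOpen_zariski_iff.1 hU p hpU
    obtain ⟨g, hg, hgq, hgV⟩ := isOpen_zariski_iff.1 hV q hqV
    obtain ⟨r, hr, h1, h2⟩ := h f g hf hg ⟨p, hp, hfp⟩ ⟨q, hq, hgq⟩
    exact ⟨r, hr, hfU r h1, hgV r h2⟩

end Topology

/-! ### Extension of derivations in characteristic zero. -/

section Algebra

/-- Formal smoothness of finitely generated field extensions in characteristic zero, as a lifting
property along nilpotent thickenings. -/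
theorem exists_ringHom_lift {K₀ K R : Type*} [Field K₀] [Field K] [CommRing R] [Algebra ℂ K₀]
    [Algebra ℂ K] [Algebra.EssFiniteType ℂ K] (α : K₀ →+* R) (π : R →+* K)
    (hπ : Function.Surjective π) (hn : IsNilpotent (RingHom.ker π))
    (hα : ∀ c : ℂ, π (α (algebraMap ℂ K₀ c)) = algebraMap ℂ K c) :
    ∃ θ : K →+* R, (∀ x, π (θ x) = x) ∧ ∀ y, θ (π (α y)) = α y := by
  let _ : Algebra K₀ R := α.toAlgebra
  let _ : Algebra K₀ K := (π.comp α).toAlgebra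
  -- Characteristic zero together with essential finite type makes `K` formally smooth over `K₀`;
  -- the lift below is of the identity of `K`.
  have : CharZero K₀ := charZero_of_injective_algebraMap (algebraMap ℂ K₀).injective
  have : IsScalarTower ℂ K₀ K := IsScalarTower.of_algebraMap_eq fun c => (hα c).symm
  have : Algebra.EssFiniteType K₀ K := Algebra.EssFiniteType.of_comp ℂ K₀ K
  let π' : R →ₐ[K₀] K := { π with commutes' := fun _ => rfl }
  let θ := Algebra.FormallySmooth.liftOfSurjective (AlgHom.id K₀ K) π' hπ hn
  refine ⟨θ, fun x => ?_, fun y => θ.commutes y⟩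
  exact Algebra.FormallySmooth.liftOfSurjective_apply (AlgHom.id K₀ K) π' hπ hn x

/-- A ring map into the dual numbers over a fraction field encodes a derivation. `Ψ` extends to the
fraction field of `A₀` because a dual number is a unit as soon as its first component is, and the
extension lifts along the square-zero ideal. -/
theorem exists_tsze_lift {A₀ A : Type*} [CommRing A₀] [IsDomain A₀] [CommRing A] [IsDomain A]
    [Algebra ℂ A₀] [Algebra ℂ A] [Algebra.FiniteType ℂ A] (φ : A₀ →+* A)
    (hφ : Function.Injective φ) (hφc : ∀ c : ℂ, φ (algebraMap ℂ A₀ c) = algebraMap ℂ A c)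
    (Ψ : A₀ →+* TrivSqZeroExt (FractionRing A) (FractionRing A))
    (hΨ : ∀ a, (Ψ a).fst = algebraMap A (FractionRing A) (φ a)) :
    ∃ Θ : A →+* TrivSqZeroExt (FractionRing A) (FractionRing A),
      (∀ a, (Θ a).fst = algebraMap A (FractionRing A) a) ∧ ∀ a, Θ (φ a) = Ψ a := by
  let K := FractionRing A
  let α : FractionRing A₀ →+* TrivSqZeroExt K K :=
    IsLocalization.lift (M := nonZeroDivisors A₀) (g := Ψ) (fun y => by
      rw [TrivSqZeroExt.isUnit_iff_isUnit_fst, hΨ, isUnit_iff_ne_zero]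
      intro h
      have h1 := (map_eq_zero_iff _ (IsFractionRing.injective A (FractionRing A))).1 h
      exact nonZeroDivisors.ne_zero y.2 ((map_eq_zero_iff φ hφ).1 h1))
  have hα : ∀ a, α (algebraMap _ _ a) = Ψ a := fun a => IsLocalization.lift_eq _ _
  let π : TrivSqZeroExt K K →+* K := (TrivSqZeroExt.fstHom K K K).toRingHom
  have : Algebra.EssFiniteType A K := .of_isLocalization _ (nonZeroDivisors A)
  have : Algebra.EssFiniteType ℂ K := .comp ℂ A K
  obtain ⟨θ, h1, h2⟩ := exists_ringHom_lift α π TrivSqZeroExt.fst_surjective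
    ⟨2, TrivSqZeroExt.kerIdeal_sq K K⟩ (fun c => by
      rw [IsScalarTower.algebraMap_apply ℂ A₀ (FractionRing A₀), hα]
      refine (hΨ _).trans ?_
      rw [hφc, ← IsScalarTower.algebraMap_apply])
  refine ⟨θ.comp (algebraMap A K), fun a => h1 _, fun a => ?_⟩
  have := h2 (algebraMap _ _ a)
  rw [hα] at this
  rw [← this]
  exact congrArg θ (hΨ a).symm

end Algebra

/-! ### Vanishing ideals, the Nullstellensatz, and the theorems of Seidenberg and Krull. -/

section Ideal

variable {E : Type u} [AddCommGroup E] [Module ℂ E]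

/-- The ideal of polynomial functions vanishing on `S`. -/
def vI (S : Set E) : Ideal (polyFun E) where
  carrier := {f | ∀ p ∈ S, f.1 p = 0}
  add_mem' := fun ha hb p hp => by simp [ha p hp, hb p hp]
  zero_mem' := fun _ _ => rfl
  smul_mem' := fun c a ha p hp => by simp [ha p hp]

theorem mem_vI {S : Set E} {f : polyFun E} : f ∈ vI S ↔ ∀ p ∈ S, f.1 p = 0 := Iff.rfl

theorem polyFun_isPoly (f : polyFun E) : IsPoly f.1 := isPoly_scalar.2 f.2

theorem vI_isPrime [FiniteDimensional ℂ E] {S : Set E} (hS : Irr S) : (vI S).IsPrime := by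
  refine ⟨?_, ?_⟩
  · rw [Ideal.ne_top_iff_one]
    obtain ⟨p, hp⟩ := hS.1
    exact fun h => one_ne_zero (h p hp)
  · intro f g hfg
    by_contra! h
    simp only [mem_vI] at h
    push Not at h
    obtain ⟨p, hp, h1, h2⟩ := hS.2 f.1 g.1 (polyFun_isPoly f) (polyFun_isPoly g) h.1 h.2
    exact mul_ne_zero h1 h2 (hfg p hp)

theorem mkvI_eq_zero {S : Set E} {f : polyFun E} :
    Ideal.Quotient.mk (vI S) f = 0 ↔ ∀ p ∈ S, f.1 p = 0 := Ideal.Quotient.eq_zero_iff_mem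

variable [FiniteDimensional ℂ E]

/-- Polynomial functions as polynomials in coordinates. -/
noncomputable def mvToPoly (E : Type u) [AddCommGroup E] [Module ℂ E] [FiniteDimensional ℂ E] :
    MvPolynomial (Fin (Module.finrank ℂ E)) ℂ →ₐ[ℂ] polyFun E :=
  MvPolynomial.aeval fun i => ⟨fun x => (Module.finBasis ℂ E).coord i x,
    isPoly_scalar.1 (isPoly_linear _)⟩

theorem mvToPoly_apply (f : MvPolynomial (Fin (Module.finrank ℂ E)) ℂ) (x : E) :
    (mvToPoly E f).1 x = MvPolynomial.aeval (fun i => (Module.finBasis ℂ E).coord i x) f := by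
  induction f using MvPolynomial.induction_on with
  | C a => simp [mvToPoly]
  | add f g hf hg => simp [hf, hg]
  | mul_X f i hf => simp [hf]; left; simp [mvToPoly]

theorem mvToPoly_surjective : Function.Surjective (mvToPoly E) := by
  rintro ⟨f, hf⟩
  change f ∈ Algebra.adjoin ℂ _ at hf
  suffices h : ∃ g, (mvToPoly E g).1 = f by
    obtain ⟨g, hg⟩ := h
    exact ⟨g, Subtype.ext hg⟩
  induction hf using Algebra.adjoin_induction with
  | mem f hf =>
    obtain ⟨φ, rfl⟩ := hf
    refine ⟨∑ i, MvPolynomial.C (φ (Module.finBasis ℂ E i)) * MvPolynomial.X i, ?_⟩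
    ext x
    rw [mvToPoly_apply]
    conv_rhs => rw [← (Module.finBasis ℂ E).sum_repr x, map_sum]
    simp only [map_sum, map_mul, MvPolynomial.aeval_C, MvPolynomial.aeval_X, map_smul,
      Module.Basis.coord_apply, smul_eq_mul, Algebra.algebraMap_self, RingHom.id_apply]
    exact Finset.sum_congr rfl fun _ _ => mul_comm _ _
  | algebraMap c => exact ⟨MvPolynomial.C c, by ext x; rw [mvToPoly_apply]; simp⟩
  | add f g _ _ hf hg =>
    obtain ⟨a, rfl⟩ := hf
    obtain ⟨b, rfl⟩ := hg
    exact ⟨a + b, by simp⟩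
  | mul f g _ _ hf hg =>
    obtain ⟨a, rfl⟩ := hf
    obtain ⟨b, rfl⟩ := hg
    exact ⟨a * b, by simp⟩

instance : IsNoetherianRing (polyFun E) :=
  isNoetherianRing_of_surjective _ _ (mvToPoly E).toRingHom mvToPoly_surjective

instance : Algebra.FiniteType ℂ (polyFun E) :=
  Algebra.FiniteType.of_surjective (mvToPoly E) mvToPoly_surjective

instance (I : Ideal (polyFun E)) : Algebra.FiniteType ℂ (polyFun E ⧸ I) :=
  Algebra.FiniteType.of_surjective (Ideal.Quotient.mkₐ ℂ I) (Ideal.Quotient.mkₐ_surjective ℂ I)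

/-- The zero set of an ideal. -/
def zeroSet (I : Ideal (polyFun E)) : Set E := {p | ∀ f ∈ I, f.1 p = 0}

/-- Hilbert's Nullstellensatz for a prime ideal. -/
theorem vI_zeroSet (P : Ideal (polyFun E)) [hP : P.IsPrime] : vI (zeroSet P) = P := by
  refine le_antisymm (fun f hf => ?_) fun f hf p hp => hp f hf
  obtain ⟨g, rfl⟩ := mvToPoly_surjective f
  have hQ : (P.comap (mvToPoly E).toRingHom).IsPrime := Ideal.comap_isPrime _ _
  have h := MvPolynomial.IsPrime.vanishingIdeal_zeroLocus (K := ℂ) (P.comap (mvToPoly E).toRingHom)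
  change g ∈ P.comap (mvToPoly E).toRingHom
  rw [← h, MvPolynomial.mem_vanishingIdeal_iff]
  intro x hx
  rw [MvPolynomial.mem_zeroLocus_iff] at hx
  let b := Module.finBasis ℂ E
  have hb : ∀ i, b.coord i (b.equivFun.symm x) = x i := fun i => by
    rw [Module.Basis.coord_apply, ← Module.Basis.equivFun_apply, LinearEquiv.apply_symm_apply]
  have := hf (b.equivFun.symm x) (fun k hk => by
    obtain ⟨k, rfl⟩ := mvToPoly_surjective k
    rw [mvToPoly_apply]
    have := hx k hk
    simpa only [b, hb] using this)
  rw [mvToPoly_apply] at this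
  simpa only [b, hb] using this

/-- By the Nullstellensatz the vanishing ideal of the zero set is `P` itself, so primality becomes
irreducibility. -/
theorem irr_zeroSet (P : Ideal (polyFun E)) [hP : P.IsPrime] : Irr (zeroSet P) := by
  have hv := vI_zeroSet P
  refine ⟨?_, fun f g hf hg hf' hg' => ?_⟩
  · by_contra h
    rw [Set.not_nonempty_iff_eq_empty] at h
    apply hP.ne_top
    rw [← hv, h, Ideal.eq_top_iff_one]
    simp [mem_vI]
  · by_contra! h
    have hm : (⟨f, isPoly_scalar.1 hf⟩ * ⟨g, isPoly_scalar.1 hg⟩ : polyFun E) ∈ vI (zeroSet P) := by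
      intro p hp
      by_cases h1 : f p = 0
      · simp [h1]
      · simp [h p hp h1]
    rw [hv] at hm
    rcases hP.mem_or_mem hm with h1 | h1
    · obtain ⟨p, hp, h2⟩ := hf'
      exact h2 (hp _ h1)
    · obtain ⟨p, hp, h2⟩ := hg'
      exact h2 (hp _ h1)

theorem zcl_eq_of_vI_eq {S T : Set E} (h : vI S = vI T) : zcl S = zcl T := by
  have key : ∀ f : E → ℂ, IsPoly f → ((∀ q ∈ S, f q = 0) ↔ ∀ q ∈ T, f q = 0) := fun f hf => by
    have := SetLike.ext_iff.1 h ⟨f, isPoly_scalar.1 hf⟩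
    simpa only [mem_vI] using this
  ext p
  exact forall_congr' fun f => forall_congr' fun hf => by rw [key f hf]

/-- A maximal irreducible closed subset of `{δ = 0} ∩ W` corresponds to a minimal prime. -/
theorem vI_mem_minimalPrimes {W Z : Set E} (hZ : Irr Z) (hZW : Z ⊆ zcl W) {δ : E → ℂ}
    (hδ : IsPoly δ) (hδZ : ∀ p ∈ Z, δ p = 0)
    (hmax : ∀ T : Set E, Irr T → T ⊆ zcl W → (∀ p ∈ T, δ p = 0) → Z ⊆ T → T ⊆ zcl Z) :
    vI Z ∈ (vI W ⊔ Ideal.span {⟨δ, isPoly_scalar.1 hδ⟩}).minimalPrimes := by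
  refine ⟨⟨vI_isPrime hZ, sup_le ?_ ?_⟩, ?_⟩
  · exact fun f hf p hp => hZW hp _ (polyFun_isPoly f) hf
  · rw [Ideal.span_singleton_le_iff_mem]
    exact hδZ
  -- The zero set of a smaller prime is irreducible and contains `Z`, so maximality puts it in the
  -- closure of `Z`; the Nullstellensatz turns this back into an inclusion of ideals.
  · rintro P ⟨hP, hle⟩ hPZ
    have h1 := hmax (zeroSet P) (irr_zeroSet P) (fun p hp f hf h0 =>
      hp ⟨f, isPoly_scalar.1 hf⟩ (hle (Ideal.mem_sup_left h0)))
      (fun p hp => hp _ (hle (Ideal.mem_sup_right (Ideal.mem_span_singleton_self _))))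
      (fun p hp f hf => hPZ hf p hp)
    intro f hf
    rw [← vI_zeroSet P]
    exact fun p hp => h1 hp _ (polyFun_isPoly f) hf

/-- In the localization at `P` the radical of `I` is `P`, so `f` becomes nilpotent modulo `I` there.
Otherwise a prime over `I` avoiding both `f` and the complement of `P` would be a smaller prime. -/
theorem exists_pow_mul_mem_of_mem_minimalPrimes {R : Type*} [CommRing R] {I P : Ideal R}
    (hP : P ∈ I.minimalPrimes) {f : R} (hf : f ∈ P) : ∃ k : ℕ, ∃ g ∉ P, f ^ k * g ∈ I := by
  by_contra! h
  have := hP.1.1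
  obtain ⟨Q, hQ, hIQ, hd⟩ := Ideal.exists_le_prime_disjoint I
    (Submonoid.powers f ⊔ P.primeCompl) (by
      rw [Set.disjoint_left]
      intro x hx hx'
      obtain ⟨_, ⟨k, rfl⟩, g, hg, rfl⟩ := Submonoid.mem_sup.1 hx'
      exact h k g hg hx)
  rw [Set.disjoint_left] at hd
  have hQP : Q ≤ P := fun x hx => by
    by_contra hxP
    exact hd hx (Submonoid.mem_sup_right (S := Submonoid.powers f) hxP)
  exact hd (hP.2 ⟨hQ, hIQ⟩ hQP hf) (Submonoid.mem_sup_left (Submonoid.mem_powers f))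

/-- Seidenberg: a minimal prime over a differential ideal is a differential ideal
(characteristic zero). -/
theorem derivation_mem_of_mem_minimalPrimes {R : Type*} [CommRing R] [Algebra ℂ R]
    (D : Derivation ℂ R R) {I P : Ideal R} (hI : ∀ f ∈ I, D f ∈ I) (hP : P ∈ I.minimalPrimes)
    {f : R} (hf : f ∈ P) : D f ∈ P := by
  have := hP.1.1
  by_contra hD
  obtain ⟨k, g, hg, hk⟩ := exists_pow_mul_mem_of_mem_minimalPrimes hP hf
  -- Descent on the exponent: `g * D (f ^ (k+1) * g) - D g * (f ^ (k+1) * g)` equals `(k+1) * f ^ k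
  -- * (g * g * D f)`. The integer is invertible, and `g * g * D f` is again outside `P`.
  have key : ∀ k : ℕ, ∀ g ∉ P, f ^ k * g ∉ I := by
    intro k
    induction k with
    | zero => intro g hg h; exact hg (hP.1.2 (by simpa using h))
    | succ k ih =>
      intro g hg h
      refine ih (g * g * D f) (fun h' => ?_) ?_
      · rcases this.mem_or_mem h' with h1 | h1
        · rcases this.mem_or_mem h1 with h2 | h2 <;> exact hg h2
        · exact hD h1
      · have h1 := hI _ h
        rw [D.leibniz, D.leibniz_pow] at h1
        simp only [smul_eq_mul, nsmul_eq_mul, Nat.add_sub_cancel] at h1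
        have h2 : ((k + 1 : ℕ) : R) * (f ^ k * (g * g * D f)) ∈ I := by
          have h3 := I.sub_mem (I.mul_mem_left g h1) (I.mul_mem_left (D g) h)
          convert! h3 using 1
          ring
        have h4 := I.mul_mem_left (algebraMap ℂ R ((k + 1 : ℕ) : ℂ)⁻¹) h2
        rw [← mul_assoc, ← map_natCast (algebraMap ℂ R) (k + 1), ← map_mul,
          inv_mul_cancel₀ (Nat.cast_ne_zero.2 k.succ_ne_zero), map_one, one_mul] at h4
        exact h4
  exact key k g hg hk

/-- The derivation of the algebra of polynomial functions given by a vector field. -/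
noncomputable def fieldDerivation (a : E → E) (ha : IsPoly a) :
    Derivation ℂ (polyFun E) (polyFun E) :=
  Derivation.mk'
    { toFun := fun f => ⟨fun x => pd f.1 x (a x),
        isPoly_scalar.1 (isPoly_pd_field (polyFun_isPoly f) ha)⟩
      map_add' := fun f g => by
        ext x
        exact congrArg (· (a x)) (pd_add (polyFun_isPoly f) (polyFun_isPoly g) x)
      map_smul' := fun c f => by
        ext x
        have := pd_smul (isPoly_const (E := E) c) (polyFun_isPoly f) x (a x)
        simp only [pd_const] at this
        simpa using! this }
    (fun f g => by
      ext x
      have := pd_mul (polyFun_isPoly f) (polyFun_isPoly g) x (a x)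
      refine this.trans ?_
      simp only [LinearMap.coe_mk, AddHom.coe_mk, smul_eq_mul, MulMemClass.coe_mul,
        AddMemClass.coe_add, Pi.add_apply, Pi.mul_apply]
      ring)

/-- A vector field tangent to `W` and to the level sets of `t` is tangent to the components of
`W ∩ {t = 0}`. -/
theorem field_tangent_component {W Z : Set E} (hZ : Irr Z) (hZW : Z ⊆ zcl W) {t : E → ℂ}
    (ht : IsPoly t) (htZ : ∀ p ∈ Z, t p = 0)
    (hmax : ∀ T : Set E, Irr T → T ⊆ zcl W → (∀ p ∈ T, t p = 0) → Z ⊆ T → T ⊆ zcl Z)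
    {a : E → E} (ha : IsPoly a) (haW : ∀ p ∈ W, a p ∈ tangentSpace W p)
    (hat : ∀ p ∈ W, pd t p (a p) = 0) {p : E} (hp : p ∈ Z) : a p ∈ tangentSpace Z p := by
  rw [mem_tangentSpace]
  intro f hf h0
  have h := derivation_mem_of_mem_minimalPrimes (fieldDerivation a ha) ?_
    (vI_mem_minimalPrimes hZ hZW ht htZ hmax) (f := ⟨f, isPoly_scalar.1 hf⟩) h0
  · exact h p hp
  -- The ideal generated by `vI W` and `t` is differential: tangency to `W` preserves `vI W`, and
  -- the derivative of `t` lies in `vI W`.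
  · intro g hg
    rw [Submodule.mem_sup] at hg ⊢
    obtain ⟨y, hy, z, hz, rfl⟩ := hg
    obtain ⟨c, rfl⟩ := Ideal.mem_span_singleton'.1 hz
    rw [map_add, Derivation.leibniz]
    refine ⟨fieldDerivation a ha y + c • fieldDerivation a ha ⟨t, isPoly_scalar.1 ht⟩, ?_, _,
      Ideal.mem_span_singleton'.2 ⟨fieldDerivation a ha c, rfl⟩, ?_⟩
    · refine Ideal.add_mem _ (fun p hp => ?_) (Ideal.mul_mem_left _ _ hat)
      exact mem_tangentSpace.1 (haW p hp) _ (polyFun_isPoly y) hy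
    · simp only [smul_eq_mul]; ring

/-- Krull's principal ideal theorem, relative to a prime ideal. -/
theorem eq_of_mem_minimalPrimes_sup_span {R : Type*} [CommRing R] [IsNoetherianRing R]
    {J Q P : Ideal R} [J.IsPrime] [hQ : Q.IsPrime] {δ : R}
    (hmin : P ∈ (J ⊔ Ideal.span {δ}).minimalPrimes) (hJQ : J < Q) (hQP : Q ≤ P) : Q = P := by
  have hP := hmin.1.1
  let π := Ideal.Quotient.mk J
  have hsurj : Function.Surjective π := Ideal.Quotient.mk_surjective
  have hker : RingHom.ker π = J := Ideal.mk_ker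
  have hcomap : ∀ I : Ideal R, J ≤ I → (I.map π).comap π = I := fun I hI => by
    rw [Ideal.comap_map_of_surjective' π hsurj, hker, sup_eq_left]
    exact hI
  have hP' : (P.map π).IsPrime :=
    Ideal.map_isPrime_of_surjective hsurj (hker.le.trans (hJQ.le.trans hQP))
  have hQ' : (Q.map π).IsPrime := Ideal.map_isPrime_of_surjective hsurj (hker.le.trans hJQ.le)
  have hcP := hcomap P (hJQ.le.trans hQP)
  have hcQ := hcomap Q hJQ.le
  have hminq : P.map π ∈ (Ideal.span {π δ}).minimalPrimes := by
    refine ⟨⟨hP', ?_⟩, ?_⟩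
    · rw [Ideal.span_singleton_le_iff_mem]
      exact Ideal.mem_map_of_mem _ (hmin.1.2 (Ideal.mem_sup_right (Ideal.mem_span_singleton_self _)))
    · rintro P' ⟨hP', hle⟩ hPZ'
      have h1 : P'.comap π ≤ P := by
        rw [← hcP]
        exact Ideal.comap_mono hPZ'
      have h2 := hmin.2 ⟨Ideal.comap_isPrime π P', sup_le ?_ ?_⟩ h1
      · rw [Ideal.map_le_iff_le_comap]
        exact h2
      · exact hker.ge.trans (Ideal.comap_mono bot_le)
      · rw [Ideal.span_singleton_le_iff_mem]
        exact hle (Ideal.mem_span_singleton_self _)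
  have hht := Ideal.height_le_one_of_isPrincipal_of_mem_minimalPrimes _ _ hminq
  by_contra hlt
  have hlt' : Q.map π < P.map π := by
    refine lt_of_le_not_ge (Ideal.map_mono hQP) fun h => hlt (le_antisymm hQP ?_)
    rw [← hcP, ← hcQ]
    exact Ideal.comap_mono h
  have h0 : (⊥ : Ideal (R ⧸ J)) < Q.map π := by
    rw [bot_lt_iff_ne_bot]
    intro h
    refine hJQ.not_ge ?_
    rw [← hcQ, h]
    exact hker.le
  -- A strict chain from zero through the images of `Q` and `P` would have length two above a
  -- principal ideal, against the height bound one.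
  have i1 := Ideal.height_add_one_le_of_lt_of_isPrime h0
  have i2 := Ideal.height_add_one_le_of_lt_of_isPrime hlt'
  have : (2 : ℕ∞) ≤ 1 := by
    calc (2 : ℕ∞) = 0 + 1 + 1 := by norm_num
      _ ≤ (P.map π).height := by
        refine le_trans ?_ i2
        gcongr
        exact le_trans (by gcongr; exact zero_le) i1
      _ ≤ 1 := hht
  exact absurd this (by norm_num)

/-- Krull's principal ideal theorem: a component `Z` of `{δ = 0} ∩ W` coincides with every proper
irreducible closed subset of `W` that contains it. -/
theorem zcl_eq_of_component {W Q Z : Set E} (hW : Irr W) (hQ : Irr Q) (hZ : Irr Z)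
    (hZQ : Z ⊆ zcl Q) (hQW : Q ⊆ zcl W) (hne : ¬ W ⊆ zcl Q) {δ : E → ℂ}
    (hδ : IsPoly δ) (hδZ : ∀ p ∈ Z, δ p = 0)
    (hmax : ∀ T : Set E, Irr T → T ⊆ zcl W → (∀ p ∈ T, δ p = 0) → Z ⊆ T → T ⊆ zcl Z) :
    zcl Q = zcl Z := by
  have hmin := vI_mem_minimalPrimes hZ (hZQ.trans (zcl_subset_zcl hQW)) hδ hδZ hmax
  have hPW := vI_isPrime hW
  have hPQ := vI_isPrime hQ
  have hPZ := vI_isPrime hZ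
  have hWQ : vI W ≤ vI Q := fun f hf p hp => hQW hp _ (polyFun_isPoly f) hf
  have hQZ : vI Q ≤ vI Z := fun f hf p hp => hZQ hp _ (polyFun_isPoly f) hf
  refine zcl_eq_of_vI_eq (eq_of_mem_minimalPrimes_sup_span hmin (lt_of_le_not_ge hWQ fun h => ?_) hQZ)
  exact hne fun p hp f hf h0 => h (show (⟨f, isPoly_scalar.1 hf⟩ : polyFun E) ∈ vI Q from h0) p hp

end Ideal

/-! ### Generic smoothness and density by dimension. -/

section Generic

variable {E : Type u} [AddCommGroup E] [Module ℂ E] [FiniteDimensional ℂ E]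
  {F : Type v} [AddCommGroup F] [Module ℂ F] [FiniteDimensional ℂ F]

/-- Pull-back of polynomial functions along a polynomial map. -/
noncomputable def pullback (g : E → F) (hg : IsPoly g) : polyFun F →ₐ[ℂ] polyFun E where
  toFun f := ⟨fun x => f.1 (g x), isPoly_scalar.1 ((polyFun_isPoly f).comp hg)⟩
  map_one' := rfl
  map_mul' _ _ := rfl
  map_zero' := rfl
  map_add' _ _ := rfl
  commutes' _ := rfl

theorem vI_image_le {W : Set E} {g : E → F} (hg : IsPoly g) {f : polyFun F} :
    f ∈ vI (g '' W) ↔ pullback g hg f ∈ vI W := by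
  simp only [mem_vI, Set.forall_mem_image]
  rfl

/-- The map `f ↦ m f + ε m (D f)` into the dual numbers. -/
def tszeHom {R K : Type*} [CommRing R] [Algebra ℂ R] [Field K] (m : R →+* K)
    (D : Derivation ℂ R R) : R →+* TrivSqZeroExt K K where
  toFun f := (m f, m (D f))
  map_one' := by
    rw [Derivation.map_one_eq_zero]
    simp only [map_one, map_zero]
    rfl
  map_zero' := by
    simp only [map_zero]
    rfl
  map_add' a b := by
    simp only [map_add]
    rfl
  map_mul' a b := by
    rw [Derivation.leibniz]
    simp only [map_add, map_mul, smul_eq_mul]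
    refine TrivSqZeroExt.ext rfl ?_
    change m a * m (D b) + m b * m (D a) = m a * m (D b) + m (D a) * m b
    ring

/-- Extension of a derivation along an injection of domains, up to a common denominator. -/
theorem exists_derivation_lift {P P₀ A A₀ : Type*} [CommRing P] [Algebra ℂ P] [CommRing P₀]
    [Algebra ℂ P₀] [CommRing A] [IsDomain A] [Algebra ℂ A] [Algebra.FiniteType ℂ A]
    [CommRing A₀] [IsDomain A₀] [Algebra ℂ A₀] (μ : P →ₐ[ℂ] A) (μ₀ : P₀ →ₐ[ℂ] A₀)
    (hμ₀ : Function.Surjective μ₀) (γ : P₀ →ₐ[ℂ] P) (hγ : ∀ f, μ₀ f = 0 ↔ μ (γ f) = 0)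
    (D₀ : Derivation ℂ P₀ P₀) (hD₀ : ∀ f, μ₀ f = 0 → μ₀ (D₀ f) = 0) :
    ∃ D : P → FractionRing A, (∀ f g, D (f + g) = D f + D g) ∧
      (∀ f g, D (f * g) = algebraMap A _ (μ f) * D g + algebraMap A _ (μ g) * D f) ∧
      (∀ f, μ f = 0 → D f = 0) ∧ ∀ f, D (γ f) = algebraMap A _ (μ (γ (D₀ f))) := by
  let K := FractionRing A
  have hker : RingHom.ker (μ₀ : P₀ →+* A₀) ≤ RingHom.ker ((μ : P →+* A).comp (γ : P₀ →+* P)) :=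
    fun f hf => (hγ f).1 hf
  let φ : A₀ →+* A := RingHom.liftOfSurjective (μ₀ : P₀ →+* A₀) hμ₀
    ⟨(μ : P →+* A).comp (γ : P₀ →+* P), hker⟩
  have hφμ : ∀ f, φ (μ₀ f) = μ (γ f) := fun f =>
    RingHom.liftOfRightInverse_comp_apply (μ₀ : P₀ →+* A₀) _ _
      ⟨(μ : P →+* A).comp (γ : P₀ →+* P), hker⟩ f
  have hφ : Function.Injective φ := by
    rw [injective_iff_map_eq_zero]
    intro x hx
    obtain ⟨f, rfl⟩ := hμ₀ x
    rw [hφμ] at hx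
    exact (hγ f).2 hx
  let ψ := tszeHom ((algebraMap A K).comp ((μ : P →+* A).comp (γ : P₀ →+* P))) D₀
  -- `D₀` preserves the kernel of `μ₀`, so the dual-number map built from it descends to the
  -- coordinate ring of the image.
  have hker' : RingHom.ker (μ₀ : P₀ →+* A₀) ≤ RingHom.ker ψ := fun f hf => by
    have h1 : μ (γ f) = 0 := (hγ f).1 hf
    have h2 : μ (γ (D₀ f)) = 0 := (hγ _).1 (hD₀ f hf)
    rw [RingHom.mem_ker]
    change ((algebraMap A K (μ (γ f)), algebraMap A K (μ (γ (D₀ f)))) : K × K) = _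
    rw [h1, h2, map_zero]
    rfl
  let Ψ : A₀ →+* TrivSqZeroExt K K :=
    RingHom.liftOfSurjective (μ₀ : P₀ →+* A₀) hμ₀ ⟨ψ, hker'⟩
  have hΨμ : ∀ f, Ψ (μ₀ f) = ψ f := fun f =>
    RingHom.liftOfRightInverse_comp_apply (μ₀ : P₀ →+* A₀) _ _ ⟨ψ, hker'⟩ f
  obtain ⟨Θ, hΘ1, hΘ2⟩ := exists_tsze_lift φ hφ (fun c => by
    rw [← AlgHom.commutes μ₀, hφμ, AlgHom.commutes, AlgHom.commutes]) Ψ (by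
    intro q
    obtain ⟨f, rfl⟩ := hμ₀ q
    rw [hΨμ, hφμ]
    rfl)
  refine ⟨fun f => (Θ (μ f)).snd, fun f g => by simp, fun f g => ?_, fun f hf => by simp [hf],
    fun f => ?_⟩
  · simp only [map_mul, TrivSqZeroExt.snd_mul, hΘ1, smul_eq_mul,
      MulOpposite.smul_eq_mul_unop, MulOpposite.unop_op]
    ring
  · simp only
    rw [← hφμ f, hΘ2, hΨμ]
    rfl

/-- A linear form as a polynomial function. -/
def dualPoly (φ : Module.Dual ℂ E) : polyFun E := ⟨fun x => φ x, isPoly_scalar.1 (isPoly_linear φ)⟩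

@[elab_as_elim]
theorem polyFun_induction {P : polyFun E → Prop} (dual : ∀ φ, P (dualPoly φ))
    (const : ∀ c : ℂ, P (algebraMap ℂ _ c)) (add : ∀ f g, P f → P g → P (f + g))
    (mul : ∀ f g, P f → P g → P (f * g)) (f : polyFun E) : P f := by
  obtain ⟨f, hf⟩ := f
  refine Algebra.adjoin_induction (p := fun x hx => P ⟨x, hx⟩) ?_ (fun c => const c)
    (fun x y hx hy h1 h2 => add ⟨x, hx⟩ ⟨y, hy⟩ h1 h2)
    (fun x y hx hy h1 h2 => mul ⟨x, hx⟩ ⟨y, hy⟩ h1 h2) hf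
  rintro _ ⟨φ, rfl⟩
  exact dual φ

/-- The coordinate ring of an irreducible set. -/
theorem exists_coordinateRing {W : Set E} (hW : Irr W) :
    ∃ (A : Type u) (_ : CommRing A) (_ : IsDomain A) (_ : Algebra ℂ A)
      (_ : Algebra.FiniteType ℂ A) (μ : polyFun E →ₐ[ℂ] A), Function.Surjective μ ∧
      ∀ f, μ f = 0 ↔ ∀ p ∈ W, f.1 p = 0 := by
  have hP := vI_isPrime hW
  exact ⟨polyFun E ⧸ vI W, inferInstance, inferInstance, inferInstance, inferInstance,
    Ideal.Quotient.mkₐ ℂ (vI W), Ideal.Quotient.mkₐ_surjective ℂ _, fun _ => mkvI_eq_zero⟩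

/-- Denominators are cleared: the values of `D` on the finitely many coordinates have a common
denominator `h`, and the numerators are the coefficients of the field `b`. -/
theorem exists_lift_field_aux {W : Set E} {g : E → F} (hg : IsPoly g) {a : F → F}
    (ha : IsPoly a) {A : Type*} [CommRing A] [IsDomain A] [Algebra ℂ A] (μ : polyFun E →ₐ[ℂ] A)
    (hμ : Function.Surjective μ) (hμ0 : ∀ f, μ f = 0 ↔ ∀ p ∈ W, f.1 p = 0)
    (D : polyFun E → FractionRing A) (hDadd : ∀ f g, D (f + g) = D f + D g)
    (hDmul : ∀ f g, D (f * g) = algebraMap A _ (μ f) * D g + algebraMap A _ (μ g) * D f)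
    (hD0 : ∀ f, μ f = 0 → D f = 0)
    (hDg : ∀ f, D (pullback g hg f) = algebraMap A _ (μ (pullback g hg (fieldDerivation a ha f)))) :
    ∃ (b : E → E) (h : E → ℂ), IsPoly b ∧ IsPoly h ∧ (∃ p ∈ W, h p ≠ 0) ∧
      (∀ p ∈ W, b p ∈ tangentSpace W p) ∧ ∀ p ∈ W, pd g p (b p) = h p • a (g p) := by
  let K := FractionRing A
  let m : polyFun E → K := fun f => algebraMap A K (μ f)
  have hm0 : ∀ f, m f = 0 ↔ ∀ p ∈ W, f.1 p = 0 := fun f => by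
    simp only [m]
    rw [map_eq_zero_iff _ (IsFractionRing.injective A K), hμ0]
  have hmadd : ∀ f g, m (f + g) = m f + m g := fun f g => by simp [m]
  have hmmul : ∀ f g, m (f * g) = m f * m g := fun f g => by simp [m]
  have hDc : ∀ c : ℂ, D (algebraMap ℂ _ c) = 0 := fun c => by
    rw [← AlgHom.commutes (pullback g hg), hDg, Derivation.map_algebraMap]
    simp
  have hD00 : D 0 = 0 := hD0 0 (map_zero μ)
  let e := Module.finBasis ℂ E
  let X : Fin (Module.finrank ℂ E) → polyFun E :=
    fun i => ⟨e.coord i, isPoly_scalar.1 (isPoly_linear _)⟩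
  obtain ⟨s, hs⟩ := IsLocalization.exist_integer_multiples_of_finite (nonZeroDivisors A)
    (fun i => D (X i))
  choose c hc using hs
  choose c' hc' using fun i => hμ (c i)
  obtain ⟨h, hh⟩ := hμ s.1
  let b : E → E := fun x => ∑ i, (c' i).1 x • e i
  have hb : IsPoly b := isPoly_sum _ fun i _ => (polyFun_isPoly (c' i)).smul (isPoly_const _)
  have hcX : ∀ i, m (c' i) = m h * D (X i) := fun i => by
    have := hc i
    simp only [m, hc', hh]
    rw [this, Algebra.smul_def]
  -- Both sides are derivations along the same ring map; they agree on coordinates by the choice of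
  -- numerators, hence everywhere.
  have key : ∀ f : polyFun E, m (fieldDerivation b hb f) = m h * D f := by
    intro f
    induction f using polyFun_induction with
    | dual ψ =>
      have e1 : dualPoly ψ = ∑ i, algebraMap ℂ _ (ψ (e i)) * X i := by
        refine Subtype.ext (funext fun x => ?_)
        simp only [AddSubmonoidClass.coe_finsetSum, Finset.sum_apply]
        change ψ x = _
        conv_lhs => rw [← e.sum_repr x, map_sum]
        refine Finset.sum_congr rfl fun i _ => ?_
        rw [map_smul, smul_eq_mul, mul_comm]
        rfl
      have e2 : ∀ i, fieldDerivation b hb (X i) = c' i := fun i => by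
        refine Subtype.ext (funext fun x => ?_)
        change pd (e.coord i) x (b x) = _
        rw [pd_linear]
        simp only [b, map_sum, map_smul, Module.Basis.coord_apply, Module.Basis.repr_self,
          smul_eq_mul]
        simp [Finsupp.single_apply]
      have e3 : ∀ (s : Finset (Fin (Module.finrank ℂ E))),
          m (fieldDerivation b hb (∑ i ∈ s, algebraMap ℂ _ (ψ (e i)) * X i))
            = m h * D (∑ i ∈ s, algebraMap ℂ _ (ψ (e i)) * X i) := by
        intro s
        classical
        induction s using Finset.induction_on with
        | empty => simp [m, hD00]
        | insert i s hi ih =>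
          rw [Finset.sum_insert hi, map_add, hmadd, hDadd, ih, mul_add, hDmul, hDc,
            Derivation.leibniz, Derivation.map_algebraMap, e2, smul_zero, add_zero, smul_eq_mul,
            hmmul, hcX]
          ring
      rw [e1]
      exact e3 _
    | const c =>
      rw [hDc, Derivation.map_algebraMap]
      simp [m]
    | add f g h1 h2 => rw [map_add, hmadd, hDadd, h1, h2, mul_add]
    | mul f g h1 h2 =>
      rw [Derivation.leibniz, hmadd, hDmul, smul_eq_mul, smul_eq_mul, hmmul, hmmul, h1, h2]
      ring
  refine ⟨b, h.1, hb, polyFun_isPoly h, ?_, ?_, ?_⟩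
  · by_contra! h0
    have : m h = 0 := (hm0 h).2 h0
    simp only [m, hh] at this
    rw [map_eq_zero_iff _ (IsFractionRing.injective A K)] at this
    exact nonZeroDivisors.ne_zero s.2 this
  · intro p hp
    rw [mem_tangentSpace]
    intro f hf h0
    have h1 := key ⟨f, isPoly_scalar.1 hf⟩
    rw [hD0 _ ((hμ0 _).2 h0), mul_zero] at h1
    exact (hm0 _).1 h1 p hp
  · intro p hp
    rw [← sub_eq_zero, ← Module.forall_dual_apply_eq_zero_iff ℂ]
    intro ψ
    let f : polyFun F := ⟨ψ, isPoly_scalar.1 (isPoly_linear ψ)⟩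
    have h1 := key (pullback g hg f)
    rw [hDg, ← hmmul] at h1
    have h1' : μ (fieldDerivation b hb (pullback g hg f)
        - h * pullback g hg (fieldDerivation a ha f)) = 0 := by
      rw [map_sub, sub_eq_zero]
      exact IsFractionRing.injective A K h1
    have h2 := (hμ0 _).1 h1' p hp
    change pd (fun x => ψ (g x)) p (b p) - h.1 p * pd ψ (g p) (a (g p)) = 0 at h2
    rw [pd_comp (isPoly_linear ψ) hg, pd_linear] at h2
    rw [map_sub, map_smul, smul_eq_mul]
    exact h2

/-- In characteristic zero a vector field on the image of `g` lifts, up to a common denominator. -/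
theorem exists_lift_field {W : Set E} (hW : Irr W) {g : E → F} (hg : IsPoly g) {a : F → F}
    (ha : IsPoly a) (hag : ∀ s ∈ g '' W, a s ∈ tangentSpace (g '' W) s) :
    ∃ (b : E → E) (h : E → ℂ), IsPoly b ∧ IsPoly h ∧ (∃ p ∈ W, h p ≠ 0) ∧
      (∀ p ∈ W, b p ∈ tangentSpace W p) ∧ ∀ p ∈ W, pd g p (b p) = h p • a (g p) := by
  obtain ⟨A, _, _, _, _, μ, hμ, hμ0⟩ := exists_coordinateRing hW
  obtain ⟨A₀, _, _, _, _, μ₀, hμ₀, hμ₀0⟩ := exists_coordinateRing (hW.image hg)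
  have hγ : ∀ f, μ₀ f = 0 ↔ μ (pullback g hg f) = 0 := fun f =>
    (hμ₀0 f).trans ((vI_image_le hg).trans (hμ0 _).symm)
  obtain ⟨D, hDadd, hDmul, hD0, hDg⟩ := exists_derivation_lift μ μ₀ hμ₀ (pullback g hg) hγ
    (fieldDerivation a ha) (fun f hf => (hμ₀0 _).2 fun s hs =>
      mem_tangentSpace.1 (hag s hs) _ (polyFun_isPoly f) ((hμ₀0 f).1 hf))
  exact exists_lift_field_aux hg ha μ hμ hμ0 D hDadd hDmul hD0 hDg

theorem Gen.forall_finite {S : Set E} (hS : Irr S) {ι : Type*} [Finite ι] {P : ι → E → Prop}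
    (h : ∀ i, Gen S (P i)) : Gen S (fun p => ∀ i, P i p) := by
  classical
  cases nonempty_fintype ι
  have : ∀ s : Finset ι, Gen S (fun p => ∀ i ∈ s, P i p) := by
    intro s
    induction s using Finset.induction_on with
    | empty => exact Gen.of_forall hS.1 (by simp)
    | insert i s hi ih =>
      refine ((h i).and hS ih).mono fun p _ hp => ?_
      simpa using hp
  exact (this Finset.univ).mono fun p _ hp i => hp i (Finset.mem_univ i)

theorem Gen.of_ne {S : Set E} {h : E → ℂ} (hh : IsPoly h) (hne : ∃ p ∈ S, h p ≠ 0) :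
    Gen S (fun p => h p ≠ 0) := ⟨h, hh, hne, fun _ _ h => h⟩

/-- Generic smoothness: at a general point the differential maps onto the tangent space of the
image. -/
theorem gen_map_tangentSpace {W : Set E} (hW : Irr W) {g : E → F} (hg : IsPoly g) :
    Gen W (fun p => (tangentSpace W p).map (pd g p) = tangentSpace (g '' W) (g p)) := by
  have hgW := hW.image hg
  obtain ⟨s₀, hs₀⟩ := exists_isSmoothPt hgW.1
  let e := Module.finBasis ℂ (tangentSpace (g '' W) s₀)
  choose a ha ha0 haW using fun i => exists_tangent_field hs₀ (e i).2
  have hli : LinearIndependent ℂ (fun i => a i s₀) := by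
    simp only [ha0]
    exact e.linearIndependent.map' (Submodule.subtype _) (Submodule.ker_subtype _)
  obtain ⟨d, hd, hd0, hdl⟩ := exists_isPoly_linearIndependent ha hli
  choose b h hb hh hne hbW hgb using fun i => exists_lift_field hW hg (ha i) (haW i)
  obtain ⟨p₀, hp₀, hp₀s⟩ := hs₀.1
  have G1 : Gen W (fun p => d (g p) ≠ 0) :=
    Gen.of_ne (hd.comp hg) ⟨p₀, hp₀, by rw [hp₀s, hd0]; exact one_ne_zero⟩
  have G2 : Gen W (fun p => ∀ i, h i p ≠ 0) :=
    Gen.forall_finite hW fun i => Gen.of_ne (hh i) (hne i)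
  have G3 : Gen W (fun p => IsSmoothPt (g '' W) (g p)) :=
    Gen.of_image hg (gen_isSmoothPt hgW.1)
  refine ((G1.and hW G2).and hW G3).mono ?_
  rintro p hp ⟨⟨h1, h2⟩, h3⟩
  apply le_antisymm
  · rintro _ ⟨v, hv, rfl⟩
    exact pd_mem_tangentSpace hg (fun q hq => Set.mem_image_of_mem g hq) hv
  · have hli' := hdl (g p) h1
    -- The lift of each field, divided by its denominator, maps onto the field. Since `g p` is a
    -- smooth point, the independent vectors `a i (g p)` are numerous enough to span the target.
    have hmem : ∀ i, a i (g p) ∈ (tangentSpace W p).map (pd g p) := fun i => by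
      have := Submodule.smul_mem _ (h i p)⁻¹ (Submodule.mem_map_of_mem (f := pd g p) (hbW i p hp))
      rwa [hgb i p hp, inv_smul_smul₀ (h2 i)] at this
    have hspan : Submodule.span ℂ (Set.range fun i => a i (g p)) = tangentSpace (g '' W) (g p) := by
      refine Submodule.eq_of_le_of_finrank_le ?_ ?_
      · rw [Submodule.span_le]
        rintro _ ⟨i, rfl⟩
        exact haW i _ ⟨p, hp, rfl⟩
      · rw [finrank_span_eq_card hli', Fintype.card_fin, (isSmoothPt_iff.1 h3).2,
          (isSmoothPt_iff.1 hs₀).2]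
    rw [← hspan, Submodule.span_le]
    rintro _ ⟨i, rfl⟩
    exact hmem i

/-- Restriction of a polynomial function to a line. -/
theorem exists_polynomial_line {f : E → ℂ} (hf : IsPoly f) (p v : E) :
    ∃ q : Polynomial ℂ, ∀ t : ℂ, f (p + t • v) = q.eval t := by
  rw [isPoly_scalar] at hf
  induction hf using Algebra.adjoin_induction with
  | mem f hf =>
    obtain ⟨φ, rfl⟩ := hf
    exact ⟨Polynomial.C (φ p) + Polynomial.X * Polynomial.C (φ v), fun t => by simp; ring⟩
  | algebraMap c => exact ⟨Polynomial.C c, fun t => by simp⟩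
  | add f g _ _ hf hg =>
    obtain ⟨a, ha⟩ := hf
    obtain ⟨b, hb⟩ := hg
    exact ⟨a + b, fun t => by simp [ha, hb]⟩
  | mul f g _ _ hf hg =>
    obtain ⟨a, ha⟩ := hf
    obtain ⟨b, hb⟩ := hg
    exact ⟨a * b, fun t => by simp [ha, hb]⟩

/-- A set that contains the lines through any two of its points is irreducible. -/
theorem irr_of_lines {S : Set E} (hS : S.Nonempty)
    (h : ∀ p ∈ S, ∀ q ∈ S, ∀ t : ℂ, p + t • (q - p) ∈ S) : Irr S := by
  refine ⟨hS, ?_⟩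
  rintro f g hf hg ⟨p, hp, hfp⟩ ⟨q, hq, hgq⟩
  obtain ⟨a, ha⟩ := exists_polynomial_line hf p (q - p)
  obtain ⟨b, hb⟩ := exists_polynomial_line hg p (q - p)
  have ha0 : a ≠ 0 := by
    rintro rfl
    have := ha 0
    simp [hfp] at this
  have hb0 : b ≠ 0 := by
    rintro rfl
    have := hb 1
    simp [hgq] at this
  obtain ⟨t, ht⟩ : ∃ t, (a * b).eval t ≠ 0 := by
    by_contra! h0
    exact mul_ne_zero ha0 hb0 (Polynomial.funext fun t => by simpa using h0 t)
  rw [Polynomial.eval_mul, ← ha, ← hb] at ht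
  exact ⟨_, h p hp q hq t, left_ne_zero_of_mul ht, right_ne_zero_of_mul ht⟩

theorem pd_eq_derivative {f : E → ℂ} (hf : IsPoly f) {p v : E} {q : Polynomial ℂ}
    (hq : ∀ t : ℂ, f (p + t • v) = q.eval t) (t : ℂ) :
    pd f (p + t • v) v = q.derivative.eval t := by
  have h1 : HasDerivAt (fun s : ℂ => f (p + t • v + s • v)) (pd f (p + t • v) v) 0 :=
    hasPD_scalar.1 (hf.hasPD _) v
  have h2 : HasDerivAt (fun s : ℂ => q.eval (t + s)) (q.derivative.eval t) 0 := by
    have h3 : HasDerivAt (fun y => q.eval y) (q.derivative.eval (t + 0)) (t + 0) := by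
      rw [add_zero]; exact q.hasDerivAt t
    have := HasDerivAt.comp_const_add t 0 h3
    simpa using this
  refine h1.unique (h2.congr_of_eventuallyEq (Filter.Eventually.of_forall fun s => ?_))
  simp only
  rw [← hq, add_smul, add_assoc]

/-- A set with full tangent spaces is dense. -/
theorem eq_zero_of_tangentSpace_eq_top {S : Set E} (hS : S.Nonempty)
    (h : ∀ p ∈ S, tangentSpace S p = ⊤) {f : E → ℂ} (hf : IsPoly f) (h0 : ∀ p ∈ S, f p = 0)
    (x : E) : f x = 0 := by
  obtain ⟨p, hp⟩ := hS
  set v := x - p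
  -- The derivative of `f` in a constant direction vanishes on `S` again, so all Taylor coefficients
  -- of `f` at `p` along the line to `x` vanish.
  have key : ∀ k : ℕ, ∀ (f : E → ℂ), IsPoly f → (∀ p ∈ S, f p = 0) → ∀ q : Polynomial ℂ,
      (∀ t : ℂ, f (p + t • v) = q.eval t) → (Polynomial.derivative^[k] q).eval 0 = 0 := by
    intro k
    induction k with
    | zero =>
      intro f hf h0 q hq
      have := hq 0
      rw [zero_smul, add_zero, h0 p hp] at this
      exact this.symm
    | succ k ih =>
      intro f hf h0 q hq
      rw [Function.iterate_succ_apply]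
      refine ih (fun y => pd f y v) (isPoly_pd_apply hf v) (fun y hy => ?_) _
        (pd_eq_derivative hf hq)
      exact mem_tangentSpace.1 (h y hy ▸ Submodule.mem_top (x := v)) f hf h0
  obtain ⟨q, hq⟩ := exists_polynomial_line hf p v
  have hq0 : q = 0 := by
    ext k
    have h1 := key k f hf h0 q hq
    rw [← Polynomial.coeff_zero_eq_eval_zero, Polynomial.coeff_iterate_derivative] at h1
    simp only [zero_add, Nat.descFactorial_self, nsmul_eq_mul, mul_eq_zero, Nat.cast_eq_zero] at h1
    simpa using h1.resolve_left k.factorial_ne_zero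
  have := hq 1
  rw [hq0, one_smul] at this
  simpa [v] using this

/-- The open subset of points with full tangent space has the same closure, hence the same tangent
spaces, so the Taylor argument applies to it. -/
theorem zcl_eq_univ_of_gen {S : Set E} (hS : Irr S) (h : Gen S (fun p => tangentSpace S p = ⊤)) :
    zcl S = Set.univ := by
  refine Set.eq_univ_of_forall fun x f hf h0 => ?_
  have h1 := h.zcl_eq hS
  refine eq_zero_of_tangentSpace_eq_top (S := {p | p ∈ S ∧ tangentSpace S p = ⊤}) ?_ ?_ hf
    (fun p hp => h0 p hp.1) x
  · obtain ⟨p, hp, h⟩ := h.exists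
    exact ⟨p, hp, h⟩
  · intro p hp
    rw [tangentSpace_congr h1]
    exact hp.2

theorem exists_eq_add_mul {f : F × ℂ → ℂ} (hf : IsPoly f) :
    ∃ g : F × ℂ → ℂ, IsPoly g ∧ ∀ x, f x = f (x.1, 0) + x.2 * g x := by
  rw [isPoly_scalar] at hf
  induction hf using Algebra.adjoin_induction with
  | mem f hf =>
    obtain ⟨φ, rfl⟩ := hf
    refine ⟨fun _ => φ (0, 1), isPoly_const _, fun x => ?_⟩
    rw [← smul_eq_mul, ← map_smul, ← map_add]
    simp
  | algebraMap c => exact ⟨fun _ => 0, isPoly_const _, fun x => by simp⟩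
  | add f g _ _ hf hg =>
    obtain ⟨a, ha, ha'⟩ := hf
    obtain ⟨b, hb, hb'⟩ := hg
    refine ⟨fun x => a x + b x, ha.add hb, fun x => ?_⟩
    simp only [Pi.add_apply]
    rw [ha', hb']
    ring
  | mul f g hf' hg' hf hg =>
    obtain ⟨a, ha, ha'⟩ := hf
    obtain ⟨b, hb, hb'⟩ := hg
    have h0 : IsPoly (fun x : F × ℂ => f (x.1, 0)) :=
      (isPoly_scalar.2 hf').comp (isPoly_fst.prodMk (isPoly_const 0))
    refine ⟨fun x => f (x.1, 0) * b x + a x * g x, (isPoly_mul h0 hb).add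
      (isPoly_mul ha (isPoly_scalar.2 hg')), fun x => ?_⟩
    simp only [Pi.mul_apply]
    have h1 := ha' x
    have h2 := hb' x
    linear_combination g x * h1 + f (x.1, 0) * h2

/-- An irreducible subset of `F × ℂ`, not contained in `F × 0`, whose closure contains a
dense subset of `F × 0`, is dense. -/
theorem zcl_eq_univ_of_hyperplane {S : Set (F × ℂ)} (hS : Irr S) (hne : ∃ p ∈ S, p.2 ≠ 0)
    {T : Set F} (hT : zcl T = Set.univ) (hTS : ∀ x ∈ T, (x, 0) ∈ zcl S) : zcl S = Set.univ := by
  have hP := vI_isPrime hS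
  let s : polyFun (F × ℂ) := ⟨fun x => x.2, isPoly_scalar.1 isPoly_snd⟩
  have h1 : ∀ f ∈ vI S, ∃ g ∈ vI S, f = s * g := by
    intro f hf
    obtain ⟨g, hg, hfg⟩ := exists_eq_add_mul (polyFun_isPoly f)
    have h0 : ∀ y : F, f.1 (y, 0) = 0 := fun y => by
      have hy : y ∈ zcl T := hT ▸ Set.mem_univ y
      exact hy (fun y => f.1 (y, 0)) ((polyFun_isPoly f).comp (isPoly_id.prodMk (isPoly_const 0)))
        fun x hx => hTS x hx _ (polyFun_isPoly f) hf
    have h2 : f = s * ⟨g, isPoly_scalar.1 hg⟩ := by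
      refine Subtype.ext (funext fun x => ?_)
      rw [hfg, h0, zero_add]
      rfl
    refine ⟨⟨g, isPoly_scalar.1 hg⟩, ?_, h2⟩
    rcases hP.mem_or_mem (h2 ▸ hf) with h3 | h3
    · obtain ⟨p, hp, h4⟩ := hne
      exact absurd (h3 p hp) h4
    · exact h3
  -- By the previous step `vI S` equals `s` times itself. Nakayama gives an annihilator congruent to
  -- 1 modulo `s`, so the ideal is zero because polynomials have no zero divisors.
  have h2 : vI S = ⊥ := by
    have hle : vI S ≤ Ideal.span {s} • vI S := by
      intro f hf
      obtain ⟨g, hg, rfl⟩ := h1 f hf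
      exact Submodule.smul_mem_smul (Ideal.mem_span_singleton_self s) hg
    obtain ⟨r, hr, hr0⟩ := Submodule.exists_sub_one_mem_and_smul_eq_zero_of_fg_of_le_smul
      (Ideal.span {s}) (vI S) (IsNoetherian.noetherian _) hle
    have hr00 : r.1 (0, 0) = 1 := by
      obtain ⟨c, hc⟩ := Ideal.mem_span_singleton'.1 hr
      have := congrFun (congrArg Subtype.val hc) (0, 0)
      change c.1 (0, 0) * (0 : ℂ) = r.1 (0, 0) - 1 at this
      rw [mul_zero] at this
      exact (sub_eq_zero.1 this.symm)
    have hu : Irr (Set.univ : Set (F × ℂ)) := irr_of_lines Set.univ_nonempty (by simp)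
    rw [eq_bot_iff]
    intro f hf
    by_contra hne
    have hf0 : ∃ p ∈ (Set.univ : Set (F × ℂ)), f.1 p ≠ 0 := by
      by_contra! h
      exact hne (Subtype.ext (funext fun p => h p (Set.mem_univ p)))
    obtain ⟨p, _, h3, h4⟩ := hu.2 f.1 r.1 (polyFun_isPoly f) (polyFun_isPoly r) hf0
      ⟨_, Set.mem_univ _, hr00 ▸ one_ne_zero⟩
    have := congrFun (congrArg Subtype.val (hr0 f hf)) p
    exact mul_ne_zero h4 h3 this
  refine Set.eq_univ_of_forall fun x f hf h0 => ?_
  have : (⟨f, isPoly_scalar.1 hf⟩ : polyFun (F × ℂ)) ∈ vI S := h0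
  rw [h2, Submodule.mem_bot] at this
  exact congrFun (congrArg Subtype.val this) x

/-- An irreducible subset of the same dimension is dense. -/
theorem zcl_eq_of_gdim_le {W W' : Set E} (hW : Irr W) (hW' : Irr W') (h : W ⊆ zcl W')
    (hd : gdim W' ≤ gdim W) : zcl W = zcl W' := by
  refine (zcl_subset_zcl h).antisymm ?_
  by_contra hne
  obtain ⟨f, hf, hf0, p₁, hp₁, hfp₁⟩ : ∃ f : E → ℂ, IsPoly f ∧ (∀ q ∈ W, f q = 0) ∧
      ∃ q ∈ W', f q ≠ 0 := by
    by_contra! hc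
    exact hne fun p hp f hf h0 => hp f hf (hc f hf h0)
  obtain ⟨p₀, hp₀⟩ := exists_isSmoothPt hW.1
  -- A linear retraction `L` onto this tangent space has surjective differential on `W` at `p₀`,
  -- hence generically, so `L` maps `W` densely to `T`.
  let T := tangentSpace W p₀
  obtain ⟨L, hL⟩ := LinearMap.exists_leftInverse_of_injective T.subtype (Submodule.ker_subtype _)
  have hLp : IsPoly L := isPoly_linear L
  have hL0 : T.map L = ⊤ := by
    rw [eq_top_iff]
    intro y _
    exact ⟨y, y.2, LinearMap.congr_fun hL y⟩
  have hLgen : Gen W (fun p => (tangentSpace W p).map L = ⊤) := by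
    let e := Module.finBasis ℂ T
    choose a ha ha0 haW using fun i => exists_tangent_field hp₀ (e i).2
    have hli : LinearIndependent ℂ (fun i => L (a i p₀)) := by
      have : (fun i => L (a i p₀)) = e := by
        ext i
        rw [ha0]
        exact congrArg Subtype.val (LinearMap.congr_fun hL (e i))
      rw [this]
      exact e.linearIndependent
    obtain ⟨d, hd, hd0, hdl⟩ := exists_isPoly_linearIndependent (v := fun i x => L (a i x))
      (fun i => hLp.comp (ha i)) hli
    refine ⟨d, hd, ⟨p₀, hp₀.1, hd0 ▸ one_ne_zero⟩, fun p hp hdp => ?_⟩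
    have h1 := (hdl p hdp).span_eq_top_of_card_eq_finrank' (by simp)
    simp only
    rw [eq_top_iff, ← h1, Submodule.span_le]
    rintro _ ⟨i, rfl⟩
    exact ⟨_, haW i p hp, rfl⟩
  have hdense : zcl (L '' W) = Set.univ := by
    refine zcl_eq_univ_of_gen (hW.image hLp) ?_
    obtain ⟨s, hs⟩ := exists_isSmoothPt (hW.image hLp).1
    obtain ⟨p, hp, ⟨h1, h2⟩, h3⟩ := ((hLgen.and hW (gen_map_tangentSpace hW hLp)).and hW
      (Gen.of_image hLp (gen_isSmoothPt (hW.image hLp).1))).exists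
    rw [pd_linear, h1] at h2
    refine (gen_isSmoothPt (hW.image hLp).1).mono fun q hq hqs => ?_
    have h4 := (isSmoothPt_iff.1 h3).2
    rw [← h2, ← (isSmoothPt_iff.1 hqs).2, finrank_top] at h4
    exact Submodule.eq_top_of_finrank_eq h4.symm
  -- The image of `W'` is not contained in `T × 0`, while its closure contains the dense image of
  -- `W` in `T × 0`. It is therefore dense, and `W'` has dimension at least that of `W` plus one.
  let g : E → T × ℂ := fun x => (L x, f x)
  have hg : IsPoly g := hLp.prodMk hf
  have hgW' := hW'.image hg
  have hdense' : zcl (g '' W') = Set.univ := by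
    refine zcl_eq_univ_of_hyperplane hgW' ⟨_, ⟨p₁, hp₁, rfl⟩, hfp₁⟩ hdense ?_
    rintro _ ⟨p, hp, rfl⟩
    have h1 : g p ∈ zcl (g '' W') :=
      mem_zcl_of_map hg (fun q hq => subset_zcl _ (Set.mem_image_of_mem g hq)) (h hp)
    have h2 : g p = (L p, 0) := by simp [g, hf0 p hp]
    rwa [h2] at h1
  obtain ⟨p, hp, h1, h2⟩ := ((gen_map_tangentSpace hW' hg).and hW' (gen_isSmoothPt hW'.1)).exists
  have htop : tangentSpace (g '' W') (g p) = ⊤ := by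
    rw [← tangentSpace_zcl, hdense', eq_top_iff]
    intro v _
    rw [mem_tangentSpace]
    intro q hq h0
    have : q = fun _ => 0 := funext fun x => h0 x (Set.mem_univ x)
    rw [this, pd_const]
    rfl
  have h3 := Submodule.finrank_map_le (pd g p) (tangentSpace W' p)
  rw [h1, htop, finrank_top, (isSmoothPt_iff.1 h2).2, Module.finrank_prod, Module.finrank_self] at h3
  have h4 : Module.finrank ℂ T = gdim W := (isSmoothPt_iff.1 hp₀).2
  omega

end Generic

/-! ### Quotients by a torus: closure, irreducibility and components computed upstairs. -/

section Quotient

variable {M : Type u} [AddCommGroup M] [Module ℂ M] [FiniteDimensional ℂ M] {P : M → Prop}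
  {Q : Type v}

/-- A quotient of a subset of a vector space by a linear action of a two-dimensional torus. -/
structure IsTorusQuotient (q : {v : M // P v} → Q) (σ : ℂ × ℂ → M →ₗ[ℂ] M) : Prop where
  surj : Function.Surjective q
  poly : ∀ v, IsPoly (fun c => σ c v)
  one : ∀ v, σ (1, 1) v = v
  stable : ∀ c v, c.1 ≠ 0 → c.2 ≠ 0 → P v → P (σ c v)
  fibre : ∀ v w, q v = q w ↔ ∃ c, c.1 ≠ 0 ∧ c.2 ≠ 0 ∧ w.1 = σ c v.1

/-- The preimage in the vector space. -/
def qlift (q : {v : M // P v} → Q) (T : Set Q) : Set M := {v | ∃ h : P v, q ⟨v, h⟩ ∈ T}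

/-- The quotient of the Zariski topology. -/
@[reducible] noncomputable def qtop (q : {v : M // P v} → Q) : TopologicalSpace Q :=
  TopologicalSpace.coinduced q (TopologicalSpace.induced Subtype.val (zariski M))

variable {q : {v : M // P v} → Q} {σ : ℂ × ℂ → M →ₗ[ℂ] M}

theorem qlift_mono {S T : Set Q} (h : S ⊆ T) : qlift q S ⊆ qlift q T :=
  fun _ ⟨hp, hv⟩ => ⟨hp, h hv⟩

theorem mem_qlift_smul (hq : IsTorusQuotient q σ) {T : Set Q} {v : M} (hv : v ∈ qlift q T)
    {c : ℂ × ℂ} (h1 : c.1 ≠ 0) (h2 : c.2 ≠ 0) : σ c v ∈ qlift q T := by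
  obtain ⟨h, hv⟩ := hv
  have hP := hq.stable c v h1 h2 h
  refine ⟨hP, ?_⟩
  rwa [← (hq.fibre ⟨v, h⟩ ⟨σ c v, hP⟩).2 ⟨c, h1, h2, rfl⟩]

theorem qlift_subset_iff (hq : IsTorusQuotient q σ) {S T : Set Q} :
    qlift q S ⊆ qlift q T ↔ S ⊆ T := by
  refine ⟨fun h p hp => ?_, qlift_mono⟩
  obtain ⟨v, rfl⟩ := hq.surj p
  obtain ⟨_, h⟩ := h ⟨v.2, hp⟩
  exact h

theorem isClosed_qtop_iff {T : Set Q} :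
    IsClosed[qtop q] T ↔ ∀ v ∈ zcl (qlift q T), P v → v ∈ qlift q T := by
  rw [isClosed_coinduced, @isClosed_induced_iff _ _ (zariski M)]
  constructor
  · rintro ⟨F, hF, hFT⟩ v hv hPv
    have h1 : qlift q T ⊆ F := fun w ⟨h, hw⟩ => by
      have : (⟨w, h⟩ : {v : M // P v}) ∈ Subtype.val ⁻¹' F := hFT ▸ hw
      exact this
    have h2 : (⟨v, hPv⟩ : {v : M // P v}) ∈ Subtype.val ⁻¹' F :=
      isClosed_zariski_iff.1 hF (zcl_mono h1 hv)
    rw [hFT] at h2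
    exact ⟨hPv, h2⟩
  · intro h
    refine ⟨zcl (qlift q T), isClosed_zariski_iff.2 (zcl_zcl _).subset, ?_⟩
    ext v
    constructor
    · intro hv
      exact (h v.1 hv v.2).2
    · intro hv
      exact subset_zcl _ ⟨v.2, hv⟩

theorem smul_mem_zcl (hq : IsTorusQuotient q σ) {T : Set Q} {v : M} (hv : v ∈ zcl (qlift q T))
    {c : ℂ × ℂ} (h1 : c.1 ≠ 0) (h2 : c.2 ≠ 0) : σ c v ∈ zcl (qlift q T) :=
  mem_zcl_of_map (isPoly_linear (σ c)) (fun _ hw => subset_zcl _ (mem_qlift_smul hq hw h1 h2)) hv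

/-- The closure upstairs of a saturated set is again saturated, because each torus element acts
linearly; so it descends to a closed set. -/
theorem mem_qlift_closure (hq : IsTorusQuotient q σ) {T : Set Q} {v : M} :
    v ∈ qlift q (@closure Q (qtop q) T) ↔ P v ∧ v ∈ zcl (qlift q T) := by
  let _ := qtop q
  let T' : Set Q := {p | ∃ w : {v : M // P v}, q w = p ∧ w.1 ∈ zcl (qlift q T)}
  have hT' : ∀ w, w ∈ qlift q T' ↔ P w ∧ w ∈ zcl (qlift q T) := by
    intro w
    constructor
    · rintro ⟨h, u, hu, hu'⟩
      obtain ⟨c, h1, h2, hc⟩ := (hq.fibre _ _).1 hu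
      refine ⟨h, ?_⟩
      have := smul_mem_zcl hq hu' h1 h2
      rwa [← hc] at this
    · rintro ⟨h, hw⟩
      exact ⟨h, ⟨w, h⟩, rfl, hw⟩
  have hcl : IsClosed T' := isClosed_qtop_iff.2 fun w hw hP => by
    rw [hT']
    exact ⟨hP, zcl_subset_zcl (fun z hz => ((hT' z).1 hz).2) hw⟩
  have hsub : T ⊆ T' := fun p hp => by
    obtain ⟨w, rfl⟩ := hq.surj p
    exact ⟨w, rfl, subset_zcl _ ⟨w.2, hp⟩⟩
  constructor
  · intro hv
    rw [← hT']
    exact qlift_mono (closure_minimal hsub hcl) hv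
  · rintro ⟨hP, hv⟩
    exact isClosed_qtop_iff.1 isClosed_closure v (zcl_mono (qlift_mono subset_closure) hv) hP

theorem zcl_qlift_closure (hq : IsTorusQuotient q σ) (T : Set Q) :
    zcl (qlift q (@closure Q (qtop q) T)) = zcl (qlift q T) := by
  let _ := qtop q
  refine (zcl_subset_zcl fun v hv => ((mem_qlift_closure hq).1 hv).2).antisymm ?_
  exact zcl_mono (qlift_mono subset_closure)

/-- Open sets upstairs need not be saturated: two of them may meet the same orbit at different
points. Since the torus is irreducible, one torus element moves a representative into both. -/
theorem isIrreducible_qtop_iff (hq : IsTorusQuotient q σ) {T : Set Q} :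
    @IsIrreducible Q (qtop q) T ↔ Irr (qlift q T) := by
  let _ := qtop q
  constructor
  · rintro ⟨⟨p, hp⟩, h⟩
    obtain ⟨v, rfl⟩ := hq.surj p
    refine ⟨⟨v.1, v.2, hp⟩, ?_⟩
    have hopen : ∀ f : M → ℂ, IsPoly f → IsOpen {p : Q | ∃ v, q v = p ∧ f v.1 ≠ 0} := by
      intro f hf
      rw [isOpen_coinduced, @isOpen_induced_iff _ _ (zariski M)]
      refine ⟨{w | ∃ c : ℂ × ℂ, c.1 ≠ 0 ∧ c.2 ≠ 0 ∧ f (σ c w) ≠ 0}, ?_, ?_⟩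
      · rw [isOpen_zariski_iff]
        rintro w ⟨c, h1, h2, h3⟩
        exact ⟨fun w => f (σ c w), hf.comp (isPoly_linear _), h3, fun z hz => ⟨c, h1, h2, hz⟩⟩
      · ext w
        constructor
        · rintro ⟨c, h1, h2, h3⟩
          exact ⟨⟨σ c w.1, hq.stable c _ h1 h2 w.2⟩,
            ((hq.fibre _ _).2 ⟨c, h1, h2, rfl⟩).symm, h3⟩
        · rintro ⟨z, hz, h3⟩
          obtain ⟨c, h1, h2, h⟩ := (hq.fibre _ _).1 hz.symm
          exact ⟨c, h1, h2, h ▸ h3⟩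
    rintro f g hf hg ⟨v, ⟨hv, hv'⟩, hfv⟩ ⟨w, ⟨hw, hw'⟩, hgw⟩
    obtain ⟨p, hp, ⟨a, rfl, ha⟩, b, hb, hb'⟩ := h _ _ (hopen f hf) (hopen g hg)
      ⟨_, hv', _, rfl, hfv⟩ ⟨_, hw', _, rfl, hgw⟩
    obtain ⟨c, -, -, hc⟩ := (hq.fibre _ _).1 hb.symm
    have hu : Irr (Set.univ : Set (ℂ × ℂ)) := irr_of_lines Set.univ_nonempty (by simp)
    have hfa : IsPoly (fun c : ℂ × ℂ => f (σ c a.1)) := hf.comp (hq.poly a.1)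
    have hga : IsPoly (fun c : ℂ × ℂ => g (σ c a.1)) := hg.comp (hq.poly a.1)
    have G1 : Gen Set.univ (fun c : ℂ × ℂ => f (σ c a.1) ≠ 0) :=
      Gen.of_ne hfa ⟨(1, 1), Set.mem_univ _, by rwa [hq.one]⟩
    have G2 : Gen Set.univ (fun c : ℂ × ℂ => g (σ c a.1) ≠ 0) :=
      Gen.of_ne hga ⟨c, Set.mem_univ _, hc ▸ hb'⟩
    have G3 : Gen Set.univ (fun c : ℂ × ℂ => c.1 ≠ 0) :=
      Gen.of_ne isPoly_fst ⟨(1, 1), Set.mem_univ _, one_ne_zero⟩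
    have G4 : Gen Set.univ (fun c : ℂ × ℂ => c.2 ≠ 0) :=
      Gen.of_ne isPoly_snd ⟨(1, 1), Set.mem_univ _, one_ne_zero⟩
    obtain ⟨e, -, ⟨h1, h2⟩, h3, h4⟩ := ((G1.and hu G2).and hu (G3.and hu G4)).exists
    exact ⟨σ e a.1, mem_qlift_smul hq ⟨a.2, hp⟩ h3 h4, h1, h2⟩
  · intro h
    obtain ⟨v, hv, hvT⟩ := h.1
    refine ⟨⟨_, hvT⟩, ?_⟩
    rintro U V hU hV ⟨p, hp, hpU⟩ ⟨p', hp', hpV⟩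
    obtain ⟨a, rfl⟩ := hq.surj p
    obtain ⟨b, rfl⟩ := hq.surj p'
    rw [isOpen_coinduced, @isOpen_induced_iff _ _ (zariski M)] at hU hV
    obtain ⟨U', hU', hUU⟩ := hU
    obtain ⟨V', hV', hVV⟩ := hV
    have e1 : ∀ z : {v : M // P v}, z.1 ∈ U' ↔ q z ∈ U := fun z => Set.ext_iff.1 hUU z
    have e2 : ∀ z : {v : M // P v}, z.1 ∈ V' ↔ q z ∈ V := fun z => Set.ext_iff.1 hVV z
    let _ := zariski M
    obtain ⟨z, ⟨hz, hzT⟩, hzU, hzV⟩ := (isIrreducible_zariski_iff.2 h).2 U' V' hU' hV'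
      ⟨a.1, ⟨a.2, hp⟩, (e1 a).2 hpU⟩ ⟨b.1, ⟨b.2, hp'⟩, (e2 b).2 hpV⟩
    exact ⟨q ⟨z, hz⟩, hzT, (e1 ⟨z, hz⟩).1 hzU, (e2 ⟨z, hz⟩).1 hzV⟩

/-- Vanishing ideals of preimages embed the closed sets, with order reversed, into the ideals of a
Noetherian ring. -/
theorem noetherian_qtop (hq : IsTorusQuotient q σ) : @TopologicalSpace.NoetherianSpace Q (qtop q) := by
  let _ := qtop q
  refine ((TopologicalSpace.noetherianSpace_TFAE Q).out 0 1 :).2 ?_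
  have hanti : StrictAnti (fun T : TopologicalSpace.Closeds Q => vI (qlift q (T : Set Q))) := by
    intro S T hST
    refine lt_of_le_of_ne (fun f hf p hp => hf p (qlift_mono hST.le hp)) fun heq => ?_
    have hz := zcl_eq_of_vI_eq heq
    refine hST.not_ge ((qlift_subset_iff hq).1 fun v hv => ?_)
    exact isClosed_qtop_iff.1 S.isClosed v (hz ▸ subset_zcl _ hv) hv.1
  exact hanti.wellFoundedLT

/-- Write the closure of `A` as a finite union of irreducible closed sets `s`; it is then the union
of the closures of the sets `s ∩ A`. A component lies in one of these, and maximality identifies it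
with that `s`. This gives honest points of the defining set in a component of the ramification
locus. -/
theorem component_subset_closure (hq : IsTorusQuotient q σ) {A Z : Set Q}
    (hZ : IsComponent (qtop q) (@closure Q (qtop q) A) Z) :
    Z ⊆ @closure Q (qtop q) (Z ∩ A) := by
  classical
  let _ := qtop q
  have := noetherian_qtop hq
  obtain ⟨S, hS, hSc, hSi, hSA⟩ :=
    TopologicalSpace.NoetherianSpace.exists_finite_set_isClosed_irreducible (isClosed_closure (s := A))
  lift S to Finset (Set Q) using hS
  obtain ⟨t, ht, hZt⟩ := isIrreducible_iff_sUnion_isClosed.1 hZ.1.1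
    (S.image fun s => closure (s ∩ A)) (by simp) (by
      refine hZ.1.2.trans (closure_minimal (fun p hp => ?_) ?_)
      · have h1 : p ∈ closure A := subset_closure hp
        rw [hSA] at h1
        obtain ⟨s, hs, hps⟩ := h1
        exact ⟨_, Finset.mem_coe.2 (Finset.mem_image_of_mem _ hs), subset_closure ⟨hps, hp⟩⟩
      · rw [Set.sUnion_eq_biUnion]
        exact (Finset.finite_toSet _).isClosed_biUnion fun s hs => by
          obtain ⟨r, _, rfl⟩ := Finset.mem_image.1 hs
          exact isClosed_closure)
  obtain ⟨s, hs, rfl⟩ := Finset.mem_image.1 ht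
  have hss : closure (s ∩ A) ⊆ s := closure_minimal Set.inter_subset_left (hSc s hs)
  have hsZ : s ⊆ Z := hZ.2 ⟨hSi s hs, hSA ▸ Set.subset_sUnion_of_mem hs⟩ (hZt.trans hss)
  exact hZt.trans (closure_mono (Set.inter_subset_inter_left A hsZ))

theorem component_isClosed {A Z : Set Q}
    (hZ : IsComponent (qtop q) (@closure Q (qtop q) A) Z) : IsClosed[qtop q] Z := by
  let _ := qtop q
  have h := hZ.2 (y := closure Z) ⟨hZ.1.1.closure, closure_minimal hZ.1.2 isClosed_closure⟩
    subset_closure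
  exact isClosed_of_closure_subset h

end Quotient

/-! ### Projective and biprojective spaces as torus quotients; affine cones. -/

section Projective

variable (E : Type u) [AddCommGroup E] [Module ℂ E] [FiniteDimensional ℂ E]

/-- The quotient map onto the projective space. -/
noncomputable def projMk : {v : E // v ≠ 0} → ℙ ℂ E := fun v => Projectivization.mk ℂ v.1 v.2

/-- The quotient map onto the product of two projective spaces. -/
noncomputable def biprojMk : {v : E × E // v.1 ≠ 0 ∧ v.2 ≠ 0} → ℙ ℂ E × ℙ ℂ E := fun v =>
  (Projectivization.mk ℂ v.1.1 v.2.1, Projectivization.mk ℂ v.1.2 v.2.2)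

/-- Only the first torus parameter acts; the second is idle, so that one theory serves both `ℙ` and
`ℙ × ℙ`. -/
theorem isTorusQuotient_projMk :
    IsTorusQuotient (projMk E) (fun c => c.1 • LinearMap.id) where
  surj p := ⟨⟨p.rep, p.rep_nonzero⟩, p.mk_rep⟩
  poly v := isPoly_fst.smul (isPoly_const v)
  one v := by simp
  stable c v h1 _ hv := by simpa [h1] using hv
  fibre v w := by
    rw [projMk, projMk, eq_comm, Projectivization.mk_eq_mk_iff']
    constructor
    · rintro ⟨a, ha⟩
      refine ⟨(a, 1), ?_, one_ne_zero, by simpa using ha.symm⟩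
      rintro rfl
      exact w.2 (by rw [← ha, zero_smul])
    · rintro ⟨c, _, _, h⟩
      exact ⟨c.1, by simpa using h.symm⟩

theorem isTorusQuotient_biprojMk :
    IsTorusQuotient (biprojMk E)
      (fun c => LinearMap.prodMap (c.1 • LinearMap.id) (c.2 • LinearMap.id)) where
  surj p := ⟨⟨(p.1.rep, p.2.rep), p.1.rep_nonzero, p.2.rep_nonzero⟩, by simp [biprojMk]⟩
  poly v := (isPoly_fst.smul (isPoly_const v.1)).prodMk (isPoly_snd.smul (isPoly_const v.2))
  one v := by simp
  stable c v h1 h2 hv := by simpa [h1, h2] using hv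
  fibre v w := by
    rw [biprojMk, biprojMk, eq_comm, Prod.mk.injEq, Projectivization.mk_eq_mk_iff',
      Projectivization.mk_eq_mk_iff']
    constructor
    · rintro ⟨⟨a, ha⟩, ⟨b, hb⟩⟩
      refine ⟨(a, b), ?_, ?_, Prod.ext (by simpa using ha.symm) (by simpa using hb.symm)⟩
      · rintro rfl
        exact w.2.1 (by rw [← ha, zero_smul])
      · rintro rfl
        exact w.2.2 (by rw [← hb, zero_smul])
    · rintro ⟨c, _, _, h⟩
      rw [Prod.ext_iff] at h
      exact ⟨⟨c.1, by simpa using h.1.symm⟩, ⟨c.2, by simpa using h.2.symm⟩⟩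

theorem qtop_projMk : qtop (projMk E) = zariskiProj E := rfl

variable {E}

/-- The punctured affine cone. -/
def pcone (S : Set (ℙ ℂ E)) : Set E := qlift (projMk E) S

theorem mem_pcone {S : Set (ℙ ℂ E)} {v : E} :
    v ∈ pcone S ↔ ∃ h : v ≠ 0, Projectivization.mk ℂ v h ∈ S := Iff.rfl

theorem mem_bicone {S : Set (ℙ ℂ E × ℙ ℂ E)} {v : E × E} :
    v ∈ bicone S ↔ ∃ (h₁ : v.1 ≠ 0) (h₂ : v.2 ≠ 0),
    (Projectivization.mk ℂ v.1 h₁, Projectivization.mk ℂ v.2 h₂) ∈ S := Iff.rfl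

theorem qlift_biprojMk (S : Set (ℙ ℂ E × ℙ ℂ E)) : qlift (biprojMk E) S = bicone S := by
  ext v
  exact ⟨fun ⟨h, hv⟩ => ⟨h.1, h.2, hv⟩, fun ⟨h1, h2, hv⟩ => ⟨⟨h1, h2⟩, hv⟩⟩

theorem mem_pcone_smul {S : Set (ℙ ℂ E)} {v : E} (hv : v ∈ pcone S) {c : ℂ} (hc : c ≠ 0) :
    c • v ∈ pcone S :=
  mem_qlift_smul (isTorusQuotient_projMk E) hv (c := (c, 1)) hc one_ne_zero

theorem mem_bicone_smul {S : Set (ℙ ℂ E × ℙ ℂ E)} {v : E × E} (hv : v ∈ bicone S) {c d : ℂ}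
    (hc : c ≠ 0) (hd : d ≠ 0) : (c • v.1, d • v.2) ∈ bicone S := by
  rw [← qlift_biprojMk] at hv ⊢
  exact mem_qlift_smul (isTorusQuotient_biprojMk E) hv (c := (c, d)) hc hd

theorem mem_pcone_rep {S : Set (ℙ ℂ E)} {p : ℙ ℂ E} : p.rep ∈ pcone S ↔ p ∈ S := by
  rw [mem_pcone]
  simp [p.rep_nonzero]

theorem mem_cone_iff {S : Set (ℙ ℂ E)} {v : E} : v ∈ cone S ↔ v = 0 ∨ v ∈ pcone S := by
  by_cases h : v = 0
  · simp [h, cone]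
  · simp [h, cone, mem_pcone]

theorem mem_cone_smul {S : Set (ℙ ℂ E)} {v : E} (hv : v ∈ cone S) (c : ℂ) : c • v ∈ cone S := by
  rw [mem_cone_iff] at hv ⊢
  by_cases hc : c = 0
  · simp [hc]
  · rcases hv with rfl | hv
    · simp
    · exact Or.inr (mem_pcone_smul hv hc)

theorem pcone_subset_cone (S : Set (ℙ ℂ E)) : pcone S ⊆ cone S :=
  fun _ hv => mem_cone_iff.2 (Or.inr hv)

theorem pcone_subset_pcone {S T : Set (ℙ ℂ E)} : pcone S ⊆ pcone T ↔ S ⊆ T :=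
  qlift_subset_iff (isTorusQuotient_projMk E)

theorem bicone_subset_bicone {S T : Set (ℙ ℂ E × ℙ ℂ E)} : bicone S ⊆ bicone T ↔ S ⊆ T := by
  rw [← qlift_biprojMk, ← qlift_biprojMk]
  exact qlift_subset_iff (isTorusQuotient_biprojMk E)

/-- The vertex of a nonempty punctured cone is in its closure. -/
theorem zero_mem_zcl_of_smul {S : Set E} (hS : S.Nonempty)
    (hs : ∀ c : ℂ, c ≠ 0 → ∀ v ∈ S, c • v ∈ S) : (0 : E) ∈ zcl S := by
  obtain ⟨v, hv⟩ := hS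
  intro f hf h0
  have hu : Irr (Set.univ : Set ℂ) := irr_of_lines Set.univ_nonempty (by simp)
  have hp : IsPoly (fun c : ℂ => f (c • v)) := hf.comp (isPoly_id.smul (isPoly_const v))
  have := Gen.vanish hu hp ⟨fun c => c, isPoly_id, ⟨1, Set.mem_univ _, one_ne_zero⟩,
    fun c _ hc => h0 _ (hs c hc v hv)⟩ 0 (Set.mem_univ _)
  simpa using this

theorem zcl_cone {S : Set (ℙ ℂ E)} (hS : S.Nonempty) : zcl (cone S) = zcl (pcone S) := by
  refine (zcl_subset_zcl fun v hv => ?_).antisymm (zcl_mono (pcone_subset_cone S))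
  rcases mem_cone_iff.1 hv with rfl | hv
  · obtain ⟨p, hp⟩ := hS
    exact zero_mem_zcl_of_smul ⟨_, mem_pcone_rep.2 hp⟩ fun c hc v hv => mem_pcone_smul hv hc
  · exact subset_zcl _ hv

theorem isClosed_zariskiProj_iff {S : Set (ℙ ℂ E)} :
    IsClosed[zariskiProj E] S ↔ ∀ v ∈ zcl (pcone S), v ≠ 0 → v ∈ pcone S :=
  isClosed_qtop_iff (q := projMk E)

theorem isIrreducible_zariskiProj_iff {S : Set (ℙ ℂ E)} :
    @IsIrreducible _ (zariskiProj E) S ↔ Irr (pcone S) :=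
  isIrreducible_qtop_iff (isTorusQuotient_projMk E)

theorem mem_pcone_closure {S : Set (ℙ ℂ E)} {v : E} :
    v ∈ pcone (@closure _ (zariskiProj E) S) ↔ v ≠ 0 ∧ v ∈ zcl (pcone S) :=
  mem_qlift_closure (isTorusQuotient_projMk E)

theorem zcl_pcone_closure (S : Set (ℙ ℂ E)) :
    zcl (pcone (@closure _ (zariskiProj E) S)) = zcl (pcone S) :=
  zcl_qlift_closure (isTorusQuotient_projMk E) S

theorem isIrreducible_zariskiBiproj_iff {S : Set (ℙ ℂ E × ℙ ℂ E)} :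
    @IsIrreducible _ (zariskiBiproj E) S ↔ Irr (bicone S) := by
  rw [← qlift_biprojMk]
  exact isIrreducible_qtop_iff (isTorusQuotient_biprojMk E)

theorem isClosed_zariskiBiproj_iff {S : Set (ℙ ℂ E × ℙ ℂ E)} :
    IsClosed[zariskiBiproj E] S ↔ ∀ v ∈ zcl (bicone S), v.1 ≠ 0 ∧ v.2 ≠ 0 → v ∈ bicone S := by
  rw [← qlift_biprojMk]
  exact isClosed_qtop_iff (q := biprojMk E)

theorem mem_bicone_closure {S : Set (ℙ ℂ E × ℙ ℂ E)} {v : E × E} :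
    v ∈ bicone (@closure _ (zariskiBiproj E) S) ↔ (v.1 ≠ 0 ∧ v.2 ≠ 0) ∧ v ∈ zcl (bicone S) := by
  rw [← qlift_biprojMk, ← qlift_biprojMk]
  exact mem_qlift_closure (isTorusQuotient_biprojMk E)

theorem zcl_bicone_closure (S : Set (ℙ ℂ E × ℙ ℂ E)) :
    zcl (bicone (@closure _ (zariskiBiproj E) S)) = zcl (bicone S) := by
  rw [← qlift_biprojMk, ← qlift_biprojMk]
  exact zcl_qlift_closure (isTorusQuotient_biprojMk E) S

theorem zcl_cone_subset {S : Set (ℙ ℂ E)} (hS : IsClosed[zariskiProj E] S) (hne : S.Nonempty) :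
    zcl (cone S) ⊆ cone S := by
  intro v hv
  rw [zcl_cone hne] at hv
  by_cases h : v = 0
  · simp [h, cone]
  · exact pcone_subset_cone S (isClosed_zariskiProj_iff.1 hS v hv h)

theorem irr_cone {S : Set (ℙ ℂ E)} (hS : @IsIrreducible _ (zariskiProj E) S) : Irr (cone S) := by
  refine (isIrreducible_zariskiProj_iff.1 hS).of_zcl_eq (zcl_cone hS.1).symm

/-- The projective closure of a conic set, in terms of its affine cone. -/
theorem zcl_pcone_mk {A : Set E} (hA : ∀ c : ℂ, c ≠ 0 → ∀ v ∈ A, c • v ∈ A) :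
    pcone {q | ∃ x ∈ A, ∃ hx : x ≠ 0, q = Projectivization.mk ℂ x hx} = A \ {0} := by
  ext v
  constructor
  · rintro ⟨hv, x, hx, hx0, h⟩
    obtain ⟨c, hc⟩ := (Projectivization.mk_eq_mk_iff' ℂ _ _ hv hx0).1 h
    refine ⟨?_, hv⟩
    rw [← hc]
    refine hA c ?_ x hx
    rintro rfl
    exact hv (by rw [← hc, zero_smul])
  · rintro ⟨hv, hv0⟩
    exact ⟨hv0, v, hv, hv0, rfl⟩

theorem pcone_image_snd (Z : Set (ℙ ℂ E × ℙ ℂ E)) : pcone (Prod.snd '' Z) = Prod.snd '' bicone Z := by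
  ext v
  constructor
  · rintro ⟨hv, ⟨p, q⟩, hz, h⟩
    refine ⟨(p.rep, v), ⟨p.rep_nonzero, hv, ?_⟩, rfl⟩
    simp only [Projectivization.mk_rep]
    change q = _ at h
    subst h
    exact hz
  · rintro ⟨z, ⟨h1, h2, hz⟩, rfl⟩
    exact ⟨h2, _, hz, rfl⟩

theorem pcone_image_fst (Z : Set (ℙ ℂ E × ℙ ℂ E)) : pcone (Prod.fst '' Z) = Prod.fst '' bicone Z := by
  ext v
  constructor
  · rintro ⟨hv, ⟨p, q⟩, hz, h⟩
    refine ⟨(v, q.rep), ⟨hv, q.rep_nonzero, ?_⟩, rfl⟩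
    simp only [Projectivization.mk_rep]
    change p = _ at h
    subst h
    exact hz
  · rintro ⟨z, ⟨h1, h2, hz⟩, rfl⟩
    exact ⟨h1, _, hz, rfl⟩

end Projective

/-! ### Lines, curves and scalars acting on tangent spaces. -/

section Complements

variable {E : Type u} [AddCommGroup E] [Module ℂ E] [FiniteDimensional ℂ E]
  {F : Type v} [AddCommGroup F] [Module ℂ F] [FiniteDimensional ℂ F]

theorem Irr.of_gen {S : Set E} (hS : Irr S) {P : E → Prop} (h : Gen S P) : Irr {p | p ∈ S ∧ P p} :=
  hS.of_zcl_eq (Gen.zcl_eq hS h).symm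

theorem irr_univ : Irr (Set.univ : Set E) :=
  irr_of_lines ⟨0, trivial⟩ fun _ _ _ _ _ => trivial

theorem irr_submodule (W : Submodule ℂ E) : Irr (W : Set E) :=
  irr_of_lines ⟨0, W.zero_mem⟩ fun _ hp _ hq t => W.add_mem hp (W.smul_mem t (W.sub_mem hq hp))

/-- Differentiation along a polynomial map that sends a dense open subset of `W` to `zcl S`. -/
theorem Gen.pd_mem_tangentSpace {W : Set F} (hW : Irr W) {S : Set E} {g : F → E} (hg : IsPoly g)
    (h : Gen W (fun p => g p ∈ zcl S)) {p v : F} (hv : v ∈ tangentSpace W p) :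
    pd g p v ∈ tangentSpace S (g p) := by
  rw [← tangentSpace_zcl S]
  refine Focal.pd_mem_tangentSpace (T := zcl S) hg (fun q hq => ?_) hv
  intro f hf h0
  exact Gen.vanish hW (hf.comp hg) (h.mono fun r hr hr' => hr' f hf h0) q hq

theorem mem_zcl_of_curve {S : Set E} {g : ℂ → E} (hg : IsPoly g) (h : ∀ t, t ≠ 0 → g t ∈ S) :
    g 0 ∈ zcl S := by
  have h0 : (0 : ℂ) ∈ zcl {t : ℂ | t ≠ 0} :=
    zero_mem_zcl_of_smul ⟨1, one_ne_zero⟩ fun c hc v hv => mul_ne_zero hc hv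
  exact mem_zcl_of_map hg (fun t ht => subset_zcl _ (h t ht)) h0

theorem tangentSpace_univ (p : E) : tangentSpace (Set.univ : Set E) p = ⊤ := by
  rw [eq_top_iff]
  intro v _
  refine mem_tangentSpace.2 fun f hf h0 => ?_
  have : f = fun _ => 0 := funext fun q => h0 q trivial
  rw [this, pd_const]; rfl

/-- The direction of an affine line contained in `S` is tangent to `S`. -/
theorem mem_tangentSpace_of_line {S : Set E} {p v : E} (h : ∀ t : ℂ, p + t • v ∈ S) :
    v ∈ tangentSpace S p := by
  have hg : IsPoly (fun t : ℂ => p + t • v) := (isPoly_const p).add (isPoly_id.smul (isPoly_const v))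
  have := pd_mem_tangentSpace (S := Set.univ) hg (fun t _ => h t) (p := 0) (v := 1)
    (by rw [tangentSpace_univ]; trivial)
  simp only [zero_smul, add_zero] at this
  convert! this
  rw [pd_add (isPoly_const p) (isPoly_id.smul (isPoly_const v)), pd_const, LinearMap.add_apply,
    pd_smul isPoly_id (isPoly_const v), pd_const]
  have : pd (fun x : ℂ => x) 0 = LinearMap.id := pd_linear LinearMap.id 0
  simp [this]

/-- A point of a conic set is a tangent vector at itself. -/
theorem self_mem_tangentSpace {S : Set E} {p : E} (h : ∀ c : ℂ, c ≠ 0 → c • p ∈ S) :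
    p ∈ tangentSpace S p := by
  rw [← tangentSpace_zcl]
  have hg : IsPoly (fun t : ℂ => t • p) := isPoly_id.smul (isPoly_const p)
  have h0 := mem_zcl_of_curve hg h
  refine mem_tangentSpace_of_line fun t => ?_
  have e : p + t • p = (1 + t) • p := by rw [add_smul, one_smul]
  rw [e]
  by_cases ht : 1 + t = 0
  · simpa only [ht] using h0
  · exact subset_zcl _ (h _ ht)

theorem map_mem_tangentSpace {S : Set E} {T : Set F} (A : E →ₗ[ℂ] F) (hA : ∀ q ∈ S, A q ∈ T)
    {p v : E} (hv : v ∈ tangentSpace S p) : A v ∈ tangentSpace T (A p) := by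
  simpa [pd_linear] using pd_mem_tangentSpace (isPoly_linear A) hA hv

theorem tangentSpace_smul {S : Set E} (h : ∀ c : ℂ, c ≠ 0 → ∀ q ∈ S, c • q ∈ S) {c : ℂ}
    (hc : c ≠ 0) (p : E) : tangentSpace S (c • p) = tangentSpace S p := by
  have key : ∀ (d : ℂ) (q : E), d ≠ 0 → tangentSpace S q ≤ tangentSpace S (d • q) := by
    intro d q hd v hv
    have := map_mem_tangentSpace (d • LinearMap.id (R := ℂ) (M := E)) (T := S)
      (fun q hq => by simpa using h d hd q hq) hv
    simp only [LinearMap.smul_apply, LinearMap.id_apply] at this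
    simpa [smul_smul, hd] using Submodule.smul_mem _ d⁻¹ this
  refine le_antisymm ?_ (key c p hc)
  simpa [smul_smul, hc] using key c⁻¹ (c • p) (inv_ne_zero hc)

theorem IsSmoothPt.smul {S : Set E} (h : ∀ c : ℂ, c ≠ 0 → ∀ q ∈ S, c • q ∈ S) {c : ℂ}
    (hc : c ≠ 0) {p : E} (hp : IsSmoothPt S p) : IsSmoothPt S (c • p) :=
  ⟨h c hc p hp.1, fun q hq => by rw [tangentSpace_smul h hc]; exact hp.2 q hq⟩

end Complements

/-! ### Saturation and maximality of components. -/

section Quotient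

variable {M : Type u} [AddCommGroup M] [Module ℂ M] [FiniteDimensional ℂ M] {P : M → Prop}
  {Q : Type u} {q : {v : M // P v} → Q} {σ : ℂ × ℂ → M →ₗ[ℂ] M}

/-- The saturation of an irreducible set is irreducible. -/
theorem irr_qlift_image (hq : IsTorusQuotient q σ) {T : Set M} (hT : Irr T) (hTP : ∀ v ∈ T, P v) :
    Irr (qlift q {a | ∃ v, ∃ hv : v ∈ T, a = q ⟨v, hTP v hv⟩}) := by
  have hmem : ∀ w, w ∈ qlift q {a | ∃ v, ∃ hv : v ∈ T, a = q ⟨v, hTP v hv⟩} ↔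
      ∃ c : ℂ × ℂ, c.1 ≠ 0 ∧ c.2 ≠ 0 ∧ ∃ v ∈ T, w = σ c v := by
    intro w
    constructor
    · rintro ⟨hw, v, hv, h⟩
      obtain ⟨c, h1, h2, h3⟩ := (hq.fibre _ _).1 h.symm
      exact ⟨c, h1, h2, v, hv, h3⟩
    · rintro ⟨c, h1, h2, v, hv, rfl⟩
      exact ⟨hq.stable c v h1 h2 (hTP v hv), v, hv, ((hq.fibre _ _).2 ⟨c, h1, h2, rfl⟩).symm⟩
  obtain ⟨v₀, hv₀⟩ := hT.1
  refine ⟨⟨v₀, (hmem _).2 ⟨(1, 1), one_ne_zero, one_ne_zero, v₀, hv₀, (hq.one v₀).symm⟩⟩, ?_⟩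
  rintro f g hf hg ⟨p, hp, hfp⟩ ⟨p', hp', hgp⟩
  obtain ⟨c, h1, h2, v, hv, rfl⟩ := (hmem _).1 hp
  obtain ⟨c', h1', h2', v', hv', rfl⟩ := (hmem _).1 hp'
  -- Irreducibility of `T` is applied first, with the two torus elements fixed; irreducibility of
  -- the torus then replaces them by a single element.
  obtain ⟨w, hw, hfw, hgw⟩ := hT.2 _ _ (hf.comp (isPoly_linear (σ c)))
    (hg.comp (isPoly_linear (σ c'))) ⟨v, hv, hfp⟩ ⟨v', hv', hgp⟩
  have hG : Irr (Set.univ : Set (ℂ × ℂ)) := irr_univ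
  obtain ⟨d, -, hd1, hd2, hd3, hd4⟩ := ((Gen.of_ne (hf.comp (hq.poly w)) ⟨c, Set.mem_univ _, hfw⟩).and hG
    ((Gen.of_ne (hg.comp (hq.poly w)) ⟨c', Set.mem_univ _, hgw⟩).and hG
    ((Gen.of_ne isPoly_fst ⟨c, Set.mem_univ _, h1⟩).and hG
      (Gen.of_ne isPoly_snd ⟨c, Set.mem_univ _, h2⟩)))).exists
  exact ⟨_, (hmem _).2 ⟨d, hd3, hd4, w, hw, rfl⟩, hd1, hd2⟩

/-- Maximality of an irreducible component, in terms of irreducible subsets of the vector space. -/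
theorem IsComponent.subset_qlift (hq : IsTorusQuotient q σ) {A Z : Set Q}
    (hA : IsClosed[qtop q] A) (hZ : IsComponent (qtop q) A Z) {T : Set M} (hT : Irr T)
    (hTP : ∀ v ∈ T, P v) (hTA : T ⊆ qlift q A) (hZT : qlift q Z ⊆ zcl T) : T ⊆ qlift q Z := by
  let _ := qtop q
  set T' : Set Q := {a | ∃ v, ∃ hv : v ∈ T, a = q ⟨v, hTP v hv⟩}
  have hTT : T ⊆ qlift q T' := fun v hv => ⟨hTP v hv, v, hv, rfl⟩
  have hirr : IsIrreducible T' := (isIrreducible_qtop_iff hq).2 (irr_qlift_image hq hT hTP)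
  have hTA' : T' ⊆ A := by
    rintro _ ⟨v, hv, rfl⟩
    exact (hTA hv).2
  have hZT' : Z ⊆ closure T' := by
    rw [← qlift_subset_iff hq]
    intro v hv
    exact (mem_qlift_closure hq).2 ⟨hv.1, zcl_mono hTT (hZT hv)⟩
  have := hZ.2 ⟨hirr.closure, closure_minimal hTA' hA⟩ hZT'
  exact hTT.trans (qlift_mono (subset_closure.trans this))

end Quotient

/-! ### The standing hypotheses and the conditions of general position on affine cones. -/

section Setting

variable {V' : Type u} [AddCommGroup V'] [Module ℂ V'] [FiniteDimensional ℂ V']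

/-- The standing hypotheses: a non-degenerate symmetric form and an irreducible projective
variety. -/
structure IsSetting (B : LinearMap.BilinForm ℂ V') (X : Set (ℙ ℂ (V' × ℂ))) : Prop where
  symm : B.IsSymm
  nondeg : B.Nondegenerate
  closed : IsClosed[zariskiProj (V' × ℂ)] X
  irr : @IsIrreducible _ (zariskiProj (V' × ℂ)) X

variable {B : LinearMap.BilinForm ℂ V'} {X : Set (ℙ ℂ (V' × ℂ))}

theorem normalSpace_smul (B : LinearMap.BilinForm ℂ V') (X : Set (ℙ ℂ (V' × ℂ))) {c : ℂ}
    (hc : c ≠ 0) (x : V' × ℂ) : normalSpace B X (c • x) = normalSpace B X x := by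
  rw [normalSpace, normalSpace, normalDirections, normalDirections, tangentDirections,
    tangentDirections, tangentSpace_smul (fun c _ q hq => mem_cone_smul hq c) hc,
    Submodule.span_singleton_smul_eq hc.isUnit]

theorem normalDirections_smul (B : LinearMap.BilinForm ℂ V') (X : Set (ℙ ℂ (V' × ℂ))) {c : ℂ}
    (hc : c ≠ 0) (x : V' × ℂ) : normalDirections B X (c • x) = normalDirections B X x := by
  rw [normalDirections, normalDirections, tangentDirections,
    tangentDirections, tangentSpace_smul (fun c _ q hq => mem_cone_smul hq c) hc]

/-- The punctured affine cone over `orthGeneral B X`. -/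
def general (B : LinearMap.BilinForm ℂ V') (X : Set (ℙ ℂ (V' × ℂ))) : Set (V' × ℂ) :=
  pcone (orthGeneral B X)

/-- The definition refers to a chosen representative of the projective point; smoothness,
transversality and the normal directions are all unchanged by rescaling. -/
theorem mem_general {x : V' × ℂ} : x ∈ general B X ↔ IsSmoothPt (cone X) x ∧
    (∃ v ∈ tangentSpace (cone X) x, v.2 ≠ 0) ∧
      x ∉ (normalDirections B X x).map (LinearMap.inl ℂ V' ℂ) := by
  have hcone : ∀ c : ℂ, c ≠ 0 → ∀ q ∈ cone X, c • q ∈ cone X := fun c _ q hq => mem_cone_smul hq c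
  rw [general, mem_pcone]
  constructor
  · rintro ⟨hx, h1, h2, h3⟩
    obtain ⟨a, ha⟩ := Projectivization.exists_smul_eq_mk_rep ℂ x hx
    rw [← ha, Units.smul_def] at h1 h2 h3
    have ha0 := a.ne_zero
    rw [tangentSpace_smul hcone ha0] at h2
    rw [normalDirections_smul B X ha0] at h3
    refine ⟨?_, h2, fun h => h3 (Submodule.smul_mem _ _ h)⟩
    simpa [smul_smul] using h1.smul hcone (inv_ne_zero ha0)
  · rintro ⟨h1, h2, h3⟩
    have hx : x ≠ 0 := fun h => h3 (h ▸ Submodule.zero_mem _)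
    refine ⟨hx, ?_⟩
    obtain ⟨a, ha⟩ := Projectivization.exists_smul_eq_mk_rep ℂ x hx
    have ha0 := a.ne_zero
    rw [orthGeneral, Set.mem_ofPred_eq, ← ha, Units.smul_def, tangentSpace_smul hcone ha0,
      normalDirections_smul B X ha0]
    refine ⟨h1.smul hcone ha0, h2, fun h => h3 ?_⟩
    simpa [smul_smul] using Submodule.smul_mem _ (a : ℂ)⁻¹ h

theorem ne_zero_of_mem_general {x : V' × ℂ} (h : x ∈ general B X) : x ≠ 0 := h.1

theorem smul_mem_general {x : V' × ℂ} (h : x ∈ general B X) {c : ℂ} (hc : c ≠ 0) :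
    c • x ∈ general B X := mem_pcone_smul h hc

theorem mem_bicone_normalBundle {p : (V' × ℂ) × (V' × ℂ)} :
    p ∈ bicone (normalBundle B X) ↔ p.1 ∈ general B X ∧ p.2 ≠ 0 ∧ p.2 ∈ normalSpace B X p.1 := by
  rw [mem_bicone]
  have key : ∀ (h1 : p.1 ≠ 0) (h2 : p.2 ≠ 0),
      (Projectivization.mk ℂ p.2 h2).rep ∈ normalSpace B X (Projectivization.mk ℂ p.1 h1).rep ↔
      p.2 ∈ normalSpace B X p.1 := by
    intro h1 h2
    obtain ⟨a, ha⟩ := Projectivization.exists_smul_eq_mk_rep ℂ p.1 h1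
    obtain ⟨b, hb⟩ := Projectivization.exists_smul_eq_mk_rep ℂ p.2 h2
    rw [← ha, ← hb, Units.smul_def, Units.smul_def, normalSpace_smul B X a.ne_zero]
    exact Submodule.smul_mem_iff _ b.ne_zero
  constructor
  · rintro ⟨h1, h2, h3, h4⟩
    exact ⟨⟨h1, h3⟩, h2, (key h1 h2).1 h4⟩
  · rintro ⟨⟨h1, h3⟩, h2, h4⟩
    exact ⟨h1, h2, h3, (key h1 h2).2 h4⟩

theorem mem_normalSpace {x y : V' × ℂ} : y ∈ normalSpace B X x ↔
    ∃ (a : ℂ) (w : V'), w ∈ normalDirections B X x ∧ y = a • x + (w, 0) := by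
  rw [normalSpace, Submodule.mem_sup]
  constructor
  · rintro ⟨y, hy, z, ⟨w, hw, rfl⟩, rfl⟩
    obtain ⟨a, rfl⟩ := Submodule.mem_span_singleton.1 hy
    exact ⟨a, w, hw, rfl⟩
  · rintro ⟨a, w, hw, rfl⟩
    exact ⟨a • x, Submodule.smul_mem _ _ (Submodule.mem_span_singleton_self x), (w, 0), ⟨w, hw, rfl⟩, rfl⟩

theorem self_mem_normalSpace (x : V' × ℂ) : x ∈ normalSpace B X x :=
  Submodule.mem_sup_left (Submodule.mem_span_singleton_self x)

theorem IsSetting.nonempty (H : IsSetting B X) : X.Nonempty := H.irr.1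

theorem IsSetting.zcl_cone_subset (H : IsSetting B X) : zcl (cone X) ⊆ cone X :=
  Focal.zcl_cone_subset H.closed H.nonempty

theorem IsSetting.irr_cone (H : IsSetting B X) : Irr (cone X) := Focal.irr_cone H.irr

end Setting

/-! ### Polynomial fields of tangent directions, normal directions and their annihilators. -/

section Sections

theorem span_range_eq_of_card {E : Type u} [AddCommGroup E] [Module ℂ E] [FiniteDimensional ℂ E]
    {W : Submodule ℂ E} {ι : Type*} [Fintype ι] {v : ι → E} (hv : LinearIndependent ℂ v)
    (hW : ∀ i, v i ∈ W) (hc : Fintype.card ι = Module.finrank ℂ W) :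
    Submodule.span ℂ (Set.range v) = W :=
  Submodule.eq_of_le_of_finrank_eq (Submodule.span_le.2 (Set.range_subset_iff.2 hW))
    (by rw [finrank_span_eq_card hv, hc])

theorem linearIndependent_coe_basis {E : Type u} [AddCommGroup E] [Module ℂ E]
    {W : Submodule ℂ E} {ι : Type*} (b : Module.Basis ι ℂ W) :
    LinearIndependent ℂ (fun i => (b i : E)) :=
  b.linearIndependent.map' W.subtype W.ker_subtype

variable {V' : Type u} [AddCommGroup V'] [Module ℂ V'] [FiniteDimensional ℂ V']
  {B : LinearMap.BilinForm ℂ V'} {X : Set (ℙ ℂ (V' × ℂ))}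

theorem mem_tangentDirections {x : V' × ℂ} {v : V'} :
    v ∈ tangentDirections X x ↔ (v, (0 : ℂ)) ∈ tangentSpace (cone X) x := Iff.rfl

theorem mem_normalDirections {x : V' × ℂ} {w : V'} :
    w ∈ normalDirections B X x ↔ ∀ v ∈ tangentDirections X x, B v w = 0 :=
  LinearMap.BilinForm.mem_orthogonal_iff

theorem mem_cone_of_general {x : V' × ℂ} (hx : x ∈ general B X) : x ∈ cone X :=
  (mem_general.1 hx).1.1

theorem self_mem_tangentSpace_cone {x : V' × ℂ} (hx : x ∈ cone X) :
    x ∈ tangentSpace (cone X) x := self_mem_tangentSpace fun c _ => mem_cone_smul hx c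

/-- Take tangent fields through `u₀` and through a vector transversal to infinity: the combination
cancelling their last coordinates is tangent and points in `V'`. -/
theorem exists_direction_field {x₀ : V' × ℂ} (hx : x₀ ∈ general B X) {u₀ : V'}
    (hu : u₀ ∈ tangentDirections X x₀) :
    ∃ u : V' × ℂ → V', IsPoly u ∧ u x₀ = u₀ ∧ ∀ x ∈ cone X, u x ∈ tangentDirections X x := by
  obtain ⟨h1, ⟨e₀, he₀, he⟩, -⟩ := mem_general.1 hx
  obtain ⟨a, ha, ha0, haT⟩ := exists_tangent_field h1 (mem_tangentDirections.1 hu)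
  obtain ⟨e, hep, he0, heT⟩ := exists_tangent_field h1 he₀
  -- The constant `e₀.2⁻¹` normalizes the value at `x₀`, where the last coordinate of `a` is zero.
  refine ⟨fun x => e₀.2⁻¹ • ((e x).2 • (a x).1 - (a x).2 • (e x).1), (isPoly_const _).smul
    ((hep.snd.smul ha.fst).sub (ha.snd.smul hep.fst)), ?_, fun x hxC => ?_⟩
  · simp [ha0, he0, smul_smul, he]
  · rw [mem_tangentDirections]
    have := Submodule.smul_mem _ e₀.2⁻¹ (Submodule.sub_mem _
      (Submodule.smul_mem _ (e x).2 (haT x hxC)) (Submodule.smul_mem _ (a x).2 (heT x hxC)))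
    convert! this using 1
    ext
    · simp
    · simp only [Prod.smul_snd, Prod.snd_sub, smul_eq_mul]; ring

/-- Transversality says that the last coordinate is a nonzero form on the tangent space; the tangent
directions are its kernel. -/
theorem finrank_tangentDirections {x : V' × ℂ} (hx : x ∈ general B X) :
    Module.finrank ℂ (tangentDirections X x) + 1 = gdim (cone X) := by
  obtain ⟨h1, ⟨e₀, he₀, he⟩, -⟩ := mem_general.1 hx
  rw [← (isSmoothPt_iff.1 h1).2]
  set T := tangentSpace (cone X) x
  let f : T →ₗ[ℂ] ℂ := (LinearMap.snd ℂ V' ℂ).domRestrict T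
  have hf : LinearMap.range f = ⊤ := by
    rw [LinearMap.range_eq_top]
    refine LinearMap.surjective fun h => he ?_
    exact LinearMap.congr_fun h ⟨e₀, he₀⟩
  have h2 := LinearMap.finrank_range_add_finrank_ker f
  rw [hf, finrank_top, Module.finrank_self] at h2
  have h3 : (LinearMap.ker f).map T.subtype =
      (tangentDirections X x).map (LinearMap.inl ℂ V' ℂ) := by
    ext v
    constructor
    · rintro ⟨⟨w, hw⟩, hw', rfl⟩
      refine ⟨w.1, ?_, ?_⟩
      · have : w = (w.1, 0) := Prod.ext rfl hw'
        rw [this] at hw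
        exact hw
      · exact Prod.ext rfl (Eq.symm hw')
    · rintro ⟨w, hw, rfl⟩
      exact ⟨⟨(w, 0), hw⟩, rfl, rfl⟩
  have h4 := congrArg (fun W : Submodule ℂ (V' × ℂ) => Module.finrank ℂ W) h3
  beta_reduce at h4
  rw [← (Submodule.equivMapOfInjective _ T.injective_subtype _).finrank_eq,
    ← (Submodule.equivMapOfInjective _ LinearMap.inl_injective _).finrank_eq] at h4
  omega

namespace IsSetting

theorem finrank_normalDirections (H : IsSetting B X) {x : V' × ℂ} (hx : x ∈ general B X) :
    Module.finrank ℂ (normalDirections B X x) + gdim (cone X) = Module.finrank ℂ V' + 1 := by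
  have h1 := finrank_tangentDirections hx
  have h2 : Module.finrank ℂ (normalDirections B X x) = _ :=
    LinearMap.BilinForm.finrank_orthogonal H.nondeg (tangentDirections X x)
  have h3 := Submodule.finrank_le (tangentDirections X x)
  omega

theorem finrank_normalSpace (H : IsSetting B X) {x : V' × ℂ} (hx : x ∈ general B X) :
    Module.finrank ℂ (normalSpace B X x) + gdim (cone X) = Module.finrank ℂ V' + 2 := by
  have h1 := H.finrank_normalDirections hx
  have h2 := Submodule.finrank_sup_add_finrank_inf_eq (Submodule.span ℂ {x})
    ((normalDirections B X x).map (LinearMap.inl ℂ V' ℂ))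
  have h3 : Submodule.span ℂ {x} ⊓ (normalDirections B X x).map (LinearMap.inl ℂ V' ℂ) = ⊥ := by
    rw [eq_bot_iff]
    rintro v ⟨hv1, hv2⟩
    obtain ⟨a, rfl⟩ := Submodule.mem_span_singleton.1 hv1
    by_cases ha : a = 0
    · simp [ha]
    · refine absurd ?_ (mem_general.1 hx).2.2
      simpa [smul_smul, ha] using Submodule.smul_mem _ a⁻¹ hv2
  rw [h3, finrank_bot, finrank_span_singleton (ne_zero_of_mem_general hx),
    ← (Submodule.equivMapOfInjective _ LinearMap.inl_injective _).finrank_eq] at h2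
  rw [normalSpace]
  omega

theorem linearIndependent_form (H : IsSetting B X) {ι : Type*} {v : ι → V'} :
    LinearIndependent ℂ (fun i => (B (v i) : Module.Dual ℂ V')) ↔ LinearIndependent ℂ v :=
  LinearMap.linearIndependent_iff (B : V' →ₗ[ℂ] Module.Dual ℂ V') H.nondeg.ker_eq_bot

/-- Normal directions solve the system given by pairing with fields of tangent directions. The rank
at general points is constant, so the fields span where they remain independent, and the Cramer
solution is zero elsewhere. -/
theorem exists_normal_field (H : IsSetting B X) {x₀ : V' × ℂ} (hx : x₀ ∈ general B X) {w₀ : V'}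
    (hw : w₀ ∈ normalDirections B X x₀) :
    ∃ w : V' × ℂ → V', IsPoly w ∧ w x₀ = w₀ ∧ ∀ x ∈ general B X, w x ∈ normalDirections B X x := by
  let b := Module.finBasis ℂ (tangentDirections X x₀)
  choose u hu hu0 huD using fun i => exists_direction_field hx (b i).2
  have hli : LinearIndependent ℂ (fun i => (B (u i x₀) : Module.Dual ℂ V')) := by
    rw [H.linearIndependent_form]
    simp only [hu0]
    exact linearIndependent_coe_basis b
  obtain ⟨w, hwp, hw0, hw1, hw2⟩ := exists_poly_solution
    (φ := fun i x => (B (u i x) : Module.Dual ℂ V'))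
    (fun i => (isPoly_linear (B : V' →ₗ[ℂ] Module.Dual ℂ V')).comp (hu i)) hli (v₀ := w₀)
    (fun i => by rw [hu0]; exact mem_normalDirections.1 hw _ (b i).2)
  refine ⟨w, hwp, hw0, fun x hxg => ?_⟩
  by_cases h : LinearIndependent ℂ (fun i => (B (u i x) : Module.Dual ℂ V'))
  · rw [H.linearIndependent_form] at h
    have hspan := span_range_eq_of_card h (fun i => huD i x (mem_cone_of_general hxg)) (by
      have h1 := finrank_tangentDirections hx
      have h2 := finrank_tangentDirections hxg
      rw [Fintype.card_fin]
      omega)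
    rw [mem_normalDirections, ← hspan]
    intro v hv
    induction hv using Submodule.span_induction with
    | mem v hv => obtain ⟨i, rfl⟩ := hv; exact hw1 x i
    | zero => simp
    | add a b _ _ ha hb => simp [ha, hb]
    | smul c a _ ha => simp [ha]
  · rw [hw2 x h]; exact Submodule.zero_mem _

theorem exists_section (H : IsSetting B X) {x₀ : V' × ℂ} (hx : x₀ ∈ general B X) {y₀ : V' × ℂ}
    (hy : y₀ ∈ normalSpace B X x₀) :
    ∃ s : V' × ℂ → V' × ℂ, IsPoly s ∧ s x₀ = y₀ ∧ ∀ x ∈ general B X, s x ∈ normalSpace B X x := by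
  obtain ⟨a, w₀, hw₀, rfl⟩ := mem_normalSpace.1 hy
  obtain ⟨w, hw, hw0, hwN⟩ := H.exists_normal_field hx hw₀
  exact ⟨fun x => a • x + (w x, 0), ((isPoly_const a).smul isPoly_id).add (hw.prodMk (isPoly_const 0)),
    by simp only [hw0], fun x hxg => mem_normalSpace.2 ⟨a, w x, hwN x hxg, rfl⟩⟩

theorem mem_tangentDirections_iff (H : IsSetting B X) {x : V' × ℂ} {u : V'} :
    u ∈ tangentDirections X x ↔ ∀ w ∈ normalDirections B X x, B u w = 0 := by
  have := LinearMap.BilinForm.orthogonal_orthogonal H.nondeg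
    (LinearMap.BilinForm.IsSymm.isRefl H.symm) (tangentDirections X x)
  conv_lhs => rw [← this, LinearMap.BilinForm.mem_orthogonal_iff]
  exact forall₂_congr fun w _ => by rw [← H.symm.eq]

theorem mem_map_inl_iff {x : V' × ℂ} : x ∈ (normalDirections B X x).map (LinearMap.inl ℂ V' ℂ) ↔
    x.2 = 0 ∧ ∀ u ∈ tangentDirections X x, B u x.1 = 0 := by
  rw [← mem_normalDirections]
  constructor
  · rintro ⟨w, hw, h⟩
    have h1 : w = x.1 := congrArg Prod.fst h
    have h2 : 0 = x.2 := congrArg Prod.snd h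
    exact ⟨h2.symm, h1 ▸ hw⟩
  · rintro ⟨h, hw⟩
    exact ⟨x.1, hw, Prod.ext rfl (by simpa using h.symm)⟩

/-- The annihilators of the normal spaces have enough polynomial sections over the whole cone. -/
theorem exists_annihilator (H : IsSetting B X) {x₀ : V' × ℂ} (hx : x₀ ∈ general B X)
    {l₀ : Module.Dual ℂ (V' × ℂ)} (hl : ∀ y ∈ normalSpace B X x₀, l₀ y = 0) :
    ∃ l : V' × ℂ → Module.Dual ℂ (V' × ℂ), IsPoly l ∧ l x₀ = l₀ ∧
      ∀ x ∈ cone X, ∀ y ∈ normalSpace B X x, l x y = 0 := by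
  let b : V' × ℂ →ₗ[ℂ] Module.Dual ℂ (V' × ℂ) :=
    ((LinearMap.fst ℂ V' ℂ).dualMap ∘ₗ (B : V' →ₗ[ℂ] Module.Dual ℂ V')).coprod
      (LinearMap.toSpanSingleton ℂ _ (LinearMap.snd ℂ V' ℂ))
  have hb : ∀ p y, b p y = B p.1 y.1 + p.2 * y.2 := fun p y => by simp [b]
  obtain ⟨u₀, hu₀⟩ : ∃ u₀ : V', ∀ w, l₀ (w, 0) = B u₀ w := by
    refine ⟨(B.toDual H.nondeg).symm (l₀ ∘ₗ LinearMap.inl ℂ V' ℂ), fun w => ?_⟩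
    have := LinearMap.BilinForm.apply_toDual_symm_apply (hB := H.nondeg)
      (l₀ ∘ₗ LinearMap.inl ℂ V' ℂ) w
    rw [this]; rfl
  set m₀ := l₀ (0, 1)
  have hl₀ : l₀ = b (u₀, m₀) := by
    ext w
    · simp [hb, hu₀]
    · simp [hb, m₀]
  have hu₀D : u₀ ∈ tangentDirections X x₀ := by
    rw [H.mem_tangentDirections_iff]
    intro w hw
    rw [← hu₀]
    exact hl _ (Submodule.mem_sup_right ⟨w, hw, rfl⟩)
  -- A second form of the same shape, with value 1 at `x₀`. It exists because `x₀` is not a normal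
  -- direction at itself.
  obtain ⟨u₁, hu₁D, m₁, h1⟩ : ∃ u₁ ∈ tangentDirections X x₀, ∃ m₁, b (u₁, m₁) x₀ = 1 := by
    have := (mem_general.1 hx).2.2
    rw [mem_map_inl_iff] at this
    by_cases h2 : x₀.2 = 0
    · simp only [h2, true_and] at this
      push Not at this
      obtain ⟨u, hu, hne⟩ := this
      exact ⟨(B u x₀.1)⁻¹ • u, Submodule.smul_mem _ _ hu, 0, by simp [hb, hne]⟩
    · exact ⟨0, Submodule.zero_mem _, x₀.2⁻¹, by simp [hb, h2]⟩
  obtain ⟨u, hu, hu0, huD⟩ := exists_direction_field hx hu₀D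
  obtain ⟨v, hv, hv0, hvD⟩ := exists_direction_field hx hu₁D
  have hP : ∀ {f : V' × ℂ → V'} (hf : IsPoly f) (c : ℂ), IsPoly (fun x => b (f x, c)) :=
    fun hf c => (isPoly_linear b).comp (hf.prodMk (isPoly_const c))
  have hP' : ∀ {f : V' × ℂ → V'} (hf : IsPoly f) (c : ℂ), IsPoly (fun x => b (f x, c) x) :=
    fun hf c => isPoly_bilin LinearMap.id (hP hf c) isPoly_id
  -- Both forms kill the normal directions; this alternating combination kills `x` as well, hence
  -- the whole normal space. At `x₀` its coefficients are 1 and 0.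
  refine ⟨fun x => b (v x, m₁) x • b (u x, m₀) - b (u x, m₀) x • b (v x, m₁),
    ((hP' hv _).smul (hP hu _)).sub ((hP' hu _).smul (hP hv _)), ?_, ?_⟩
  · simp only [hu0, hv0, h1, ← hl₀, hl _ (self_mem_normalSpace x₀)]
    simp
  · rintro x hxC y hy
    obtain ⟨a, w, hw, rfl⟩ := mem_normalSpace.1 hy
    have e1 := mem_normalDirections.1 hw _ (huD x hxC)
    have e2 := mem_normalDirections.1 hw _ (hvD x hxC)
    have e3 : b (u x, m₀) (w, 0) = 0 := by simp [hb, e1]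
    have e4 : b (v x, m₁) (w, 0) = 0 := by simp [hb, e2]
    simp only [LinearMap.sub_apply, LinearMap.smul_apply, map_add, map_smul, e3, e4, smul_eq_mul]
    ring

/-- The general points form a principal neighbourhood of each of their points. -/
theorem _root_.Focal.exists_general_nhd {x₀ : V' × ℂ} (hx : x₀ ∈ general B X) :
    ∃ h : V' × ℂ → ℂ, IsPoly h ∧ h x₀ ≠ 0 ∧ ∀ x ∈ cone X, h x ≠ 0 → x ∈ general B X := by
  obtain ⟨h1, ⟨e₀, he₀, he⟩, h3⟩ := mem_general.1 hx
  obtain ⟨d, hd, hd0, hdS⟩ := h1.nhd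
  obtain ⟨e, hep, he0, heT⟩ := exists_tangent_field h1 he₀
  obtain ⟨c, hc, hc0, hcN⟩ : ∃ c : V' × ℂ → ℂ, IsPoly c ∧ c x₀ ≠ 0 ∧ ∀ x ∈ cone X, c x ≠ 0 →
      x ∉ (normalDirections B X x).map (LinearMap.inl ℂ V' ℂ) := by
    rw [mem_map_inl_iff] at h3
    by_cases h2 : x₀.2 = 0
    · simp only [h2, true_and] at h3
      push Not at h3
      obtain ⟨u₀, hu₀, hne⟩ := h3
      obtain ⟨u, hu, hu0, huD⟩ := exists_direction_field hx hu₀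
      refine ⟨fun x => B (u x) x.1, isPoly_bilin _ hu isPoly_fst, by simp only [hu0]; exact hne,
        fun x hxC hxne hmem => hxne ?_⟩
      exact (mem_map_inl_iff.1 hmem).2 _ (huD x hxC)
    · exact ⟨fun x => x.2, isPoly_snd, h2, fun x _ hxne hmem => hxne (mem_map_inl_iff.1 hmem).1⟩
  refine ⟨fun x => d x * ((e x).2 * c x), isPoly_mul hd (isPoly_mul hep.snd hc), ?_,
    fun x hxC hne => ?_⟩
  · simp only [hd0, he0]
    exact mul_ne_zero one_ne_zero (mul_ne_zero he hc0)
  · rw [mem_general]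
    exact ⟨hdS x hxC (left_ne_zero_of_mul hne),
      ⟨e x, heT x hxC, left_ne_zero_of_mul (right_ne_zero_of_mul hne)⟩,
      hcN x hxC (right_ne_zero_of_mul (right_ne_zero_of_mul hne))⟩

theorem zcl_general (H : IsSetting B X) (hne : (general B X).Nonempty) :
    zcl (general B X) = zcl (cone X) := by
  obtain ⟨x₀, hx⟩ := hne
  obtain ⟨h, hh, h0, hg⟩ := exists_general_nhd hx
  have := Gen.zcl_eq H.irr_cone ⟨h, hh, ⟨x₀, mem_cone_of_general hx, h0⟩, hg⟩
  rw [← this]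
  congr 1
  ext x
  exact ⟨fun hx => ⟨mem_cone_of_general hx, hx⟩, fun hx => hx.2⟩

theorem irr_general (H : IsSetting B X) (hne : (general B X).Nonempty) : Irr (general B X) :=
  H.irr_cone.of_zcl_eq (H.zcl_general hne).symm

end IsSetting

end Sections

/-! ### The normal bundle on affine cones: irreducibility, dimension, ramification equation. -/

section NormalOver

variable {V' : Type u} [AddCommGroup V'] [Module ℂ V'] [FiniteDimensional ℂ V']
  {B : LinearMap.BilinForm ℂ V'} {X : Set (ℙ ℂ (V' × ℂ))}

/-- The total space of the normal spaces over a subset of the affine cone. -/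
def normalOver (B : LinearMap.BilinForm ℂ V') (X : Set (ℙ ℂ (V' × ℂ))) (Q : Set (V' × ℂ)) :
    Set ((V' × ℂ) × (V' × ℂ)) := {p | p.1 ∈ Q ∧ p.2 ∈ normalSpace B X p.1}

theorem normalOver_mono {Q Q' : Set (V' × ℂ)} (h : Q ⊆ Q') :
    normalOver B X Q ⊆ normalOver B X Q' := fun _ hp => ⟨h hp.1, hp.2⟩

/-- The two sets differ only by the zero vectors of the fibres, and `(x, 0)` is the limit of `(x, t
• x)`. -/
theorem zcl_bicone_normalBundle (D : Set (ℙ ℂ (V' × ℂ))) :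
    zcl (bicone {p | p ∈ normalBundle B X ∧ p.1 ∈ D}) =
      zcl (normalOver B X (pcone D ∩ general B X)) := by
  apply Set.Subset.antisymm
  · refine zcl_mono fun p hp => ?_
    have := mem_bicone_normalBundle.1 (show p ∈ bicone (normalBundle B X) from
      ⟨hp.1, hp.2.1, hp.2.2.1⟩)
    exact ⟨⟨⟨hp.1, hp.2.2.2⟩, this.1⟩, this.2.2⟩
  · refine zcl_subset_zcl ?_
    rintro ⟨x, y⟩ ⟨⟨hxD, hxg⟩, hy⟩
    have key : ∀ z, z ≠ 0 → z ∈ normalSpace B X x →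
        (x, z) ∈ bicone {p | p ∈ normalBundle B X ∧ p.1 ∈ D} := by
      intro z hz hzn
      obtain ⟨h1, h2, h3⟩ := mem_bicone_normalBundle.2
        (show (x, z).1 ∈ general B X ∧ (x, z).2 ≠ 0 ∧ (x, z).2 ∈ normalSpace B X (x, z).1 from
          ⟨hxg, hz, hzn⟩)
      exact ⟨h1, h2, h3, hxD.2⟩
    by_cases hy0 : y = 0
    · subst hy0
      have hg : IsPoly (fun t : ℂ => (x, t • x)) :=
        (isPoly_const x).prodMk (isPoly_id.smul (isPoly_const x))
      have := mem_zcl_of_curve hg (S := bicone {p | p ∈ normalBundle B X ∧ p.1 ∈ D})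
        fun t ht => key _ (smul_ne_zero ht (ne_zero_of_mem_general hxg))
          (Submodule.smul_mem _ _ (self_mem_normalSpace x))
      simpa using this
    · exact subset_zcl _ (key y hy0 hy)

theorem zcl_bicone_normalBundle_univ :
    zcl (bicone (normalBundle B X)) = zcl (normalOver B X (general B X)) := by
  have := zcl_bicone_normalBundle (B := B) (X := X) Set.univ
  have h1 : {p | p ∈ normalBundle B X ∧ p.1 ∈ Set.univ} = normalBundle B X := by
    ext p; simp
  have h2 : pcone Set.univ ∩ general B X = general B X :=
    Set.inter_eq_right.2 fun x hx => ⟨hx.1, trivial⟩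
  rwa [h1, h2] at this

/-- At a set all of whose tangent spaces have dimension `n`, surjectivity of a linear map onto a
space of dimension `n` on the tangent spaces is locally given by one equation. -/
theorem exists_surjectivity_equation {E : Type v} [AddCommGroup E] [Module ℂ E]
    [FiniteDimensional ℂ E] {F : Type w} [AddCommGroup F] [Module ℂ F] [FiniteDimensional ℂ F]
    {N : Set E} {p₀ : E} (hp₀ : IsSmoothPt N p₀) (A : E →ₗ[ℂ] F) {n : ℕ}
    (hdim : ∀ p ∈ N, Module.finrank ℂ (tangentSpace N p) = n) (hF : Module.finrank ℂ F = n) :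
    ∃ d k : E → ℂ, IsPoly d ∧ IsPoly k ∧ k p₀ ≠ 0 ∧
      ∀ p ∈ N, k p ≠ 0 → (d p = 0 ↔ (tangentSpace N p).map A ≠ ⊤) := by
  let b := Module.finBasisOfFinrankEq ℂ (tangentSpace N p₀) (hdim p₀ hp₀.1)
  let e := Module.finBasisOfFinrankEq ℂ F hF
  have hfield := fun i => exists_tangent_field hp₀ (b i).2
  choose u hu hu0 huT using hfield
  obtain ⟨k, hk, hk0, hkl⟩ := exists_isPoly_linearIndependent hu (p₀ := p₀) (by
    simp only [hu0]
    exact linearIndependent_coe_basis b)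
  have hdet : IsPoly (fun p => (e.toMatrix (fun i => A (u i p))).det) :=
    isPoly_det fun i j => (isPoly_linear (e.coord i ∘ₗ A)).comp (hu j)
  refine ⟨fun p => (e.toMatrix (fun i => A (u i p))).det, k, hdet, hk, by rw [hk0]; exact one_ne_zero,
    fun p hp hne => ?_⟩
  have hli := hkl p hne
  have hspan := span_range_eq_of_card hli (fun i => huT i p hp) (by rw [hdim p hp, Fintype.card_fin])
  have hrange : Submodule.span ℂ (Set.range fun i => A (u i p)) = (tangentSpace N p).map A := by
    rw [← hspan, Submodule.map_span, ← Set.range_comp]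
    rfl
  have hiff : ((e.toMatrix (fun i => A (u i p))).det ≠ 0) ↔ (tangentSpace N p).map A = ⊤ := by
    rw [← Module.Basis.det_apply, ← isUnit_iff_ne_zero, ← Module.Basis.is_basis_iff_det, hrange]
    refine ⟨fun h => h.2, fun h => ⟨?_, h⟩⟩
    rw [← hrange] at h
    exact linearIndependent_of_top_le_span_of_card_eq_finrank h.ge
      ((Fintype.card_fin n).trans hF.symm)
  rw [← not_iff_not, ← ne_eq, hiff, not_not]

namespace IsSetting

/-- Polynomial sections through the two given points first yield a base point over which neither
polynomial vanishes identically; the fibre there is linear, hence irreducible. -/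
theorem irr_normalOver (H : IsSetting B X) {Q : Set (V' × ℂ)} (hQ : Irr Q)
    (hQg : Q ⊆ general B X) : Irr (normalOver B X Q) := by
  obtain ⟨x, hx⟩ := hQ.1
  refine ⟨⟨(x, x), hx, self_mem_normalSpace x⟩, ?_⟩
  rintro f g hf hg ⟨⟨x₁, y₁⟩, ⟨h1, h1'⟩, hf1⟩ ⟨⟨x₂, y₂⟩, ⟨h2, h2'⟩, hg2⟩
  obtain ⟨s, hs, hs0, hsn⟩ := H.exists_section (hQg h1) h1'
  obtain ⟨r, hr, hr0, hrn⟩ := H.exists_section (hQg h2) h2'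
  obtain ⟨x, hx, hfx, hgx⟩ := hQ.2 _ _ (hf.comp (isPoly_id.prodMk hs))
    (hg.comp (isPoly_id.prodMk hr)) ⟨x₁, h1, by rw [hs0]; exact hf1⟩ ⟨x₂, h2, by rw [hr0]; exact hg2⟩
  obtain ⟨y, hy, hfy, hgy⟩ := (irr_submodule (normalSpace B X x)).2 _ _
    (hf.comp ((isPoly_const x).prodMk isPoly_id)) (hg.comp ((isPoly_const x).prodMk isPoly_id))
    ⟨s x, hsn x (hQg hx), hfx⟩ ⟨r x, hrn x (hQg hx), hgx⟩
  exact ⟨(x, y), ⟨hx, hy⟩, hfy, hgy⟩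

/-- Tangent vectors to the normal bundle obtained from a section. -/
theorem exists_tangent_normalOver (H : IsSetting B X) {Q : Set (V' × ℂ)}
    (hQg : Q ⊆ general B X) {x : V' × ℂ} (hx : x ∈ Q) {a : ℂ} {w₀ : V'}
    (hw : w₀ ∈ normalDirections B X x) :
    ∃ L : V' × ℂ →ₗ[ℂ] V', ∀ v ∈ tangentSpace Q x, ∀ z ∈ normalSpace B X x,
      (v, a • v + (L v, 0) + z) ∈ tangentSpace (normalOver B X Q) (x, a • x + (w₀, 0)) := by
  obtain ⟨w, hwp, hw0, hwN⟩ := H.exists_normal_field (hQg hx) hw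
  have hs : IsPoly (fun x => (x, a • x + (w x, (0 : ℂ)))) :=
    isPoly_id.prodMk (((isPoly_const a).smul isPoly_id).add (hwp.prodMk (isPoly_const 0)))
  have hpd : HasPD (fun x => (x, a • x + (w x, (0 : ℂ)))) x
      (LinearMap.id.prod (a • LinearMap.id + (pd w x).prod 0)) :=
    hasPD_prodMk (hasPD_linear LinearMap.id x)
      ((hasPD_linear (a • LinearMap.id) x).add (hasPD_prodMk (hwp.hasPD x) (hasPD_const 0 x)))
  refine ⟨pd w x, fun v hv z hz => ?_⟩
  have h1 := pd_mem_tangentSpace (T := normalOver B X Q) hs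
    (fun q hq => ⟨hq, mem_normalSpace.2 ⟨a, w q, hwN q (hQg hq), rfl⟩⟩) hv
  rw [hpd.pd_eq, hw0] at h1
  have h2 : (0, z) ∈ tangentSpace (normalOver B X Q) (x, a • x + (w₀, 0)) :=
    mem_tangentSpace_of_line fun t => ⟨by simpa using hx, by
      simpa using Submodule.add_mem _ (mem_normalSpace.2 ⟨a, w₀, hw, rfl⟩)
        (Submodule.smul_mem _ t hz)⟩
  convert! Submodule.add_mem _ h1 h2 using 1
  simp

/-- Annihilator fields are polynomial equations of the bundle and persist on its closure, so over
general points the closure contains nothing new. -/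
theorem mem_normalSpace_of_annihilator (H : IsSetting B X) {Q : Set (V' × ℂ)}
    (hQg : Q ⊆ general B X) {x : V' × ℂ} (hx : x ∈ general B X) {y : V' × ℂ}
    (hxy : (x, y) ∈ zcl (normalOver B X Q)) : y ∈ normalSpace B X x := by
  rw [← Subspace.forall_mem_dualAnnihilator_apply_eq_zero_iff]
  intro l₀ hl
  obtain ⟨l, hlp, hl0, hlN⟩ := H.exists_annihilator hx
    fun y hy => (Submodule.mem_dualAnnihilator _).1 hl y hy
  rw [← hl0]
  exact hxy (fun p => l p.1 p.2) (isPoly_bilin LinearMap.id (hlp.comp isPoly_fst) isPoly_snd)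
    fun p hp => hlN p.1 (mem_cone_of_general (hQg hp.1)) p.2 hp.2

/-- Differentiating the annihilator equations along the fibre shows that vertical tangent vectors
belong to the fibre. -/
theorem snd_mem_normalSpace (H : IsSetting B X) {Q : Set (V' × ℂ)}
    (hQg : Q ⊆ general B X) {x y z : V' × ℂ} (hx : x ∈ general B X)
    (hz : (0, z) ∈ tangentSpace (normalOver B X Q) (x, y)) : z ∈ normalSpace B X x := by
  rw [← Subspace.forall_mem_dualAnnihilator_apply_eq_zero_iff]
  intro l₀ hl
  obtain ⟨l, hlp, hl0, hlN⟩ := H.exists_annihilator hx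
    fun y hy => (Submodule.mem_dualAnnihilator _).1 hl y hy
  have hpd : HasPD (fun p : (V' × ℂ) × (V' × ℂ) => l p.1 p.2) (x, y) _ :=
    hasPD_bilin LinearMap.id ((hlp.hasPD x).polyComp hlp (hasPD_linear (LinearMap.fst ℂ _ _) (x, y)))
      (hasPD_linear (LinearMap.snd ℂ _ _) (x, y))
  have := mem_tangentSpace.1 hz (fun p => l p.1 p.2)
    (isPoly_bilin LinearMap.id (hlp.comp isPoly_fst) isPoly_snd)
    fun p hp => hlN p.1 (mem_cone_of_general (hQg hp.1)) p.2 hp.2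
  rw [hpd.pd_eq] at this
  simpa [hl0] using this

/-- Rank and kernel of the first projection: sections lift every tangent vector of the base, and the
vertical vectors form the fibre. -/
theorem finrank_tangentSpace_normalOver (H : IsSetting B X) {Q : Set (V' × ℂ)}
    (hQg : Q ⊆ general B X) {p : (V' × ℂ) × (V' × ℂ)} (hp : p ∈ normalOver B X Q) :
    Module.finrank ℂ (tangentSpace (normalOver B X Q) p) =
      Module.finrank ℂ (tangentSpace Q p.1) + Module.finrank ℂ (normalSpace B X p.1) := by
  obtain ⟨x, y⟩ := p
  obtain ⟨hx, hy⟩ := hp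
  dsimp only at hx hy
  obtain ⟨a, w, hw, rfl⟩ := mem_normalSpace.1 hy
  obtain ⟨L, hL⟩ := H.exists_tangent_normalOver hQg hx (a := a) hw
  dsimp only
  set T := tangentSpace (normalOver B X Q) (x, a • x + (w, 0))
  have h1 : T.map (LinearMap.fst ℂ _ _) = tangentSpace Q x := by
    apply le_antisymm
    · rintro _ ⟨t, ht, rfl⟩
      exact map_mem_tangentSpace (LinearMap.fst ℂ (V' × ℂ) (V' × ℂ)) (fun q hq => hq.1) ht
    · intro v hv
      exact ⟨_, hL v hv 0 (Submodule.zero_mem _), rfl⟩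
  let f : T →ₗ[ℂ] V' × ℂ := (LinearMap.fst ℂ _ _).domRestrict T
  have h2 : LinearMap.range f = tangentSpace Q x := by
    rw [← h1, LinearMap.range_domRestrict]
  have h3 : (LinearMap.ker f).map T.subtype =
      (normalSpace B X x).map (LinearMap.inr ℂ (V' × ℂ) (V' × ℂ)) := by
    ext v
    constructor
    · rintro ⟨⟨⟨v1, v2⟩, hv⟩, hv', rfl⟩
      have hv1 : v1 = 0 := hv'
      subst hv1
      exact ⟨v2, H.snd_mem_normalSpace hQg (hQg hx) hv, rfl⟩
    · rintro ⟨z, hz, rfl⟩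
      have := hL 0 (Submodule.zero_mem _) z hz
      simp only [smul_zero, map_zero, zero_add, Prod.mk_zero_zero] at this
      exact ⟨⟨_, this⟩, rfl, rfl⟩
  have h4 := congrArg (fun W : Submodule ℂ ((V' × ℂ) × (V' × ℂ)) => Module.finrank ℂ W) h3
  beta_reduce at h4
  rw [← (Submodule.equivMapOfInjective _ T.injective_subtype _).finrank_eq,
    ← (Submodule.equivMapOfInjective _ LinearMap.inr_injective _).finrank_eq] at h4
  have h5 := LinearMap.finrank_range_add_finrank_ker f
  rw [h2] at h5
  omega

theorem gdim_normalOver (H : IsSetting B X) {Q : Set (V' × ℂ)} (hQ : Irr Q)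
    (hQg : Q ⊆ general B X) :
    gdim (normalOver B X Q) + gdim (cone X) = gdim Q + (Module.finrank ℂ V' + 2) := by
  obtain ⟨p, hp, h1, h2⟩ := ((gen_isSmoothPt (H.irr_normalOver hQ hQg).1).and
    (H.irr_normalOver hQ hQg) (Gen.of_image isPoly_fst (P := IsSmoothPt Q) (by
      have : Prod.fst '' normalOver B X Q = Q := by
        ext x
        exact ⟨by rintro ⟨p, hp, rfl⟩; exact hp.1, fun hx => ⟨(x, x), ⟨hx, self_mem_normalSpace x⟩, rfl⟩⟩
      rw [this]
      exact gen_isSmoothPt hQ.1))).exists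
  have h3 := H.finrank_tangentSpace_normalOver hQg hp
  have h4 := H.finrank_normalSpace (hQg hp.1)
  rw [(isSmoothPt_iff.1 h1).2, (isSmoothPt_iff.1 h2).2] at h3
  omega

/-- The normal bundle is smooth, of dimension `m + 2`. -/
theorem finrank_tangentSpace_normalBundle (H : IsSetting B X) {p : (V' × ℂ) × (V' × ℂ)}
    (hp : p ∈ normalOver B X (general B X)) :
    Module.finrank ℂ (tangentSpace (normalOver B X (general B X)) p) =
      Module.finrank ℂ V' + 2 := by
  have h1 := H.finrank_tangentSpace_normalOver subset_rfl hp
  have h2 := H.finrank_normalSpace hp.1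
  rw [tangentSpace_congr (H.zcl_general ⟨_, hp.1⟩),
    (isSmoothPt_iff.1 (mem_general.1 hp.1).1).2] at h1
  omega

theorem isSmoothPt_normalBundle (H : IsSetting B X) {p : (V' × ℂ) × (V' × ℂ)}
    (hp : p ∈ normalOver B X (general B X)) : IsSmoothPt (normalOver B X (general B X)) p :=
  ⟨hp, fun q hq => by
    rw [H.finrank_tangentSpace_normalBundle hp, H.finrank_tangentSpace_normalBundle hq]⟩

/-- The Euler vector of the first factor. It spans the direction that the second projection kills
for trivial reasons. -/
theorem fst_mem_tangentSpace_normalBundle {p : (V' × ℂ) × (V' × ℂ)}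
    (hp : p ∈ normalOver B X (general B X)) :
    (p.1, (0 : V' × ℂ)) ∈ tangentSpace (normalOver B X (general B X)) p := by
  obtain ⟨x, y⟩ := p
  have hg : IsPoly (fun t : ℂ => (x + t • x, y)) :=
    ((isPoly_const x).add (isPoly_id.smul (isPoly_const x))).prodMk (isPoly_const y)
  have := Gen.pd_mem_tangentSpace irr_univ hg (S := normalOver B X (general B X)) (p := 0) (v := 1) ⟨fun t => 1 + t,
    (isPoly_const 1).add isPoly_id, ⟨0, trivial, by simp⟩, fun t _ ht => subset_zcl _ (by
      have e1 : x + t • x = (1 + t) • x := by rw [add_smul, one_smul]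
      rw [e1]
      exact ⟨smul_mem_general hp.1 ht, by rw [normalSpace_smul B X ht]; exact hp.2⟩)⟩
      (by rw [tangentSpace_univ]; trivial)
  have hpd : HasPD (fun t : ℂ => (x + t • x, y)) 0 _ :=
    hasPD_prodMk ((hasPD_const x 0).add (hasPD_linear (LinearMap.toSpanSingleton ℂ _ x) 0))
      (hasPD_const y 0)
  rw [hpd.pd_eq] at this
  simpa using this

/-- The ramification condition is given, near a point of the normal bundle, by one equation. -/
theorem exists_ramification_equation (H : IsSetting B X) {p₀ : (V' × ℂ) × (V' × ℂ)}
    (hp₀ : p₀ ∈ normalOver B X (general B X)) :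
    ∃ d h : (V' × ℂ) × (V' × ℂ) → ℂ, IsPoly d ∧ IsPoly h ∧ h p₀ ≠ 0 ∧
      ∀ p ∈ normalOver B X (general B X), h p ≠ 0 → (d p = 0 ↔
        (tangentSpace (normalOver B X (general B X)) p).map (LinearMap.snd ℂ _ _) ≠ ⊤) := by
  obtain ⟨l, hl⟩ := Module.Projective.exists_dual_eq_one ℂ (ne_zero_of_mem_general hp₀.1)
  -- The tangent space has dimension `m + 2` but the target of the second projection has dimension
  -- `m + 1`. Adjoining a form nonzero on the Euler vector of the first factor makes the system
  -- square, so surjectivity becomes one determinant.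
  let A : (V' × ℂ) × (V' × ℂ) →ₗ[ℂ] (V' × ℂ) × ℂ :=
    (LinearMap.snd ℂ _ _).prod (l ∘ₗ LinearMap.fst ℂ _ _)
  obtain ⟨d, k, hd, hk, hk0, hdk⟩ := exists_surjectivity_equation
    (H.isSmoothPt_normalBundle hp₀) A (n := Module.finrank ℂ V' + 2)
    (fun p hp => H.finrank_tangentSpace_normalBundle hp) (by simp)
  refine ⟨d, fun p => k p * l p.1, hd, isPoly_mul hk ((isPoly_linear l).comp isPoly_fst), ?_,
    fun p hp hne => ?_⟩
  · simpa only [hl, mul_one] using hk0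
  have hlp := right_ne_zero_of_mul hne
  have hself := fst_mem_tangentSpace_normalBundle hp
  rw [hdk p hp (left_ne_zero_of_mul hne), not_iff_not]
  have hsnd : (LinearMap.fst ℂ (V' × ℂ) ℂ) ∘ₗ A = LinearMap.snd ℂ _ _ := rfl
  constructor
  · intro h
    rw [← hsnd, Submodule.map_comp, h, Submodule.map_top, LinearMap.range_eq_top]
    exact Prod.fst_surjective
  · intro h
    rw [eq_top_iff]
    rintro ⟨y, c⟩ -
    obtain ⟨t, ht, hty⟩ := h.ge (Submodule.mem_top (x := y))
    refine ⟨t + ((c - l t.1) * (l p.1)⁻¹) • (p.1, 0),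
      Submodule.add_mem _ ht (Submodule.smul_mem _ _ hself), ?_⟩
    simp only [LinearMap.snd_apply] at hty
    simp [A, hty, hlp]

end IsSetting

end NormalOver

/-! ### Components at infinity and focal pairs. -/

section Infinity

variable {E : Type u} [AddCommGroup E] [Module ℂ E] [FiniteDimensional ℂ E]
  {F : Type v} [AddCommGroup F] [Module ℂ F] [FiniteDimensional ℂ F]

theorem zcl_image_congr {S T : Set E} {g : E → F} (hg : IsPoly g) (h : zcl S = zcl T) :
    zcl (g '' S) = zcl (g '' T) := by
  have key : ∀ {S T : Set E}, zcl S = zcl T → zcl (g '' S) ⊆ zcl (g '' T) := by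
    intro S T h
    refine zcl_subset_zcl ?_
    rintro _ ⟨p, hp, rfl⟩
    exact mem_zcl_of_map hg (fun q hq => subset_zcl _ (Set.mem_image_of_mem g hq))
      (h ▸ subset_zcl S hp)
  exact (key h).antisymm (key h.symm)

theorem zcl_image_inl_iff {S T : Set E} : zcl ((fun x => (x, (0 : ℂ))) '' S) =
    zcl ((fun x => (x, (0 : ℂ))) '' T) ↔ zcl S = zcl T := by
  refine ⟨fun h => ?_, zcl_image_congr (isPoly_id.prodMk (isPoly_const 0))⟩
  have := zcl_image_congr isPoly_fst h
  simpa only [Set.image_image, Set.image_id'] using this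

theorem eq_of_zcl_pcone_eq {S T : Set (ℙ ℂ E)} (hS : IsClosed[zariskiProj E] S)
    (hT : IsClosed[zariskiProj E] T) (h : zcl (pcone S) = zcl (pcone T)) : S = T := by
  rw [isClosed_zariskiProj_iff] at hS hT
  refine Set.Subset.antisymm (pcone_subset_pcone.1 fun v hv => ?_)
    (pcone_subset_pcone.1 fun v hv => ?_)
  · exact hT v (h ▸ subset_zcl _ hv) hv.1
  · exact hS v (h ▸ subset_zcl _ hv) hv.1

theorem tangentSpace_image_inl (S : Set E) (x : E) :
    tangentSpace ((fun x => (x, (0 : ℂ))) '' S) (x, 0) =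
      (tangentSpace S x).map (LinearMap.inl ℂ E ℂ) := by
  ext v
  constructor
  · intro hv
    have h1 := mem_tangentSpace.1 hv (fun p => p.2) isPoly_snd (by rintro _ ⟨q, -, rfl⟩; rfl)
    have h2 := map_mem_tangentSpace (LinearMap.fst ℂ E ℂ) (T := S)
      (by rintro _ ⟨q, hq, rfl⟩; exact hq) hv
    have h3 : pd (fun p : E × ℂ => p.2) (x, 0) = LinearMap.snd ℂ E ℂ := pd_linear (LinearMap.snd ℂ E ℂ) _
    rw [h3] at h1
    exact ⟨v.1, h2, Prod.ext rfl (Eq.symm h1)⟩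
  · rintro ⟨v, hv, rfl⟩
    exact map_mem_tangentSpace (LinearMap.inl ℂ E ℂ) (fun q hq => Set.mem_image_of_mem _ hq) hv

theorem gdim_image_inl (S : Set E) : gdim ((fun x => (x, (0 : ℂ))) '' S) = gdim S := by
  have e : ∀ x, Module.finrank ℂ (tangentSpace ((fun x => (x, (0 : ℂ))) '' S) (x, 0)) =
      Module.finrank ℂ (tangentSpace S x) := fun x => by
    rw [tangentSpace_image_inl, ← (Submodule.equivMapOfInjective _ LinearMap.inl_injective _).finrank_eq]
  rw [gdim, gdim]
  congr 1
  ext n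
  simp only [Set.mem_ofPred_eq, Set.exists_mem_image, e]

variable {V' : Type u} [AddCommGroup V'] [Module ℂ V'] [FiniteDimensional ℂ V']
  {B : LinearMap.BilinForm ℂ V'} {X : Set (ℙ ℂ (V' × ℂ))} {D : Set (ℙ ℂ V')}

theorem pcone_image_atInfinity (D : Set (ℙ ℂ V')) :
    pcone (atInfinity V' '' D) = (fun x => (x, (0 : ℂ))) '' pcone D := by
  ext v
  constructor
  · rintro ⟨hv, p, hp, h⟩
    obtain ⟨x, hx, rfl⟩ : ∃ x, ∃ hx : x ≠ 0, p = Projectivization.mk ℂ x hx :=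
      ⟨p.rep, p.rep_nonzero, p.mk_rep.symm⟩
    have h' : Projectivization.mk ℂ (LinearMap.inl ℂ V' ℂ x)
        ((map_ne_zero_iff _ LinearMap.inl_injective).2 hx) = Projectivization.mk ℂ v hv := h
    rw [Projectivization.mk_eq_mk_iff'] at h'
    obtain ⟨a, ha⟩ := h'
    have ha0 : a ≠ 0 := by
      rintro rfl
      rw [zero_smul] at ha
      exact hx (LinearMap.inl_injective (ha.symm.trans (map_zero _).symm))
    refine ⟨a⁻¹ • x, mem_pcone_smul ⟨hx, hp⟩ (inv_ne_zero ha0), ?_⟩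
    have : v = a⁻¹ • LinearMap.inl ℂ V' ℂ x := by rw [← ha, smul_smul, inv_mul_cancel₀ ha0, one_smul]
    rw [this]
    ext <;> simp
  · rintro ⟨x, ⟨hx, hxD⟩, rfl⟩
    exact ⟨fun h => hx (congrArg Prod.fst h), _, hxD, rfl⟩

theorem isClosed_image_atInfinity {S : Set (ℙ ℂ V')} :
    IsClosed[zariskiProj (V' × ℂ)] (atInfinity V' '' S) ↔ IsClosed[zariskiProj V'] S := by
  rw [isClosed_zariskiProj_iff, isClosed_zariskiProj_iff, pcone_image_atInfinity]
  constructor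
  · intro h v hv hv0
    obtain ⟨x, hx, hxv⟩ := h (v, 0) (mem_zcl_of_map (isPoly_id.prodMk (isPoly_const 0))
      (fun q hq => subset_zcl _ (Set.mem_image_of_mem (fun x => (x, (0 : ℂ))) hq)) hv)
      (fun h => hv0 (congrArg Prod.fst h))
    have e : x = v := congrArg Prod.fst hxv
    exact e ▸ hx
  · intro h v hv hv0
    have h1 : v.1 ∈ zcl (pcone S) := mem_zcl_of_map isPoly_fst
      (by rintro _ ⟨q, hq, rfl⟩; exact subset_zcl _ hq) hv
    have h2 : v.2 = 0 := hv _ isPoly_snd (by rintro _ ⟨q, hq, rfl⟩; rfl)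
    exact ⟨v.1, h v.1 h1 fun h => hv0 (Prod.ext h h2), Prod.ext rfl h2.symm⟩

theorem isClosed_range_atInfinity : IsClosed[zariskiProj (V' × ℂ)] (Set.range (atInfinity V')) := by
  rw [← Set.image_univ, isClosed_image_atInfinity, isClosed_zariskiProj_iff]
  exact fun v _ hv => ⟨hv, trivial⟩

theorem mem_pcone_inter_range {v : V' × ℂ} :
    v ∈ pcone (X ∩ Set.range (atInfinity V')) ↔ v ∈ pcone X ∧ v.2 = 0 := by
  constructor
  · rintro ⟨h, h1, h2⟩
    refine ⟨⟨h, h1⟩, ?_⟩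
    have : v ∈ pcone (atInfinity V' '' Set.univ) := ⟨h, by rwa [Set.image_univ]⟩
    rw [pcone_image_atInfinity] at this
    obtain ⟨x, -, rfl⟩ := this
    rfl
  · rintro ⟨⟨h, h1⟩, h2⟩
    refine ⟨h, h1, ?_⟩
    have : v ∈ pcone (atInfinity V' '' Set.univ) := by
      rw [pcone_image_atInfinity]
      exact ⟨v.1, ⟨fun h0 => h (Prod.ext h0 h2), trivial⟩, Prod.ext rfl h2.symm⟩
    rw [Set.image_univ] at this
    exact this.2

namespace IsSetting

theorem isClosed_infinity (H : IsSetting B X) :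
    IsClosed[zariskiProj (V' × ℂ)] (X ∩ Set.range (atInfinity V')) :=
  @IsClosed.inter _ _ _ (zariskiProj (V' × ℂ)) H.closed isClosed_range_atInfinity

theorem isClosed_component (H : IsSetting B X) (hD : IsComponentAtInfinity X D) :
    IsClosed[zariskiProj V'] D := by
  rw [← isClosed_image_atInfinity]
  refine component_isClosed (q := projMk (V' × ℂ)) (A := X ∩ Set.range (atInfinity V')) ?_
  have := @IsClosed.closure_eq _ (zariskiProj (V' × ℂ)) _ H.isClosed_infinity
  rw [qtop_projMk, this]
  exact hD

theorem irr_component (hD : IsComponentAtInfinity X D) : Irr (pcone D) := by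
  have := (isIrreducible_zariskiProj_iff.1 hD.1.1).image isPoly_fst
  rw [pcone_image_atInfinity, Set.image_image, Set.image_id'] at this
  exact this

theorem component_subset (hD : IsComponentAtInfinity X D) {x : V'} (hx : x ∈ pcone D) :
    (x, (0 : ℂ)) ∈ pcone X := by
  have : (x, (0 : ℂ)) ∈ pcone (atInfinity V' '' D) := by
    rw [pcone_image_atInfinity]
    exact ⟨x, hx, rfl⟩
  exact ⟨this.1, (hD.1.2 this.2).1⟩

/-- At a general point of a component at infinity, its cone has the tangent space
`tangentDirections`. -/
theorem tangentSpace_component (H : IsSetting B X) (hD : IsComponentAtInfinity X D) {x : V'}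
    (hx : x ∈ pcone D) (hxg : (x, (0 : ℂ)) ∈ general B X) :
    tangentSpace (pcone D) x = tangentDirections X (x, 0) := by
  have hmem : ∀ z ∈ pcone D, (z, (0 : ℂ)) ∈ cone X := fun z hz =>
    pcone_subset_cone X (component_subset hD hz)
  apply le_antisymm
  · intro v hv
    exact map_mem_tangentSpace (LinearMap.inl ℂ V' ℂ) hmem hv
  · intro u₀ hu₀
    obtain ⟨u, hu, hu0, huD⟩ := exists_direction_field hxg hu₀
    have hpd : ∀ p : V' × ℂ, pd (fun p : V' × ℂ => p.2) p = LinearMap.snd ℂ V' ℂ :=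
      pd_linear (LinearMap.snd ℂ V' ℂ)
    -- The field has last coordinate zero, so it is tangent both to the cone over `X` and to the
    -- level sets of that coordinate.
    have key := field_tangent_component (W := cone X) (Z := (fun x => (x, (0 : ℂ))) '' pcone D)
      (t := fun p => p.2) (a := fun p => (u p, 0)) (p := (x, 0))
      ((irr_component hD).image (isPoly_id.prodMk (isPoly_const 0)))
      (by rintro _ ⟨z, hz, rfl⟩; exact subset_zcl _ (hmem z hz)) isPoly_snd
      (by rintro _ ⟨z, hz, rfl⟩; rfl) ?_ (hu.prodMk (isPoly_const 0)) huD
      (fun p _ => by rw [hpd]; rfl) ⟨x, hx, rfl⟩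
    · beta_reduce at key
      rw [hu0, tangentSpace_image_inl] at key
      obtain ⟨v, hv, h⟩ := key
      have e : v = u₀ := congrArg Prod.fst h
      exact e ▸ hv
    -- Away from the vertex, `T` lies in the punctured cone over `X_∞`; maximality of the component
    -- puts it in the cone over `D`, and the vertex is restored by closure.
    · intro T hT hTC hT0 hDT
      have hTgen : Gen T (fun p => p ≠ 0) := by
        obtain ⟨l, hl⟩ := Module.Projective.exists_dual_eq_one ℂ (ne_zero_of_mem_general hxg)
        refine ⟨l, isPoly_linear l, ⟨(x, 0), hDT ⟨x, hx, rfl⟩, by rw [hl]; exact one_ne_zero⟩, ?_⟩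
        rintro p - hp rfl
        exact hp (map_zero l)
      have h1 := IsComponent.subset_qlift (isTorusQuotient_projMk (V' × ℂ)) H.isClosed_infinity hD
        (hT.of_gen hTgen) (fun v hv => hv.2) (fun v hv => mem_pcone_inter_range.2
          ⟨(mem_cone_iff.1 (H.zcl_cone_subset (hTC hv.1))).resolve_left hv.2, hT0 v hv.1⟩) ?_
      · have h2 : {p | p ∈ T ∧ p ≠ 0} ⊆ (fun x => (x, (0 : ℂ))) '' pcone D := by
          rw [← pcone_image_atInfinity]; exact h1
        refine (subset_zcl T).trans ?_
        rw [← Gen.zcl_eq hT hTgen]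
        exact zcl_mono h2
      · rw [Gen.zcl_eq hT hTgen]
        change pcone _ ⊆ _
        rw [pcone_image_atInfinity]
        exact hDT.trans (subset_zcl T)

end IsSetting

/-- The general points of the cone over a subvariety at infinity. -/
def generalAtInfinity (B : LinearMap.BilinForm ℂ V') (X : Set (ℙ ℂ (V' × ℂ))) (D : Set (ℙ ℂ V')) :
    Set V' := {x | x ∈ pcone D ∧ (x, (0 : ℂ)) ∈ general B X}

theorem image_generalAtInfinity : (fun x => (x, (0 : ℂ))) '' generalAtInfinity B X D =
    pcone (atInfinity V' '' D) ∩ general B X := by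
  rw [pcone_image_atInfinity]
  ext v
  constructor
  · rintro ⟨x, hx, rfl⟩
    exact ⟨⟨x, hx.1, rfl⟩, hx.2⟩
  · rintro ⟨⟨x, hx, rfl⟩, h⟩
    exact ⟨x, ⟨hx, h⟩, rfl⟩

/-- The pairs `(x, O)` with `x` a general point of the cone over `D` and `O - x` normal at `x`. -/
def focalPairs (B : LinearMap.BilinForm ℂ V') (X : Set (ℙ ℂ (V' × ℂ))) (D : Set (ℙ ℂ V')) :
    Set (V' × V') :=
  {p | p.1 ∈ generalAtInfinity B X D ∧ p.2 - p.1 ∈ normalDirections B X (p.1, 0)}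

theorem smul_mem_generalAtInfinity {x : V'} (hx : x ∈ generalAtInfinity B X D) {c : ℂ}
    (hc : c ≠ 0) : c • x ∈ generalAtInfinity B X D :=
  ⟨mem_pcone_smul hx.1 hc, by simpa using smul_mem_general hx.2 hc⟩

theorem normalDirections_smul_inl (x : V') {c : ℂ} (hc : c ≠ 0) :
    normalDirections B X (c • x, 0) = normalDirections B X (x, 0) := by
  simpa using normalDirections_smul B X hc (x, 0)

theorem smul_mem_focalPairs {p : V' × V'} (hp : p ∈ focalPairs B X D) {c : ℂ}
    (hc : c ≠ 0) : c • p ∈ focalPairs B X D :=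
  ⟨smul_mem_generalAtInfinity hp.1 hc, by
    have := Submodule.smul_mem _ c hp.2
    simp only [Prod.smul_fst, Prod.smul_snd, normalDirections_smul_inl _ hc]
    rwa [← smul_sub]⟩

theorem diag_mem_focalPairs {x : V'} (hx : x ∈ generalAtInfinity B X D) :
    (x, x) ∈ focalPairs B X D := ⟨hx, by simp⟩

/-- A vector `a • x + w` with `a ≠ 0` is the second member of the focal pair based at `a • x`; the
vectors with `a = 0` are limits of these. -/
theorem zcl_snd_normalOver : zcl (Prod.snd '' normalOver B X
      ((fun x => (x, (0 : ℂ))) '' generalAtInfinity B X D)) =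
    zcl ((fun x => (x, (0 : ℂ))) '' (Prod.snd '' focalPairs B X D)) := by
  apply Set.Subset.antisymm
  · refine zcl_subset_zcl ?_
    rintro _ ⟨⟨_, y⟩, ⟨⟨x, hx, rfl⟩, hy⟩, rfl⟩
    dsimp only at hy ⊢
    obtain ⟨a, w, hw, rfl⟩ := mem_normalSpace.1 hy
    have key : ∀ c : ℂ, c ≠ 0 → c • (x, (0 : ℂ)) + (w, (0 : ℂ)) ∈
        (fun x => (x, (0 : ℂ))) '' (Prod.snd '' focalPairs B X D) := fun c hc =>
      ⟨c • x + w, ⟨(c • x, c • x + w), ⟨smul_mem_generalAtInfinity hx hc, by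
        simpa only [add_sub_cancel_left, normalDirections_smul_inl x hc] using hw⟩, rfl⟩, by simp⟩
    by_cases ha : a = 0
    · subst ha
      exact mem_zcl_of_curve (g := fun c : ℂ => c • (x, (0 : ℂ)) + (w, (0 : ℂ)))
        ((isPoly_id.smul (isPoly_const _)).add (isPoly_const _)) key
    · exact subset_zcl _ (key a ha)
  · refine zcl_mono ?_
    rintro _ ⟨_, ⟨⟨x, O⟩, ⟨hx, hO⟩, rfl⟩, rfl⟩
    exact ⟨((x, 0), (O, 0)), ⟨⟨x, hx, rfl⟩, mem_normalSpace.2 ⟨1, O - x, hO, by simp⟩⟩, rfl⟩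

theorem zcl_bicone_normalRestriction : zcl (bicone (normalRestriction B X (atInfinity V' '' D))) =
    zcl (normalOver B X ((fun x => (x, (0 : ℂ))) '' generalAtInfinity B X D)) := by
  rw [normalRestriction, zcl_bicone_closure, zcl_bicone_normalBundle, image_generalAtInfinity]

theorem focalImage_normalRestriction_eq_iff {S : Set (ℙ ℂ V')} (hS : IsClosed[zariskiProj V'] S) :
    focalImage (normalRestriction B X (atInfinity V' '' D)) = atInfinity V' '' S ↔
      zcl (Prod.snd '' focalPairs B X D) = zcl (pcone S) := by
  have h : zcl (pcone (focalImage (normalRestriction B X (atInfinity V' '' D)))) =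
      zcl ((fun x => (x, (0 : ℂ))) '' (Prod.snd '' focalPairs B X D)) := by
    rw [focalImage, zcl_pcone_closure, pcone_image_snd,
      zcl_image_congr isPoly_snd zcl_bicone_normalRestriction, zcl_snd_normalOver]
  constructor
  · intro e
    rw [e, pcone_image_atInfinity, zcl_image_inl_iff] at h
    exact h.symm
  · intro e
    refine eq_of_zcl_pcone_eq (@isClosed_closure _ (zariskiProj (V' × ℂ)) _)
      (isClosed_image_atInfinity.2 hS) ?_
    rw [h, pcone_image_atInfinity, zcl_image_inl_iff, e]

namespace IsSetting

theorem gen_generalAtInfinity (hD : IsComponentAtInfinity X D)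
    (hne : (generalAtInfinity B X D).Nonempty) :
    Gen (pcone D) (fun x => (x, (0 : ℂ)) ∈ general B X) := by
  obtain ⟨x, hx, hxg⟩ := hne
  obtain ⟨h, hh, h0, hg⟩ := exists_general_nhd hxg
  exact ⟨fun x => h (x, 0), hh.comp (isPoly_id.prodMk (isPoly_const 0)), ⟨x, hx, h0⟩,
    fun p hp hne => hg _ (pcone_subset_cone X (component_subset hD hp)) hne⟩

theorem zcl_generalAtInfinity (hD : IsComponentAtInfinity X D)
    (hne : (generalAtInfinity B X D).Nonempty) :
    zcl (generalAtInfinity B X D) = zcl (pcone D) :=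
  Gen.zcl_eq (irr_component hD) (gen_generalAtInfinity hD hne)

theorem irr_generalAtInfinity (hD : IsComponentAtInfinity X D)
    (hne : (generalAtInfinity B X D).Nonempty) : Irr (generalAtInfinity B X D) :=
  (irr_component hD).of_gen (gen_generalAtInfinity hD hne)

theorem tangentSpace_generalAtInfinity (H : IsSetting B X) (hD : IsComponentAtInfinity X D) {x : V'}
    (hx : x ∈ generalAtInfinity B X D) :
    tangentSpace (generalAtInfinity B X D) x = tangentDirections X (x, 0) := by
  rw [tangentSpace_congr (zcl_generalAtInfinity hD ⟨x, hx⟩), H.tangentSpace_component hD hx.1 hx.2]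

theorem gdim_generalAtInfinity (H : IsSetting B X) (hD : IsComponentAtInfinity X D)
    (hne : (generalAtInfinity B X D).Nonempty) :
    gdim (generalAtInfinity B X D) + 1 = gdim (cone X) := by
  obtain ⟨x, hx⟩ := exists_isSmoothPt hne
  rw [← (isSmoothPt_iff.1 hx).2, H.tangentSpace_generalAtInfinity hD hx.1,
    finrank_tangentDirections hx.1.2]

theorem image_generalAtInfinity_subset :
    (fun x => (x, (0 : ℂ))) '' generalAtInfinity B X D ⊆ general B X := by
  rintro _ ⟨x, hx, rfl⟩
  exact hx.2

theorem irr_normalOver_infinity (H : IsSetting B X) (hD : IsComponentAtInfinity X D)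
    (hne : (generalAtInfinity B X D).Nonempty) :
    Irr (normalOver B X ((fun x => (x, (0 : ℂ))) '' generalAtInfinity B X D)) :=
  H.irr_normalOver ((irr_generalAtInfinity hD hne).image (isPoly_id.prodMk (isPoly_const 0)))
    image_generalAtInfinity_subset

/-- Transversality lowers the dimension of the base by exactly one, so the restriction has
codimension one in the normal bundle. -/
theorem gdim_normalOver_infinity (H : IsSetting B X) (hD : IsComponentAtInfinity X D)
    (hne : (generalAtInfinity B X D).Nonempty) :
    gdim (normalOver B X ((fun x => (x, (0 : ℂ))) '' generalAtInfinity B X D)) =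
      Module.finrank ℂ V' + 1 := by
  have h1 := H.gdim_normalOver ((irr_generalAtInfinity hD hne).image
    (isPoly_id.prodMk (isPoly_const 0))) image_generalAtInfinity_subset
  have h2 := H.gdim_generalAtInfinity hD hne
  rw [gdim_image_inl] at h1
  omega

theorem baseImage_normalRestriction (H : IsSetting B X) (hD : IsComponentAtInfinity X D)
    (hne : (generalAtInfinity B X D).Nonempty) :
    baseImage (normalRestriction B X (atInfinity V' '' D)) = atInfinity V' '' D := by
  refine eq_of_zcl_pcone_eq (@isClosed_closure _ (zariskiProj (V' × ℂ)) _)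
    (isClosed_image_atInfinity.2 (H.isClosed_component hD)) ?_
  rw [baseImage, zcl_pcone_closure, pcone_image_fst,
    zcl_image_congr isPoly_fst zcl_bicone_normalRestriction, pcone_image_atInfinity]
  have : Prod.fst '' normalOver B X ((fun x => (x, (0 : ℂ))) '' generalAtInfinity B X D) =
      (fun x => (x, (0 : ℂ))) '' generalAtInfinity B X D := by
    ext x
    exact ⟨by rintro ⟨p, hp, rfl⟩; exact hp.1, fun hx => ⟨(x, x), ⟨hx, self_mem_normalSpace x⟩, rfl⟩⟩
  rw [this, zcl_image_inl_iff, zcl_generalAtInfinity hD hne]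

/-- The argument for the normal bundle again, with affine fibres `x` plus the normal directions. -/
theorem irr_focalPairs (H : IsSetting B X) (hD : IsComponentAtInfinity X D)
    (hne : (generalAtInfinity B X D).Nonempty) : Irr (focalPairs B X D) := by
  have hQ := irr_generalAtInfinity hD hne
  obtain ⟨x, hx⟩ := hne
  refine ⟨⟨_, diag_mem_focalPairs hx⟩, ?_⟩
  have key : ∀ {f : V' × V' → ℂ}, IsPoly f → (∃ p ∈ focalPairs B X D, f p ≠ 0) →
      ∃ s : V' → V', IsPoly s ∧ (∀ x ∈ generalAtInfinity B X D, (x, s x) ∈ focalPairs B X D) ∧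
        ∃ x ∈ generalAtInfinity B X D, f (x, s x) ≠ 0 := by
    rintro f hf ⟨⟨x, O⟩, ⟨h1, h2⟩, hne⟩
    obtain ⟨w, hw, hw0, hwN⟩ := H.exists_normal_field h1.2 h2
    refine ⟨fun x => x + w (x, 0), isPoly_id.add (hw.comp (isPoly_id.prodMk (isPoly_const 0))),
      fun x hx => ⟨hx, by simpa using hwN _ hx.2⟩, x, h1, ?_⟩
    beta_reduce
    rw [hw0]
    simpa using hne
  intro f g hf hg hf' hg'
  obtain ⟨s, hs, hsP, hsf⟩ := key hf hf'
  obtain ⟨r, hr, hrP, hrg⟩ := key hg hg'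
  obtain ⟨x, hx, hfx, hgx⟩ := hQ.2 _ _ (hf.comp (isPoly_id.prodMk hs))
    (hg.comp (isPoly_id.prodMk hr)) hsf hrg
  have hfib : Irr {O : V' | (x, O) ∈ focalPairs B X D} := by
    refine irr_of_lines ⟨_, hsP x hx⟩ fun p hp q hq t => ⟨hx, ?_⟩
    have := Submodule.add_mem _ hp.2 (Submodule.smul_mem _ t (Submodule.sub_mem _ hq.2 hp.2))
    convert! this using 1
    simp only [sub_sub_sub_cancel_right]
    abel
  obtain ⟨y, hy, hfy, hgy⟩ := hfib.2 _ _
    (hf.comp ((isPoly_const x).prodMk isPoly_id)) (hg.comp ((isPoly_const x).prodMk isPoly_id))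
    ⟨s x, hsP x hx, hfx⟩ ⟨r x, hrP x hx, hgx⟩
  exact ⟨(x, y), hy, hfy, hgy⟩

theorem exists_tangent_focalPairs (H : IsSetting B X) {p : V' × V'} (hp : p ∈ focalPairs B X D) :
    ∃ L : V' →ₗ[ℂ] V', ∀ v ∈ tangentSpace (generalAtInfinity B X D) p.1,
      ∀ z ∈ normalDirections B X (p.1, 0), (v, v + L v + z) ∈ tangentSpace (focalPairs B X D) p := by
  obtain ⟨x, O⟩ := p
  obtain ⟨hx, hO⟩ := hp
  dsimp only at hx hO ⊢
  obtain ⟨w, hw, hw0, hwN⟩ := H.exists_normal_field hx.2 hO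
  have hwp : IsPoly (fun x : V' => w (x, 0)) := hw.comp (isPoly_id.prodMk (isPoly_const 0))
  have hs : IsPoly (fun x : V' => (x, x + w (x, 0))) := isPoly_id.prodMk (isPoly_id.add hwp)
  have hpd : HasPD (fun x : V' => (x, x + w (x, 0))) x _ :=
    hasPD_prodMk (hasPD_linear LinearMap.id x) ((hasPD_linear LinearMap.id x).add (hwp.hasPD x))
  refine ⟨pd (fun x : V' => w (x, 0)) x, fun v hv z hz => ?_⟩
  have h1 := pd_mem_tangentSpace (T := focalPairs B X D) hs
    (fun q hq => ⟨hq, by simpa using hwN _ hq.2⟩) hv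
  rw [hpd.pd_eq, hw0, add_sub_cancel] at h1
  have h2 : (0, z) ∈ tangentSpace (focalPairs B X D) (x, O) :=
    mem_tangentSpace_of_line fun t => ⟨by simpa using hx, by
      have := Submodule.add_mem _ hO (Submodule.smul_mem _ t hz)
      simp only [Prod.smul_mk, smul_zero, Prod.mk_add_mk, add_zero]
      convert! this using 1
      abel⟩
  convert! Submodule.add_mem _ h1 h2 using 1
  simp

theorem snd_mem_normalDirections {p : V' × V'} (hp : p ∈ focalPairs B X D)
    {z : V'} (hz : (0, z) ∈ tangentSpace (focalPairs B X D) p) :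
    z ∈ normalDirections B X (p.1, 0) := by
  rw [mem_normalDirections]
  intro u₀ hu₀
  obtain ⟨u, hu, hu0, huD⟩ := exists_direction_field hp.1.2 hu₀
  have hup : IsPoly (fun q : V' × V' => u (q.1, 0)) := hu.comp (isPoly_fst.prodMk (isPoly_const 0))
  have hup' : IsPoly (fun x : V' => u (x, 0)) := hu.comp (isPoly_id.prodMk (isPoly_const 0))
  have hpd : HasPD (fun q : V' × V' => B (u (q.1, 0)) (q.2 - q.1)) p _ :=
    hasPD_bilin B (HasPD.polyComp (g := fun x => u (x, 0)) hup' (hup'.hasPD p.1) (hasPD_linear (LinearMap.fst ℂ V' V') p))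
      (hasPD_linear (LinearMap.snd ℂ V' V' - LinearMap.fst ℂ V' V') p)
  have := mem_tangentSpace.1 hz _ (isPoly_bilin B hup (isPoly_snd.sub isPoly_fst)) fun q hq =>
    mem_normalDirections.1 hq.2 _ (huD _ (mem_cone_of_general hq.1.2))
  rw [hpd.pd_eq] at this
  simpa [hu0] using this

/-- The base contributes the tangent directions and the fibre their orthogonal space, whose
dimensions add up to that of `V'` whatever the dimension of `D`. -/
theorem finrank_tangentSpace_focalPairs (H : IsSetting B X) (hD : IsComponentAtInfinity X D)
    {p : V' × V'} (hp : p ∈ focalPairs B X D) :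
    Module.finrank ℂ (tangentSpace (focalPairs B X D) p) = Module.finrank ℂ V' := by
  obtain ⟨L, hL⟩ := H.exists_tangent_focalPairs hp
  obtain ⟨x, O⟩ := p
  have hx : x ∈ generalAtInfinity B X D := hp.1
  dsimp only at hL
  set T := tangentSpace (focalPairs B X D) (x, O)
  have h2 : LinearMap.range ((LinearMap.fst ℂ V' V').domRestrict T) =
      tangentSpace (generalAtInfinity B X D) x := by
    rw [LinearMap.range_domRestrict]
    apply le_antisymm
    · rintro _ ⟨t, ht, rfl⟩
      exact map_mem_tangentSpace (LinearMap.fst ℂ V' V') (fun q hq => hq.1) ht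
    · intro v hv
      exact ⟨_, hL v hv 0 (Submodule.zero_mem _), rfl⟩
  have h3 : (LinearMap.ker ((LinearMap.fst ℂ V' V').domRestrict T)).map T.subtype =
      (normalDirections B X (x, 0)).map (LinearMap.inr ℂ V' V') := by
    ext v
    constructor
    · rintro ⟨⟨⟨v1, v2⟩, hv⟩, hv', rfl⟩
      have hv1 : v1 = 0 := hv'
      subst hv1
      exact ⟨v2, snd_mem_normalDirections hp hv, rfl⟩
    · rintro ⟨z, hz, rfl⟩
      have := hL 0 (Submodule.zero_mem _) z hz
      simp only [smul_zero, map_zero, zero_add, Prod.mk_zero_zero] at this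
      exact ⟨⟨_, this⟩, rfl, rfl⟩
  have h4 := congrArg (fun W : Submodule ℂ (V' × V') => Module.finrank ℂ W) h3
  beta_reduce at h4
  rw [← (Submodule.equivMapOfInjective _ T.injective_subtype _).finrank_eq,
    ← (Submodule.equivMapOfInjective _ LinearMap.inr_injective _).finrank_eq] at h4
  have h5 := LinearMap.finrank_range_add_finrank_ker ((LinearMap.fst ℂ V' V').domRestrict T)
  rw [h2, H.tangentSpace_generalAtInfinity hD hx] at h5
  have h6 := finrank_tangentDirections hx.2
  have h7 := H.finrank_normalDirections hx.2
  omega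

theorem gdim_focalPairs (H : IsSetting B X) (hD : IsComponentAtInfinity X D)
    (hne : (generalAtInfinity B X D).Nonempty) :
    gdim (focalPairs B X D) = Module.finrank ℂ V' := by
  obtain ⟨p, hp⟩ := exists_isSmoothPt (H.irr_focalPairs hD hne).1
  rw [← (isSmoothPt_iff.1 hp).2, H.finrank_tangentSpace_focalPairs hD hp.1]

end IsSetting

end Infinity

/-! ### The isotropic fibres over the graph of a function of weight two. -/

section IsotropicFibre

variable {V' : Type u} [AddCommGroup V'] [Module ℂ V'] [FiniteDimensional ℂ V']
  {B : LinearMap.BilinForm ℂ V'} {R : Set (V' × ℂ)}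

/-- The action of scalars on `V' × ℂ` for which the second component has weight two. -/
def twist (V' : Type u) [AddCommGroup V'] [Module ℂ V'] (c : ℂ) : V' × ℂ →ₗ[ℂ] V' × ℂ :=
  LinearMap.prodMap (c • LinearMap.id) (c ^ 2 • LinearMap.id)

@[simp] theorem twist_fst (c : ℂ) (p : V' × ℂ) : (twist V' c p).1 = c • p.1 := rfl

@[simp] theorem twist_snd (c : ℂ) (p : V' × ℂ) : (twist V' c p).2 = c ^ 2 * p.2 := rfl

@[simp] theorem twist_one (p : V' × ℂ) : twist V' 1 p = p := by ext <;> simp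

theorem twist_twist {c d : ℂ} (h : c * d = 1) (p : V' × ℂ) : twist V' c (twist V' d p) = p := by
  ext
  · simp [smul_smul, h]
  · simp [← mul_assoc, ← mul_pow, h]

theorem HasPD.linear_comp {E : Type v} [AddCommGroup E] [Module ℂ E] {F : Type w} [AddCommGroup F]
    [Module ℂ F] [FiniteDimensional ℂ F] {G : Type x} [AddCommGroup G] [Module ℂ G]
    [FiniteDimensional ℂ G] {f : E → F} {p : E}
    {L : E →ₗ[ℂ] F} (A : F →ₗ[ℂ] G) (hf : HasPD f p L) : HasPD (fun x => A (f x)) p (A ∘ₗ L) :=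
  HasPD.polyComp (isPoly_linear A) (hasPD_linear A _) hf

theorem HasPD.exists_twist {E : Type v} [AddCommGroup E] [Module ℂ E] {c : E → ℂ}
    {g : E → V' × ℂ} {p : E} {L : E →ₗ[ℂ] ℂ} {M : E →ₗ[ℂ] V' × ℂ} (hc : HasPD c p L)
    (hg : HasPD g p M) :
    ∃ N : E →ₗ[ℂ] V' × ℂ, HasPD (fun x => twist V' (c x) (g x)) p N ∧ ∀ v, N v =
      (L v • (g p).1 + c p • (M v).1, 2 * c p * L v * (g p).2 + c p ^ 2 * (M v).2) := by
  have e : (fun x => twist V' (c x) (g x)) =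
      fun x => (c x • LinearMap.fst ℂ V' ℂ (g x), (c x • c x) • LinearMap.snd ℂ V' ℂ (g x)) := by
    funext x
    ext
    · rfl
    · simp [sq]
  rw [e]
  refine ⟨_, hasPD_prodMk (hc.smul (hg.linear_comp _)) ((hc.smul hc).smul (hg.linear_comp _)),
    fun v => Prod.ext ?_ ?_⟩
  · simp
  · simp
    ring

/-- Stability under the nonzero scalars. -/
def IsTwistStable (R : Set (V' × ℂ)) : Prop := ∀ c : ℂ, c ≠ 0 → ∀ p ∈ R, twist V' c p ∈ R

theorem IsPoly.twist {E : Type v} [AddCommGroup E] [Module ℂ E] {c : E → ℂ} {g : E → V' × ℂ}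
    (hc : IsPoly c) (hg : IsPoly g) : IsPoly (fun x => Focal.twist V' (c x) (g x)) :=
  (hc.smul hg.fst).prodMk (isPoly_mul (isPoly_pow hc 2) hg.snd)

namespace IsTwistStable

theorem twist_mem_tangentSpace (hR : IsTwistStable R) {c : ℂ} (hc : c ≠ 0) {p v : V' × ℂ}
    (hv : v ∈ tangentSpace R p) : twist V' c v ∈ tangentSpace R (twist V' c p) :=
  map_mem_tangentSpace _ (fun q hq => hR c hc q hq) hv

theorem mem_tangentSpace_twist (hR : IsTwistStable R) {c : ℂ} (hc : c ≠ 0) {p v : V' × ℂ}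
    (hv : v ∈ tangentSpace R (twist V' c p)) : twist V' c⁻¹ v ∈ tangentSpace R p := by
  have := hR.twist_mem_tangentSpace (inv_ne_zero hc) hv
  rwa [twist_twist (inv_mul_cancel₀ hc)] at this

theorem isSmoothPt_twist (hR : IsTwistStable R) {c : ℂ} (hc : c ≠ 0) {p : V' × ℂ}
    (hp : IsSmoothPt R p) : IsSmoothPt R (twist V' c p) := by
  refine ⟨hR c hc p hp.1, fun q hq => le_trans ?_ (hp.2 q hq)⟩
  have h : (tangentSpace R (twist V' c p)).map (twist V' c⁻¹) ≤ tangentSpace R p := by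
    rintro _ ⟨v, hv, rfl⟩
    exact hR.mem_tangentSpace_twist hc hv
  refine le_trans (le_of_eq ?_) (Submodule.finrank_mono h)
  refine (Submodule.equivMapOfInjective _ ?_ _).finrank_eq
  exact Function.LeftInverse.injective (g := twist V' c) fun v => twist_twist (mul_inv_cancel₀ hc) v

/-- Derivative at 0 of the action of `1 + t`; the factor 2 is the weight of the second coordinate.
-/
theorem euler_mem_tangentSpace (hR : IsTwistStable R) {p : V' × ℂ} (hp : p ∈ R) :
    (p.1, 2 * p.2) ∈ tangentSpace R p := by
  have hg : IsPoly (fun t : ℂ => twist V' (1 + t) p) :=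
    ((isPoly_const 1).add isPoly_id).twist (isPoly_const p)
  have := Gen.pd_mem_tangentSpace irr_univ hg (S := R) (p := 0) (v := 1) ⟨fun t => 1 + t,
    (isPoly_const 1).add isPoly_id, ⟨0, trivial, by simp⟩, fun t _ ht => subset_zcl _ (hR _ ht p hp)⟩
    (by rw [tangentSpace_univ]; trivial)
  obtain ⟨N, hN, hNv⟩ := HasPD.exists_twist
    ((hasPD_const (1 : ℂ) 0).add (hasPD_linear (LinearMap.id (R := ℂ) (M := ℂ)) 0)) (hasPD_const p 0)
  have e := hN.pd_eq
  simp only [LinearMap.id_apply] at e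
  rw [e, hNv] at this
  simpa using this

/-- The equation `⟨O, x⟩ = ρ` is the instance of the tangent equations at the Euler vector. -/
theorem mem_isotropicFibre_iff (hR : IsTwistStable R) {p : V' × ℂ} (hp : p ∈ R) {x : V'} :
    x ∈ isotropicFibre B R p ↔ ∀ v ∈ tangentSpace R p, B v.1 x = v.2 / 2 := by
  refine ⟨fun h => h.2, fun h => ⟨?_, h⟩⟩
  have := h _ (hR.euler_mem_tangentSpace hp)
  simpa using this

end IsTwistStable

/-- The pairs of a smooth point of `R` and a point of its isotropic fibre. -/
def fibrePairs (B : LinearMap.BilinForm ℂ V') (R : Set (V' × ℂ)) : Set (V' × (V' × ℂ)) :=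
  {q | IsSmoothPt R q.2 ∧ q.1 ∈ isotropicFibre B R q.2}

/-- The linear space of the solutions of the homogenized equations of an isotropic fibre. -/
def homogFibre (B : LinearMap.BilinForm ℂ V') (R : Set (V' × ℂ)) (p : V' × ℂ) :
    Submodule ℂ (V' × ℂ) where
  carrier := {y | ∀ v ∈ tangentSpace R p, B v.1 y.1 = y.2 * (v.2 / 2)}
  add_mem' := by
    intro a b ha hb v hv
    rw [Prod.fst_add, map_add, ha v hv, hb v hv, Prod.snd_add]
    ring
  zero_mem' := by
    intro v _
    simp
  smul_mem' := by
    intro c a ha v hv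
    rw [Prod.smul_fst, map_smul, ha v hv, Prod.smul_snd, smul_eq_mul, smul_eq_mul, mul_assoc]

theorem mem_homogFibre {p y : V' × ℂ} :
    y ∈ homogFibre B R p ↔ ∀ v ∈ tangentSpace R p, B v.1 y.1 = y.2 * (v.2 / 2) := Iff.rfl

namespace IsTwistStable

theorem mk_one_mem_homogFibre {q : V' × (V' × ℂ)} (hq : q ∈ fibrePairs B R) :
    (q.1, 1) ∈ homogFibre B R q.2 := fun v hv => by rw [hq.2.2 v hv, one_mul]

/-- A homogeneous solution of weight `s = y.2` is not divided by `s`: it is already a point of the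
fibre over the twist of `p` by `s`. This keeps all constructions polynomial. -/
theorem mem_fibrePairs_of_homogFibre (hR : IsTwistStable R) {p : V' × ℂ} (hp : IsSmoothPt R p)
    {y : V' × ℂ} (hy : y ∈ homogFibre B R p) (h : y.2 ≠ 0) :
    (y.1, twist V' y.2 p) ∈ fibrePairs B R := by
  have hs := hR.isSmoothPt_twist h hp
  refine ⟨hs, (hR.mem_isotropicFibre_iff hs.1).2 fun v hv => ?_⟩
  have := hy _ (hR.mem_tangentSpace_twist h hv)
  simp only [twist_fst, map_smul, LinearMap.smul_apply, twist_snd, smul_eq_mul] at this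
  field_simp at this ⊢
  linear_combination this

theorem twist_mem_fibrePairs (hR : IsTwistStable R) {q : V' × (V' × ℂ)} (hq : q ∈ fibrePairs B R)
    {c : ℂ} (hc : c ≠ 0) : (c • q.1, twist V' c q.2) ∈ fibrePairs B R := by
  have := hR.mem_fibrePairs_of_homogFibre hq.1
    (Submodule.smul_mem _ c (mk_one_mem_homogFibre hq)) (by simpa using hc)
  simpa using this

/-- Consistency of the fibre equations: if the `V'` component vanishes, the equation reads `0 = v.2
/ 2`. -/
theorem fst_injective {q : V' × (V' × ℂ)} (hq : q ∈ fibrePairs B R) {v : V' × ℂ}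
    (hv : v ∈ tangentSpace R q.2) (h : v.1 = 0) : v = 0 := by
  have := hq.2.2 v hv
  rw [h, map_zero, LinearMap.zero_apply] at this
  refine Prod.ext h ?_
  rw [Prod.snd_zero]
  linear_combination -2 * this

/-- Near a point of `fibrePairs B R`, the fibres are given by polynomial equations and have
polynomial sections. -/
theorem exists_fibre_field (hnd : B.Nondegenerate) {q : V' × (V' × ℂ)} (hq : q ∈ fibrePairs B R)
    {y : V' × ℂ} (hy : y ∈ homogFibre B R q.2) :
    ∃ (g : V' × ℂ → V' × ℂ) (d : V' × ℂ → ℂ), IsPoly g ∧ IsPoly d ∧ g q.2 = y ∧ d q.2 ≠ 0 ∧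
      ∀ p ∈ R, d p ≠ 0 → IsSmoothPt R p ∧ g p ∈ homogFibre B R p := by
  obtain ⟨x, p₀⟩ := q
  have hsm : IsSmoothPt R p₀ := hq.1
  let b := Module.finBasis ℂ (tangentSpace R p₀)
  have hfield := fun i => exists_tangent_field hsm (b i).2
  choose u hu hu0 huT using hfield
  have hb := linearIndependent_coe_basis b
  obtain ⟨k, hk, hk0, hkl⟩ := exists_isPoly_linearIndependent hu (p₀ := p₀) (by
    simp only [hu0]
    exact hb)
  obtain ⟨e, he, he0, hes⟩ := hsm.nhd
  let β : V' × ℂ →ₗ[ℂ] Module.Dual ℂ (V' × ℂ) :=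
    ((LinearMap.fst ℂ V' ℂ).dualMap ∘ₗ (B : V' →ₗ[ℂ] Module.Dual ℂ V')).coprod
      (LinearMap.toSpanSingleton ℂ _ (-(1 / 2 : ℂ) • LinearMap.snd ℂ V' ℂ))
  have hβ : ∀ v z, β v z = B v.1 z.1 - z.2 * (v.2 / 2) := fun v z => by simp [β]; ring
  -- `β v` is the homogenized fibre equation attached to `v`. A tangent vector giving the zero
  -- equation has zero `V'` component by nondegeneracy, hence vanishes because the fibre is
  -- nonempty.
  have hli : LinearIndependent ℂ (fun i => β (u i p₀)) := by
    simp only [hu0]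
    refine hb.map (f := β) ?_
    rw [Submodule.disjoint_def]
    intro v hv hβv
    have hvT : v ∈ tangentSpace R p₀ :=
      Submodule.span_le.2 (Set.range_subset_iff.2 fun i => (b i).2) hv
    refine fst_injective hq hvT ((LinearMap.ker_eq_bot'.1 hnd.ker_eq_bot) _ ?_)
    ext z
    have := hβ v (z, 0)
    rw [LinearMap.mem_ker.1 hβv] at this
    simpa using this.symm
  obtain ⟨g, hg, hg0, hg1, -⟩ := exists_poly_solution (fun i => (isPoly_linear β).comp (hu i)) hli
    (v₀ := y) (fun i => by
      rw [hβ, hu0, sub_eq_zero]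
      exact hy _ (b i).2)
  refine ⟨g, fun p => k p * e p, hg, isPoly_mul hk he, hg0, ?_, fun p hp hne => ?_⟩
  · beta_reduce
    rw [hk0, he0]
    norm_num
  · have hps := hes p hp (right_ne_zero_of_mul hne)
    refine ⟨hps, ?_⟩
    have hspan := span_range_eq_of_card (hkl p (left_ne_zero_of_mul hne)) (fun i => huT i p hp) (by
      rw [Fintype.card_fin, (isSmoothPt_iff.1 hps).2, (isSmoothPt_iff.1 hsm).2])
    rw [mem_homogFibre, ← hspan]
    intro v hv
    rw [← sub_eq_zero, ← hβ]
    induction hv using Submodule.span_induction with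
    | mem v hv => obtain ⟨i, rfl⟩ := hv; exact hg1 p i
    | zero => simp
    | add a b _ _ ha hb => rw [map_add, LinearMap.add_apply, ha, hb, add_zero]
    | smul c a _ ha => rw [map_smul, LinearMap.smul_apply, ha, smul_zero]

/-- Irreducibility of `R` gives a smooth point whose homogenized fibre meets all the required open
conditions; that fibre is a linear space, so they hold simultaneously at one of its points of
nonzero weight. -/
theorem irr_fibrePairs (hR : IsTwistStable R) (hRi : Irr R) (hnd : B.Nondegenerate)
    (hne : (fibrePairs B R).Nonempty) : Irr (fibrePairs B R) := by
  refine ⟨hne, ?_⟩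
  have key : ∀ {f : V' × (V' × ℂ) → ℂ}, IsPoly f → (∃ q ∈ fibrePairs B R, f q ≠ 0) →
      Gen R (fun p => IsSmoothPt R p ∧ ∃ y ∈ homogFibre B R p, f (y.1, twist V' y.2 p) ≠ 0) := by
    rintro f hf ⟨q, hq, hfq⟩
    obtain ⟨g, d, hg, hd, hg0, hd0, h⟩ := exists_fibre_field hnd hq (mk_one_mem_homogFibre hq)
    have hF : IsPoly (fun p => f ((g p).1, twist V' (g p).2 p)) :=
      hf.comp (hg.fst.prodMk (hg.snd.twist isPoly_id))
    refine ⟨fun p => d p * f ((g p).1, twist V' (g p).2 p), isPoly_mul hd hF,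
      ⟨q.2, hq.1.1, mul_ne_zero hd0 ?_⟩, fun p hp hne => ?_⟩
    · rw [hg0]
      dsimp only
      rw [twist_one]
      exact hfq
    · obtain ⟨h1, h2⟩ := h p hp (left_ne_zero_of_mul hne)
      exact ⟨h1, g p, h2, right_ne_zero_of_mul hne⟩
  intro f₁ f₂ hf₁ hf₂ h₁ h₂
  obtain ⟨q, hq⟩ := hne
  have h3 := key (f := fun q => 1) (isPoly_const 1) ⟨q, hq, one_ne_zero⟩
  have h4 : Gen R (fun p => ∃ y ∈ homogFibre B R p, y.2 ≠ 0) := by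
    obtain ⟨g, d, hg, hd, hg0, hd0, h⟩ := exists_fibre_field hnd hq (mk_one_mem_homogFibre hq)
    refine ⟨fun p => d p * (g p).2, isPoly_mul hd hg.snd, ⟨q.2, hq.1.1, mul_ne_zero hd0 ?_⟩,
      fun p hp hne => ⟨g p, (h p hp (left_ne_zero_of_mul hne)).2, right_ne_zero_of_mul hne⟩⟩
    rw [hg0]
    exact one_ne_zero
  obtain ⟨p, hp, ⟨hps, y₁, hy₁, hfy₁⟩, ⟨-, y₂, hy₂, hfy₂⟩, y₃, hy₃, hne₃⟩ :=
    ((key hf₁ h₁).and hRi ((key hf₂ h₂).and hRi h4)).exists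
  have hP : ∀ {f : V' × (V' × ℂ) → ℂ}, IsPoly f → IsPoly (fun y : V' × ℂ => f (y.1, twist V' y.2 p)) :=
    fun hf => hf.comp (isPoly_fst.prodMk (isPoly_snd.twist (isPoly_const p)))
  have hI := irr_submodule (homogFibre B R p)
  obtain ⟨y, hy, hy1, hy2, hy3⟩ := ((Gen.of_ne (hP hf₁) ⟨y₁, hy₁, hfy₁⟩).and hI
    ((Gen.of_ne (hP hf₂) ⟨y₂, hy₂, hfy₂⟩).and hI (Gen.of_ne isPoly_snd ⟨y₃, hy₃, hne₃⟩))).exists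
  exact ⟨_, hR.mem_fibrePairs_of_homogFibre hps hy hy3, hy1, hy2⟩

/-- The projection of `fibrePairs B R` to `R` is dominant. -/
theorem gen_exists_fibre (hR : IsTwistStable R) (hnd : B.Nondegenerate) (hne : (fibrePairs B R).Nonempty) :
    Gen R (fun p => ∃ x, (x, p) ∈ fibrePairs B R) := by
  obtain ⟨q, hq⟩ := hne
  obtain ⟨g, d, hg, hd, hg0, hd0, h⟩ := exists_fibre_field hnd hq (mk_one_mem_homogFibre hq)
  refine ⟨fun p => d p * (g p).2, isPoly_mul hd hg.snd, ⟨q.2, hq.1.1, mul_ne_zero hd0 ?_⟩,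
    fun p hp hne => ⟨(g p).2⁻¹ • (g p).1, ?_⟩⟩
  · rw [hg0]
    exact one_ne_zero
  · obtain ⟨h1, h2⟩ := h p hp (left_ne_zero_of_mul hne)
    have h3 : (g p).2 ≠ 0 := right_ne_zero_of_mul hne
    have := hR.mem_fibrePairs_of_homogFibre h1 (Submodule.smul_mem _ (g p).2⁻¹ h2)
      (by simpa using h3)
    simpa [h3] using this

theorem euler_mem_tangentSpace_fibrePairs (hR : IsTwistStable R) {q : V' × (V' × ℂ)}
    (hq : q ∈ fibrePairs B R) :
    (q.1, (q.2.1, 2 * q.2.2)) ∈ tangentSpace (fibrePairs B R) q := by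
  have h1 := (isPoly_const (E := ℂ) (1 : ℂ)).add isPoly_id
  have := Gen.pd_mem_tangentSpace irr_univ (h1.smul (isPoly_const q.1) |>.prodMk
    (h1.twist (isPoly_const q.2))) (S := fibrePairs B R) (p := 0) (v := 1) ⟨fun t => 1 + t,
    h1, ⟨0, trivial, by simp⟩, fun t _ ht => subset_zcl _ (hR.twist_mem_fibrePairs hq ht)⟩
    (by rw [tangentSpace_univ]; trivial)
  have hc := (hasPD_const (1 : ℂ) 0).add (hasPD_linear (LinearMap.id (R := ℂ) (M := ℂ)) 0)
  obtain ⟨N, hN, hNv⟩ := HasPD.exists_twist hc (hasPD_const q.2 0)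
  have e := (hasPD_prodMk (hc.smul (hasPD_const q.1 0)) hN).pd_eq
  simp only [LinearMap.id_apply] at e
  rw [e, LinearMap.prod_apply] at this
  simpa [Function.prod, hNv] using this

/-- Tangent vectors to `R` lift to `fibrePairs B R`. -/
theorem exists_lift_tangent (hR : IsTwistStable R) (hRi : Irr R) (hnd : B.Nondegenerate)
    {q : V' × (V' × ℂ)} (hq : q ∈ fibrePairs B R) {v : V' × ℂ} (hv : v ∈ tangentSpace R q.2) :
    ∃ x, (x, v) ∈ tangentSpace (fibrePairs B R) q := by
  have hE := hR.euler_mem_tangentSpace_fibrePairs hq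
  obtain ⟨x₀, p₀⟩ := q
  obtain ⟨g, d, hg, hd, hg0, hd0, h⟩ := exists_fibre_field hnd hq (mk_one_mem_homogFibre hq)
  dsimp only at hv hg0 hd0 hE
  have h1 : HasPD (fun p => (g p).2) p₀ (LinearMap.snd ℂ V' ℂ ∘ₗ pd g p₀) :=
    (hg.hasPD p₀).linear_comp (LinearMap.snd ℂ V' ℂ)
  have h2 : HasPD (fun p => (g p).1) p₀ (LinearMap.fst ℂ V' ℂ ∘ₗ pd g p₀) :=
    (hg.hasPD p₀).linear_comp (LinearMap.fst ℂ V' ℂ)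
  obtain ⟨N, hN, hNv⟩ := HasPD.exists_twist h1 (hasPD_linear LinearMap.id p₀)
  have h3 := Gen.pd_mem_tangentSpace hRi (hg.fst.prodMk (hg.snd.twist isPoly_id))
    (S := fibrePairs B R) ⟨fun p => d p * (g p).2, isPoly_mul hd hg.snd,
      ⟨p₀, hq.1.1, by simpa only [hg0, mul_one] using hd0⟩, fun p hp hne => subset_zcl _ ?_⟩ hv
  · have e := (hasPD_prodMk h2 hN).pd_eq
    simp only [LinearMap.id_apply] at e
    rw [e, LinearMap.prod_apply, Function.prod, hNv, hg0] at h3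
    change _ ∈ tangentSpace _ (x₀, twist V' 1 p₀) at h3
    rw [twist_one] at h3
    -- The weight of the section `g` is 1 only at `p₀`; its variation moves the base point along the
    -- Euler direction, and subtracting that multiple of the Euler vector restores `v`.
    refine ⟨(pd g p₀ v).1 - (pd g p₀ v).2 • x₀, ?_⟩
    convert! Submodule.sub_mem _ h3 (Submodule.smul_mem _ (pd g p₀ v).2 hE) using 1
    refine Prod.ext rfl (Prod.ext ?_ ?_)
    · simp
    · simp
      ring
  · obtain ⟨h4, h5⟩ := h p hp (left_ne_zero_of_mul hne)
    exact hR.mem_fibrePairs_of_homogFibre h4 h5 (right_ne_zero_of_mul hne)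

theorem mem_tangentSpace_of_orthogonal (hR : IsTwistStable R) {q : V' × (V' × ℂ)}
    (hq : q ∈ fibrePairs B R) {x : V'}
    (hx : x ∈ B.orthogonal ((tangentSpace R q.2).map (LinearMap.fst ℂ V' ℂ))) :
    (x, 0) ∈ tangentSpace (fibrePairs B R) q := by
  refine mem_tangentSpace_of_line fun t => ⟨by simpa using hq.1, ?_⟩
  simp only [Prod.smul_mk, smul_zero, Prod.fst_add, Prod.snd_add, add_zero]
  rw [hR.mem_isotropicFibre_iff hq.1.1]
  intro v hv
  rw [map_add, hq.2.2 v hv, map_smul, LinearMap.BilinForm.mem_orthogonal_iff.1 hx v.1 ⟨v, hv, rfl⟩,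
    smul_zero, add_zero]

/-- The linear relations between the components of a tangent vector to `fibrePairs B R`. -/
theorem tangent_fibrePairs {q : V' × (V' × ℂ)} (hq : q ∈ fibrePairs B R) {x : V'} {v : V' × ℂ}
    (hx : (x, v) ∈ tangentSpace (fibrePairs B R) q) :
    v ∈ tangentSpace R q.2 ∧ B v.1 q.1 = v.2 / 2 ∧ B q.2.1 x = v.2 / 2 := by
  have h1 : v ∈ tangentSpace R q.2 :=
    map_mem_tangentSpace (LinearMap.snd ℂ V' (V' × ℂ)) (fun p hp => hp.1.1) hx
  have h2 := hq.2.2 v h1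
  refine ⟨h1, h2, ?_⟩
  have hpd : HasPD (fun q : V' × (V' × ℂ) => B q.2.1 q.1 - q.2.2) q _ :=
    ((hasPD_bilin B (hasPD_linear (LinearMap.fst ℂ V' ℂ ∘ₗ LinearMap.snd ℂ V' (V' × ℂ)) q)
      (hasPD_linear (LinearMap.fst ℂ V' (V' × ℂ)) q)).add
      (hasPD_linear (-(LinearMap.snd ℂ V' ℂ ∘ₗ LinearMap.snd ℂ V' (V' × ℂ))) q))
  have h3 := isPoly_snd (E := V') (F := V' × ℂ)
  have := mem_tangentSpace.1 hx _ ((isPoly_bilin B h3.fst isPoly_fst).sub h3.snd)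
    fun p hp => sub_eq_zero.2 hp.2.1
  rw [hpd.pd_eq] at this
  simp only [LinearMap.add_apply, LinearMap.comp_apply, LinearMap.flip_apply, LinearMap.fst_apply,
    LinearMap.snd_apply, LinearMap.neg_apply, h2] at this
  linear_combination this

/-- Extend `v` to a tangent field `u` on `R` and differentiate the fibre equation of `u` in the
direction `(x, 0)`: `u` does not move, and what remains is orthogonality to `v.1`. -/
theorem mem_orthogonal_of_tangent {q : V' × (V' × ℂ)}
    (hq : q ∈ fibrePairs B R) {x : V'} (hx : (x, 0) ∈ tangentSpace (fibrePairs B R) q) :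
    x ∈ B.orthogonal ((tangentSpace R q.2).map (LinearMap.fst ℂ V' ℂ)) := by
  rw [LinearMap.BilinForm.mem_orthogonal_iff]
  rintro _ ⟨v, hv, rfl⟩
  obtain ⟨u, hu, hu0, huT⟩ := exists_tangent_field hq.1 hv
  have hu1 : HasPD (fun q : V' × (V' × ℂ) => u q.2) q (pd u q.2 ∘ₗ LinearMap.snd ℂ V' (V' × ℂ)) :=
    (hu.hasPD q.2).polyComp hu (hasPD_linear (LinearMap.snd ℂ V' (V' × ℂ)) q)
  have hpd : HasPD (fun q : V' × (V' × ℂ) => B (u q.2).1 q.1 - (1 / 2 : ℂ) * (u q.2).2) q _ :=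
    (hasPD_bilin B (hu1.linear_comp (LinearMap.fst ℂ V' ℂ))
      (hasPD_linear (LinearMap.fst ℂ V' (V' × ℂ)) q)).add
      (hu1.linear_comp (-((1 / 2 : ℂ) • LinearMap.snd ℂ V' ℂ)))
  have hup := hu.comp (isPoly_snd (E := V') (F := V' × ℂ))
  have := mem_tangentSpace.1 hx _ ((isPoly_bilin B hup.fst isPoly_fst).sub
    (isPoly_mul (isPoly_const (1 / 2 : ℂ)) hup.snd)) fun p hp => by
      rw [hp.2.2 _ (huT p.2 hp.1.1)]
      ring
  rw [hpd.pd_eq] at this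
  simpa [hu0] using this

/-- All tangent spaces of `fibrePairs B R` have the dimension of `V'`. -/
theorem finrank_tangentSpace_fibrePairs (hR : IsTwistStable R) (hRi : Irr R) (hnd : B.Nondegenerate)
    {q : V' × (V' × ℂ)} (hq : q ∈ fibrePairs B R) :
    Module.finrank ℂ (tangentSpace (fibrePairs B R) q) = Module.finrank ℂ V' := by
  set T := tangentSpace (fibrePairs B R) q
  set W := (tangentSpace R q.2).map (LinearMap.fst ℂ V' ℂ)
  have h1 : Module.finrank ℂ (B.orthogonal W) = _ :=
    LinearMap.BilinForm.finrank_orthogonal hnd W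
  have h1' := Submodule.finrank_le W
  -- Projection to the `O` component has image `W` and kernel the orthogonal space of `W`, whose
  -- dimensions add up to that of `V'`.
  have h2 : LinearMap.range ((LinearMap.fst ℂ V' ℂ ∘ₗ LinearMap.snd ℂ V' (V' × ℂ)).domRestrict T) =
      W := by
    rw [LinearMap.range_domRestrict]
    apply le_antisymm
    · rintro _ ⟨⟨x, v⟩, ht, rfl⟩
      exact ⟨v, (tangent_fibrePairs hq ht).1, rfl⟩
    · rintro _ ⟨v, hv, rfl⟩
      obtain ⟨x, hx⟩ := hR.exists_lift_tangent hRi hnd hq hv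
      exact ⟨_, hx, rfl⟩
  have h3 : (LinearMap.ker ((LinearMap.fst ℂ V' ℂ ∘ₗ
      LinearMap.snd ℂ V' (V' × ℂ)).domRestrict T)).map T.subtype =
      (B.orthogonal W).map (LinearMap.inl ℂ V' (V' × ℂ)) := by
    ext v
    constructor
    · rintro ⟨⟨⟨x, v⟩, hv⟩, hv', rfl⟩
      have hv1 : v = 0 := fst_injective hq (tangent_fibrePairs hq hv).1 hv'
      subst hv1
      exact ⟨x, mem_orthogonal_of_tangent hq hv, rfl⟩
    · rintro ⟨z, hz, rfl⟩
      exact ⟨⟨_, hR.mem_tangentSpace_of_orthogonal hq hz⟩, rfl, rfl⟩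
  have h4 := congrArg (fun W : Submodule ℂ (V' × (V' × ℂ)) => Module.finrank ℂ W) h3
  beta_reduce at h4
  rw [← (Submodule.equivMapOfInjective _ T.injective_subtype _).finrank_eq,
    ← (Submodule.equivMapOfInjective _ LinearMap.inl_injective _).finrank_eq] at h4
  have h5 := LinearMap.finrank_range_add_finrank_ker
    ((LinearMap.fst ℂ V' ℂ ∘ₗ LinearMap.snd ℂ V' (V' × ℂ)).domRestrict T)
  rw [h2] at h5
  omega

theorem gdim_fibrePairs (hR : IsTwistStable R) (hRi : Irr R) (hnd : B.Nondegenerate)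
    (hne : (fibrePairs B R).Nonempty) : gdim (fibrePairs B R) = Module.finrank ℂ V' := by
  obtain ⟨p, hp⟩ := exists_isSmoothPt hne
  rw [← (isSmoothPt_iff.1 hp).2, hR.finrank_tangentSpace_fibrePairs hRi hnd hp.1]

end IsTwistStable

end IsotropicFibre

/-! ### Rank formulas and dimensions of images. -/

section General

variable {E : Type u} [AddCommGroup E] [Module ℂ E] [FiniteDimensional ℂ E]
  {F : Type v} [AddCommGroup F] [Module ℂ F] [FiniteDimensional ℂ F]

theorem finrank_map_add_finrank_inf_ker (T : Submodule ℂ E) (f : E →ₗ[ℂ] F) :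
    Module.finrank ℂ (T.map f) + Module.finrank ℂ (T ⊓ LinearMap.ker f : Submodule ℂ E) =
      Module.finrank ℂ T := by
  rw [← LinearMap.finrank_range_add_finrank_ker (f.domRestrict T), LinearMap.range_domRestrict,
    ← Submodule.map_comap_subtype,
    ← (Submodule.equivMapOfInjective _ T.injective_subtype _).finrank_eq]
  rfl

theorem gdim_univ : gdim (Set.univ : Set E) = Module.finrank ℂ E := by
  obtain ⟨p, hp⟩ := exists_isSmoothPt (S := (Set.univ : Set E)) ⟨0, trivial⟩
  rw [← (isSmoothPt_iff.1 hp).2, tangentSpace_univ, finrank_top]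

/-- The dimension of the image is the generic rank. -/
theorem gdim_image {E : Type u} [AddCommGroup E] [Module ℂ E] [FiniteDimensional ℂ E]
    {F : Type u} [AddCommGroup F] [Module ℂ F] [FiniteDimensional ℂ F]
    {W : Set E} (hW : Irr W) {g : E → F} (hg : IsPoly g) {P : ℕ → Prop}
    (h : Gen W (fun p => P (Module.finrank ℂ ((tangentSpace W p).map (pd g p))))) :
    P (gdim (g '' W)) := by
  obtain ⟨p, hp, h1, h2, h3⟩ := ((gen_map_tangentSpace hW hg).and hW
    (h.and hW (Gen.of_image hg (gen_isSmoothPt (hW.image hg).1)))).exists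
  rw [h1, (isSmoothPt_iff.1 h3).2] at h2
  exact h2

theorem eq_univ_of_gdim {S : Set (ℙ ℂ E)} (hS : IsClosed[zariskiProj E] S)
    (hSi : Irr (pcone S)) (h : Module.finrank ℂ E ≤ gdim (pcone S)) : S = Set.univ := by
  have h1 : zcl (pcone S) = zcl Set.univ := zcl_eq_of_gdim_le hSi irr_univ
    (fun x _ => subset_zcl _ trivial) (by rwa [gdim_univ])
  refine Set.eq_univ_of_forall fun p => mem_pcone_rep.1 ?_
  exact isClosed_zariskiProj_iff.1 hS _ (h1 ▸ subset_zcl _ trivial) p.rep_nonzero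

end General

/-! ### Ramification along a component at infinity. -/

section Ramification

variable {V' : Type u} [AddCommGroup V'] [Module ℂ V'] [FiniteDimensional ℂ V']
  {B : LinearMap.BilinForm ℂ V'} {X : Set (ℙ ℂ (V' × ℂ))} {D : Set (ℙ ℂ V')}

/-- The points of the normal bundle at which the second projection is ramified. -/
def ramified (B : LinearMap.BilinForm ℂ V') (X : Set (ℙ ℂ (V' × ℂ))) :
    Set ((V' × ℂ) × (V' × ℂ)) :=
  {p | p ∈ normalOver B X (general B X) ∧
    (tangentSpace (normalOver B X (general B X)) p).map (LinearMap.snd ℂ (V' × ℂ) (V' × ℂ)) ≠ ⊤}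

namespace IsSetting

theorem gen_unramified (H : IsSetting B X) {Q : Set (V' × ℂ)} (hQg : Q ⊆ general B X)
    {p₀ : (V' × ℂ) × (V' × ℂ)} (hp₀ : p₀ ∈ normalOver B X Q) (h₀ : p₀ ∉ ramified B X) :
    Gen (normalOver B X Q) (fun p => p ∉ ramified B X) := by
  have hN := normalOver_mono (B := B) (X := X) hQg
  obtain ⟨d, h, hd, hh, hh0, hdh⟩ := H.exists_ramification_equation (hN hp₀)
  refine ⟨fun p => d p * h p, isPoly_mul hd hh, ⟨p₀, hp₀, mul_ne_zero (fun h0 => h₀ ?_) hh0⟩,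
    fun p hp hne hr => left_ne_zero_of_mul hne ?_⟩
  · exact ⟨hN hp₀, (hdh p₀ (hN hp₀) hh0).1 h0⟩
  · exact (hdh p (hN hp) (right_ne_zero_of_mul hne)).2 hr.2

theorem irr_pcone_focal (H : IsSetting B X) (hD : IsComponentAtInfinity X D)
    (hne : (generalAtInfinity B X D).Nonempty) {S : Set (ℙ ℂ V')}
    (hS : zcl (Prod.snd '' focalPairs B X D) = zcl (pcone S)) : Irr (pcone S) :=
  ((H.irr_focalPairs hD hne).image isPoly_snd).of_zcl_eq hS

/-- If the restriction of the normal bundle to a component at infinity has a point where the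
projection is unramified, then its image is the whole hyperplane at infinity. -/
theorem eq_univ_of_unramified (H : IsSetting B X) (hD : IsComponentAtInfinity X D)
    (hne : (generalAtInfinity B X D).Nonempty) {S : Set (ℙ ℂ V')}
    (hSc : IsClosed[zariskiProj V'] S)
    (hS : zcl (Prod.snd '' focalPairs B X D) = zcl (pcone S)) {p₀ : (V' × ℂ) × (V' × ℂ)}
    (hp₀ : p₀ ∈ normalOver B X ((fun x => (x, (0 : ℂ))) '' generalAtInfinity B X D))
    (h₀ : p₀ ∉ ramified B X) : S = Set.univ := by
  have hSi := H.irr_pcone_focal hD hne hS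
  refine eq_univ_of_gdim hSc hSi ?_
  set N := normalOver B X (general B X)
  set N' := normalOver B X ((fun x => (x, (0 : ℂ))) '' generalAtInfinity B X D)
  have hN' : Irr N' := H.irr_normalOver_infinity hD hne
  have hNN : N' ⊆ N := normalOver_mono image_generalAtInfinity_subset
  have h1 : Module.finrank ℂ V' ≤ gdim (Prod.snd '' N') := by
    refine gdim_image hN' isPoly_snd (P := fun n => Module.finrank ℂ V' ≤ n) ?_
    refine (H.gen_unramified image_generalAtInfinity_subset hp₀ h₀).mono fun p hp hpr => ?_
    have e : pd (Prod.snd : (V' × ℂ) × (V' × ℂ) → V' × ℂ) p = LinearMap.snd ℂ _ _ :=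
      pd_linear (LinearMap.snd ℂ _ _) p
    rw [e]
    -- At an unramified point the kernel on the whole bundle has dimension `(m + 2) - (m + 1) = 1`.
    -- On the restriction, of dimension `m + 1`, it is at most one, so the rank is at least `m`.
    have h2 := finrank_map_add_finrank_inf_ker (tangentSpace N p) (LinearMap.snd ℂ (V' × ℂ) (V' × ℂ))
    have h3 := finrank_map_add_finrank_inf_ker (tangentSpace N' p) (LinearMap.snd ℂ (V' × ℂ) (V' × ℂ))
    have h4 : (tangentSpace N p).map (LinearMap.snd ℂ (V' × ℂ) (V' × ℂ)) = ⊤ := by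
      by_contra h
      exact hpr ⟨hNN hp, h⟩
    rw [h4, finrank_top, H.finrank_tangentSpace_normalBundle (hNN hp), Module.finrank_prod,
      Module.finrank_self] at h2
    have h5 : gdim N' ≤ Module.finrank ℂ (tangentSpace N' p) := gdim_le hp
    have h7 : gdim N' = Module.finrank ℂ V' + 1 := H.gdim_normalOver_infinity hD hne
    have h6 : Module.finrank ℂ
        (tangentSpace N' p ⊓ LinearMap.ker (LinearMap.snd ℂ (V' × ℂ) (V' × ℂ)) : Submodule ℂ _) ≤ _ :=
      Submodule.finrank_mono (inf_le_inf_right _ (tangentSpace_mono hNN p))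
    omega
  have h2 : gdim (Prod.snd '' N') = _ := gdim_congr (hN'.image isPoly_snd) zcl_snd_normalOver
  rw [gdim_image_inl, gdim_congr ((H.irr_focalPairs hD hne).image isPoly_snd) hS] at h2
  omega

/-- The ramification condition is stated at chosen representatives; independent rescaling of the two
factors transports tangent vectors to any other representative. -/
theorem bicone_ramification_subset {p : (V' × ℂ) × (V' × ℂ)}
    (hp : p ∈ bicone {p | p ∈ normalBundle B X ∧
      (tangentSpace (bicone (normalBundle B X)) (p.1.rep, p.2.rep)).map
        (LinearMap.snd ℂ (V' × ℂ) (V' × ℂ)) ≠ ⊤}) : p ∈ ramified B X := by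
  obtain ⟨h1, h2, h3, h4⟩ := hp
  have hpN := mem_bicone_normalBundle.1 ⟨h1, h2, h3⟩
  refine ⟨⟨hpN.1, hpN.2.2⟩, ?_⟩
  rw [← tangentSpace_congr zcl_bicone_normalBundle_univ]
  obtain ⟨a, ha⟩ := Projectivization.exists_smul_eq_mk_rep ℂ p.1 h1
  obtain ⟨b, hb⟩ := Projectivization.exists_smul_eq_mk_rep ℂ p.2 h2
  intro htop
  apply h4
  simp only
  rw [← ha, ← hb, eq_top_iff]
  rintro y -
  obtain ⟨t, ht, hty⟩ := htop.ge (Submodule.mem_top (x := (b : ℂ)⁻¹ • y))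
  refine ⟨((a : ℂ) • t.1, (b : ℂ) • t.2), ?_, ?_⟩
  · exact map_mem_tangentSpace (T := bicone (normalBundle B X))
      (LinearMap.prodMap ((a : ℂ) • LinearMap.id) ((b : ℂ) • LinearMap.id))
      (fun q hq => mem_bicone_smul hq a.ne_zero b.ne_zero) ht
  · simp only [LinearMap.snd_apply] at hty ⊢
    rw [hty, smul_smul, mul_inv_cancel₀ b.ne_zero, one_smul]

/-- Generic smoothness of the second projection: at a general point its differential maps onto the
tangent space of the image, which is everything when the projection is dominant. -/
theorem exists_unramified (H : IsSetting B X) (hne : (general B X).Nonempty)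
    (hdom : ¬ IsIsotropicallyFocallyDegenerate B X) :
    ∃ p ∈ normalOver B X (general B X), p ∉ ramified B X := by
  have hN := H.irr_normalOver (H.irr_general hne) subset_rfl
  obtain ⟨p, hp, h⟩ := (gen_map_tangentSpace hN isPoly_snd).exists
  refine ⟨p, hp, fun hr => hr.2 ?_⟩
  have e : pd (Prod.snd : (V' × ℂ) × (V' × ℂ) → V' × ℂ) p = LinearMap.snd ℂ _ _ :=
    pd_linear (LinearMap.snd ℂ _ _) p
  rw [e] at h
  rw [h, eq_top_iff, ← tangentSpace_univ (p.2)]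
  have h1 : zcl (pcone (focalImage (normalVariety B X))) =
      zcl (Prod.snd '' normalOver B X (general B X)) := by
    rw [focalImage, zcl_pcone_closure, pcone_image_snd]
    refine zcl_image_congr isPoly_snd ?_
    rw [normalVariety, zcl_bicone_closure, zcl_bicone_normalBundle_univ]
  rw [IsIsotropicallyFocallyDegenerate, not_not] at hdom
  rw [hdom] at h1
  rw [← tangentSpace_zcl (Prod.snd '' _), ← h1, tangentSpace_zcl]
  have h2 : zcl (pcone (Set.univ : Set (ℙ ℂ (V' × ℂ)))) = zcl Set.univ := by
    rw [← zcl_cone ⟨Projectivization.mk ℂ _ hp.1.1, Set.mem_univ _⟩]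
    congr 1
    exact Set.eq_univ_of_forall fun v _ => trivial
  rw [tangentSpace_congr h2]

/-- If the normal bundle is ramified along its restriction to a component at infinity, then this
restriction is a component of the ramification locus. -/
theorem isComponent_normalRestriction (H : IsSetting B X) (hD : IsComponentAtInfinity X D)
    (hne : (generalAtInfinity B X D).Nonempty) (hdom : ¬ IsIsotropicallyFocallyDegenerate B X)
    (hram : ∀ p ∈ normalOver B X ((fun x => (x, (0 : ℂ))) '' generalAtInfinity B X D),
      p ∈ ramified B X) :
    IsComponent (zariskiBiproj (V' × ℂ)) (ramification B X)
      (normalRestriction B X (atInfinity V' '' D)) := by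
  have hgne : (general B X).Nonempty := by
    obtain ⟨x, hx⟩ := hne
    exact ⟨_, hx.2⟩
  set N := normalOver B X (general B X)
  set N' := normalOver B X ((fun x => (x, (0 : ℂ))) '' generalAtInfinity B X D)
  have hN : Irr N := H.irr_normalOver (H.irr_general hgne) subset_rfl
  have hN' : Irr N' := H.irr_normalOver_infinity hD hne
  refine ⟨⟨isIrreducible_zariskiBiproj_iff.2 (hN'.of_zcl_eq zcl_bicone_normalRestriction.symm),
    @closure_mono _ (zariskiBiproj (V' × ℂ)) _ _ fun p hp => ⟨hp.1, ?_⟩⟩, ?_⟩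
  · have hpN : (p.1.rep, p.2.rep) ∈ N' := by
      refine ⟨?_, hp.1.2⟩
      rw [image_generalAtInfinity]
      exact ⟨mem_pcone_rep.2 hp.2, mem_pcone_rep.2 hp.1.1⟩
    rw [tangentSpace_congr zcl_bicone_normalBundle_univ]
    exact (hram _ hpN).2
  · rintro T ⟨hT, hTr⟩ hle
    have hTi := isIrreducible_zariskiBiproj_iff.1 hT
    have hTR : bicone T ⊆ zcl (ramified B X) := fun v hv =>
      zcl_mono (fun _ => bicone_ramification_subset)
        (mem_bicone_closure.1 (bicone_subset_bicone.2 hTr hv)).2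
    have hTN : bicone T ⊆ zcl N := hTR.trans (zcl_mono fun p hp => hp.1)
    have hNT : N' ⊆ zcl (bicone T) := by
      refine (subset_zcl N').trans ?_
      rw [← zcl_bicone_normalRestriction]
      exact zcl_mono (bicone_subset_bicone.2 hle)
    have hNd : gdim N = Module.finrank ℂ V' + 2 := by
      obtain ⟨p, hp⟩ := exists_isSmoothPt hN.1
      rw [← (isSmoothPt_iff.1 hp).2, H.finrank_tangentSpace_normalBundle hp.1]
    have hNd' : gdim N' = Module.finrank ℂ V' + 1 := H.gdim_normalOver_infinity hD hne
    -- A larger irreducible set inside the ramification locus either has full dimension, so that it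
    -- is dense in `N` against the existence of unramified points, or has at most dimension `m + 1`
    -- and coincides with the restriction up to closure.
    by_cases hd : gdim N ≤ gdim (bicone T)
    · have h1 := zcl_eq_of_gdim_le hTi hN hTN hd
      obtain ⟨p₀, hp₀, hr⟩ := H.exists_unramified hgne hdom
      obtain ⟨f, hf, ⟨p, hp, hfp⟩, h⟩ := H.gen_unramified subset_rfl hp₀ hr
      refine absurd ?_ hfp
      have h2 : p ∈ zcl (ramified B X) := zcl_subset_zcl hTR (h1 ▸ subset_zcl N hp)
      refine h2 f hf fun q hq => ?_
      by_contra hne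
      exact h q hq.1 hne hq
    · have h1 := zcl_eq_of_gdim_le hN' hTi hNT (by omega)
      refine bicone_subset_bicone.1 fun v hv => mem_bicone_closure.2 ⟨⟨hv.1, hv.2.1⟩, ?_⟩
      rw [zcl_bicone_normalBundle, ← image_generalAtInfinity]
      exact h1 ▸ subset_zcl _ hv

end IsSetting

end Ramification

/-! ### Hypersurfaces are not proper subsets of the hyperplane at infinity. -/

section Hypersurface

variable {V' : Type u} [AddCommGroup V'] [Module ℂ V'] [FiniteDimensional ℂ V']

/-- A proper closed subset of the hyperplane at infinity is not a hypersurface. -/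
theorem not_isHypersurface {S : Set (ℙ ℂ V')} (hS : S ≠ Set.univ) :
    ¬ IsHypersurface (atInfinity V' '' S) := by
  rintro ⟨f, hf, d, hd, -, hhom, hfS⟩
  have hfp : IsPoly f := isPoly_scalar.2 hf
  have key : ∀ v (hv : v ≠ 0), Projectivization.mk ℂ v hv ∈ atInfinity V' '' S ↔ f v = 0 := by
    intro v hv
    obtain ⟨a, ha⟩ := Projectivization.exists_smul_eq_mk_rep ℂ v hv
    rw [hfS, Set.mem_ofPred_eq, ← ha, Units.smul_def, hhom]
    simp
  have hmem : ∀ v (hv : v ≠ 0), Projectivization.mk ℂ v hv ∈ atInfinity V' '' S ↔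
      ∃ x ∈ pcone S, (x, (0 : ℂ)) = v := by
    intro v hv
    have h := Set.ext_iff.1 (pcone_image_atInfinity S) v
    rw [mem_pcone] at h
    exact ⟨fun h' => h.1 ⟨hv, h'⟩, fun h' => (h.2 h').2⟩
  have hne : ∀ (v : V') (t : ℂ), t ≠ 0 → f (v, t) ≠ 0 := by
    intro v t ht h0
    have hv : (v, t) ≠ 0 := fun h => ht (congrArg Prod.snd h)
    obtain ⟨x, -, hx⟩ := (hmem _ hv).1 ((key _ hv).2 h0)
    exact ht (congrArg Prod.snd hx).symm
  refine hS (Set.eq_univ_of_forall fun p => ?_)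
  have hv : (p.rep, (0 : ℂ)) ≠ 0 := fun h => p.rep_nonzero (congrArg Prod.fst h)
  suffices h0 : f (p.rep, 0) = 0 by
    obtain ⟨x, hx, hxp⟩ := (hmem _ hv).1 ((key _ hv).2 h0)
    have e : x = p.rep := congrArg Prod.fst hxp
    rw [e] at hx
    exact mem_pcone_rep.1 hx
  -- If `f (p, 0) ≠ 0`, then `t ↦ f (p, t)` has no root and is a constant `c`. By homogeneity `f (s
  -- • p, 1) = s ^ d * c` for `s ≠ 0`, so in the limit `f (0, 1) = 0` since `d > 0`, although `f`
  -- has no zero off infinity.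
  by_contra hv0
  obtain ⟨q, hq⟩ := exists_polynomial_line hfp (p.rep, (0 : ℂ)) (0, 1)
  have hq' : ∀ t, f (p.rep, t) = q.eval t := fun t => by simpa using hq t
  have hdeg : q.degree = 0 := by
    by_contra h
    obtain ⟨t, ht⟩ := IsAlgClosed.exists_root q h
    rw [Polynomial.IsRoot.def, ← hq'] at ht
    by_cases h0 : t = 0
    · exact hv0 (h0 ▸ ht)
    · exact hne _ t h0 ht
  rw [Polynomial.eq_C_of_degree_eq_zero hdeg] at hq'
  simp only [Polynomial.eval_C] at hq'
  have hg : IsPoly (fun s : ℂ => f (s • p.rep, 1) - s ^ d * q.coeff 0) :=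
    (hfp.comp ((isPoly_id.smul (isPoly_const _)).prodMk (isPoly_const 1))).sub
      (isPoly_mul (isPoly_pow isPoly_id d) (isPoly_const _))
  have h1 := mem_zcl_of_curve (S := {(0 : ℂ)}) hg fun s hs => by
    have h2 := hhom s (p.rep, s⁻¹)
    rw [Prod.smul_mk, smul_eq_mul, mul_inv_cancel₀ hs, hq'] at h2
    rw [h2, sub_self]
    rfl
  have h2 := h1 (fun t => t) isPoly_id (fun t ht => ht)
  simp only [zero_smul, zero_pow hd.ne', zero_mul, sub_zero] at h2
  exact hne 0 1 one_ne_zero h2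

end Hypersurface

/-! ### From an admissible pair to ramification. -/

section Converse

variable {V' : Type u} [AddCommGroup V'] [Module ℂ V'] [FiniteDimensional ℂ V']
  {B : LinearMap.BilinForm ℂ V'} {X : Set (ℙ ℂ (V' × ℂ))} {D S : Set (ℙ ℂ V')} {R : Set (V' × ℂ)}

namespace IsAlgebraicSection

theorem twistStable (h : IsAlgebraicSection S R) : IsTwistStable R :=
  fun c hc p hp => h.homogeneous c p.1 p.2 hc hp

theorem irr (h : IsAlgebraicSection S R) : Irr R := isIrreducible_zariski_iff.1 h.irreducible

end IsAlgebraicSection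

/-- The cone over the variety swept out by the isotropic fibres. -/
theorem mem_pcone_sweep (hR : IsTwistStable R) {v : V'} :
    v ∈ pcone (@closure _ (zariskiProj V') {q | ∃ p, IsSmoothPt R p ∧
      ∃ x ∈ isotropicFibre B R p, ∃ hx : x ≠ 0, q = Projectivization.mk ℂ x hx}) ↔
      v ≠ 0 ∧ v ∈ zcl (Prod.fst '' fibrePairs B R \ {0}) := by
  have h : {q | ∃ p, IsSmoothPt R p ∧ ∃ x ∈ isotropicFibre B R p, ∃ hx : x ≠ 0,
      q = Projectivization.mk ℂ x hx} =
      {q | ∃ x ∈ Prod.fst '' fibrePairs B R, ∃ hx : x ≠ 0, q = Projectivization.mk ℂ x hx} := by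
    ext q
    constructor
    · rintro ⟨p, hp, x, hx, hx0, h⟩
      exact ⟨x, ⟨(x, p), ⟨hp, hx⟩, rfl⟩, hx0, h⟩
    · rintro ⟨_, ⟨⟨x, p⟩, ⟨hp, hx⟩, rfl⟩, hx0, h⟩
      exact ⟨p, hp, x, hx, hx0, h⟩
  rw [mem_pcone_closure, h, zcl_pcone_mk]
  rintro c hc _ ⟨q, hq, rfl⟩
  exact ⟨_, hR.twist_mem_fibrePairs hq hc, rfl⟩

namespace IsIsotropicInverseFocal

theorem mem_pcone_iff (hI : IsIsotropicInverseFocal B S R D) {v : V'} :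
    v ∈ pcone D ↔ v ≠ 0 ∧ v ∈ zcl (Prod.fst '' fibrePairs B R \ {0}) := by
  conv_lhs => rw [hI.eq_closure]
  exact mem_pcone_sweep hI.isSection.twistStable

theorem nonempty_fibrePairs (hI : IsIsotropicInverseFocal B S R D) (hD : (pcone D).Nonempty) :
    (fibrePairs B R).Nonempty := by
  by_contra hne
  rw [Set.not_nonempty_iff_eq_empty] at hne
  obtain ⟨v, hv⟩ := hD
  have := (hI.mem_pcone_iff.1 hv).2 (fun _ => 1) (isPoly_const 1)
  simp [hne] at this

theorem zcl_fst_fibrePairs (hI : IsIsotropicInverseFocal B S R D) (hD : (pcone D).Nonempty) :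
    zcl (Prod.fst '' fibrePairs B R) = zcl (pcone D) := by
  apply Set.Subset.antisymm
  · refine zcl_subset_zcl fun v hv => ?_
    by_cases h0 : v = 0
    · exact h0 ▸ zero_mem_zcl_of_smul hD fun c hc v hv => mem_pcone_smul hv hc
    · exact subset_zcl _ (hI.mem_pcone_iff.2 ⟨h0, subset_zcl _ ⟨hv, h0⟩⟩)
  · exact zcl_subset_zcl fun v hv => zcl_mono Set.sdiff_subset (hI.mem_pcone_iff.1 hv).2

/-- The cone over `D` is the closure of the points in the isotropic fibres, so the open condition of
being general, once satisfied on `D`, is satisfied by some fibre point. -/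
theorem gen_fst_mem (hI : IsIsotropicInverseFocal B S R D) (hD : IsComponentAtInfinity X D)
    (hne : (generalAtInfinity B X D).Nonempty) :
    Gen (fibrePairs B R) (fun q => q.1 ∈ generalAtInfinity B X D) := by
  obtain ⟨x, hx, hxg⟩ := hne
  obtain ⟨h, hh, h0, hg⟩ := exists_general_nhd hxg
  obtain ⟨l, hl⟩ := Module.Projective.exists_dual_eq_one ℂ hx.1
  have hF : IsPoly (fun v : V' => h (v, 0) * l v) :=
    isPoly_mul (hh.comp (isPoly_id.prodMk (isPoly_const 0))) (isPoly_linear l)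
  have hx1 := (hI.mem_pcone_iff.1 hx).2
  obtain ⟨_, ⟨⟨q, hq, rfl⟩, -⟩, hne⟩ := (exists_ne_zcl hF).1 ⟨x, hx1, by rw [hl, mul_one]; exact h0⟩
  refine ⟨_, hF.comp isPoly_fst, ⟨q, hq, hne⟩, fun p hp hpne => ?_⟩
  have hp0 : p.1 ≠ 0 := fun h => right_ne_zero_of_mul hpne (by rw [h, map_zero])
  have hpD : p.1 ∈ pcone D :=
    hI.mem_pcone_iff.2 ⟨hp0, subset_zcl _ ⟨⟨p, hp, rfl⟩, hp0⟩⟩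
  exact ⟨hpD, hg _ (pcone_subset_cone X (IsSetting.component_subset hD hpD))
    (left_ne_zero_of_mul hpne)⟩

/-- The differential of the relation `⟨x, x⟩ = ρ` on an admissible pair. -/
theorem tangent_sq (hI : IsIsotropicInverseFocal B S R D) (hB : B.IsSymm) {q : V' × (V' × ℂ)}
    {x : V'} {v : V' × ℂ} (h : (x, v) ∈ tangentSpace (fibrePairs B R) q) :
    B q.1 x = v.2 / 2 := by
  have hpd : HasPD (fun q : V' × (V' × ℂ) => B q.1 q.1 - q.2.2) q _ :=
    ((hasPD_bilin B (hasPD_linear (LinearMap.fst ℂ V' (V' × ℂ)) q)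
      (hasPD_linear (LinearMap.fst ℂ V' (V' × ℂ)) q)).add
      (hasPD_linear (-(LinearMap.snd ℂ V' ℂ ∘ₗ LinearMap.snd ℂ V' (V' × ℂ))) q))
  have := mem_tangentSpace.1 h _ ((isPoly_bilin B isPoly_fst isPoly_fst).sub
    (isPoly_snd (E := V') (F := V' × ℂ)).snd)
    fun p hp => sub_eq_zero.2 (hI.admissible p.2 hp.1 p.1 hp.2)
  rw [hpd.pd_eq] at this
  simp only [LinearMap.add_apply, LinearMap.comp_apply, LinearMap.flip_apply, LinearMap.fst_apply,
    LinearMap.snd_apply, LinearMap.neg_apply, hB.eq x] at this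
  linear_combination this / 2

/-- The differentials of `⟨O, x⟩ = ρ` and `⟨x, x⟩ = ρ` give `⟨O, u⟩ = ⟨x, u⟩` for every `u` coming
from a tangent vector of the total space. By generic smoothness these are all the tangent directions
of `D`, so `O - x` is normal. -/
theorem gen_mem_focalPairs (hI : IsIsotropicInverseFocal B S R D) (H : IsSetting B X)
    (hD : IsComponentAtInfinity X D) (hne : (generalAtInfinity B X D).Nonempty) :
    Gen (fibrePairs B R) (fun q => (q.1, q.2.1) ∈ focalPairs B X D) := by
  have hDne := (IsSetting.irr_component hD).1
  have hA := hI.isSection.twistStable.irr_fibrePairs hI.isSection.irr H.nondeg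
    (hI.nonempty_fibrePairs hDne)
  refine ((hI.gen_fst_mem hD hne).and hA (gen_map_tangentSpace hA isPoly_fst)).mono ?_
  rintro ⟨x, p⟩ hq ⟨hx, hT⟩
  refine ⟨hx, ?_⟩
  dsimp only at hx hT ⊢
  rw [mem_normalDirections]
  intro u hu
  have e : pd (Prod.fst : V' × (V' × ℂ) → V') (x, p) = LinearMap.fst ℂ _ _ :=
    pd_linear (LinearMap.fst ℂ V' (V' × ℂ)) (x, p)
  rw [e, tangentSpace_congr ((hI.zcl_fst_fibrePairs hDne).trans (IsSetting.zcl_generalAtInfinity hD hne).symm),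
    H.tangentSpace_generalAtInfinity hD hx] at hT
  obtain ⟨⟨u, v⟩, hv, rfl⟩ := hT.ge hu
  have h1 := (IsTwistStable.tangent_fibrePairs hq hv).2.2
  have h2 := hI.tangent_sq H.symm hv
  simp only [LinearMap.fst_apply] at h1 h2 ⊢
  rw [map_sub, H.symm.eq u, H.symm.eq u, h1, h2, sub_self]

/-- Forgetting `ρ` is injective on tangent vectors, since the tangent spaces of `R` contain no
vertical vector. Both sides then have the dimension of `V'`, and inclusion gives density. -/
theorem zcl_focalPairs (hI : IsIsotropicInverseFocal B S R D) (H : IsSetting B X)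
    (hD : IsComponentAtInfinity X D) (hne : (generalAtInfinity B X D).Nonempty) :
    zcl ((fun q : V' × (V' × ℂ) => (q.1, q.2.1)) '' fibrePairs B R) = zcl (focalPairs B X D) := by
  have hR := hI.isSection.twistStable
  have hAne := hI.nonempty_fibrePairs (IsSetting.irr_component hD).1
  have hA := hR.irr_fibrePairs hI.isSection.irr H.nondeg hAne
  have hκ : IsPoly (fun q : V' × (V' × ℂ) => (q.1, q.2.1)) :=
    isPoly_fst.prodMk (isPoly_snd (E := V') (F := V' × ℂ)).fst
  refine zcl_eq_of_gdim_le (hA.image hκ) (H.irr_focalPairs hD hne) ?_ ?_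
  · rintro _ ⟨q, hq, rfl⟩ f hf h0
    exact Gen.vanish hA (hf.comp hκ)
      ((hI.gen_mem_focalPairs H hD hne).mono fun p _ hp => h0 _ hp) q hq
  · rw [H.gdim_focalPairs hD hne]
    refine (gdim_image hA hκ (P := fun n => n = Module.finrank ℂ V')
      (Gen.of_forall hAne fun q hq => ?_)).ge
    have e : pd (fun q : V' × (V' × ℂ) => (q.1, q.2.1)) q = (LinearMap.fst ℂ V' (V' × ℂ)).prod
        (LinearMap.fst ℂ V' ℂ ∘ₗ LinearMap.snd ℂ V' (V' × ℂ)) :=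
      pd_linear ((LinearMap.fst ℂ V' (V' × ℂ)).prod
        (LinearMap.fst ℂ V' ℂ ∘ₗ LinearMap.snd ℂ V' (V' × ℂ))) q
    have h1 := finrank_map_add_finrank_inf_ker (tangentSpace (fibrePairs B R) q)
      (pd (fun q : V' × (V' × ℂ) => (q.1, q.2.1)) q)
    have h2 : tangentSpace (fibrePairs B R) q ⊓
        LinearMap.ker (pd (fun q : V' × (V' × ℂ) => (q.1, q.2.1)) q) = ⊥ := by
      rw [eq_bot_iff, e]
      rintro ⟨x, v⟩ ⟨hv, hk⟩
      have hx : x = 0 := congrArg Prod.fst (LinearMap.mem_ker.1 hk)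
      have hv0 : v = 0 := IsTwistStable.fst_injective hq (IsTwistStable.tangent_fibrePairs hq hv).1
        (congrArg Prod.snd (LinearMap.mem_ker.1 hk))
      rw [hx, hv0]
      rfl
    rw [h2, finrank_bot, add_zero,
      hR.finrank_tangentSpace_fibrePairs hI.isSection.irr H.nondeg hq] at h1
    exact h1

/-- By density the second projection may be computed on the isotropic fibres, which dominate `R`;
and `R` dominates the cone over `S`. -/
theorem zcl_snd_focalPairs (hI : IsIsotropicInverseFocal B S R D) (H : IsSetting B X)
    (hD : IsComponentAtInfinity X D) (hne : (generalAtInfinity B X D).Nonempty) :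
    zcl (Prod.snd '' focalPairs B X D) = zcl (pcone S) := by
  have hAne := hI.nonempty_fibrePairs (IsSetting.irr_component hD).1
  have h1 := zcl_image_congr (isPoly_snd (E := V') (F := V')) (hI.zcl_focalPairs H hD hne)
  have h2 : zcl (Prod.snd '' fibrePairs B R) = zcl R := by
    rw [← Gen.zcl_eq hI.isSection.irr (hI.isSection.twistStable.gen_exists_fibre H.nondeg hAne)]
    congr 1
    ext p
    constructor
    · rintro ⟨⟨x, p⟩, hq, rfl⟩
      exact ⟨hq.1.1, x, hq⟩
    · rintro ⟨-, x, hx⟩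
      exact ⟨_, hx, rfl⟩
  have h3 := zcl_image_congr (isPoly_fst (E := V') (F := ℂ)) h2
  have h4 := hI.isSection.dominant
  rw [closure_zariski] at h4
  rw [← h1, Set.image_image]
  rw [Set.image_image, h4] at h3
  have hSne : S.Nonempty := hI.irreducible.1
  rw [← zcl_cone hSne, h3, ← h4, zcl_zcl]

end IsIsotropicInverseFocal

/-- A component at infinity obtained by the inverse focal construction is the base of a component
of the ramification locus whose image lies at infinity. -/
theorem IsSetting.isDegenerateAtInfinity (H : IsSetting B X) (hD : IsComponentAtInfinity X D)
    (hne : (atInfinity V' '' D ∩ orthGeneral B X).Nonempty)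
    (hdom : ¬ IsIsotropicallyFocallyDegenerate B X) (hI : IsIsotropicInverseFocal B S R D) :
    IsDegenerateAtInfinity B X (normalRestriction B X (atInfinity V' '' D)) S D ∧
      ¬ IsHypersurface (atInfinity V' '' S) := by
  have hne' : (generalAtInfinity B X D).Nonempty := by
    obtain ⟨p, hp1, hp2⟩ := hne
    have h : p.rep ∈ (fun x => (x, (0 : ℂ))) '' generalAtInfinity B X D := by
      rw [image_generalAtInfinity]
      exact ⟨mem_pcone_rep.2 hp1, mem_pcone_rep.2 hp2⟩
    obtain ⟨x, hx, -⟩ := h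
    exact ⟨x, hx⟩
  have hS := hI.zcl_snd_focalPairs H hD hne'
  have hfocal := (focalImage_normalRestriction_eq_iff hI.closed).2 hS
  -- A single unramified point of the restriction would make its image the whole hyperplane at
  -- infinity, which properness of `S` forbids.
  have hcomp := H.isComponent_normalRestriction hD hne' hdom fun p hp => by
    by_contra h
    exact hI.proper (H.eq_univ_of_unramified hD hne' hI.closed hS hp h)
  have hhyp := not_isHypersurface hI.proper
  exact ⟨⟨⟨hdom, _, hcomp, by rwa [hfocal]⟩, hcomp, hfocal,
    H.baseImage_normalRestriction hD hne', hD⟩, hhyp⟩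

end Converse

/-! ### A component of the ramification locus over `D` is the whole restriction, and its image is
proper. -/

section Restriction

variable {V' : Type u} [AddCommGroup V'] [Module ℂ V'] [FiniteDimensional ℂ V']
  {B : LinearMap.BilinForm ℂ V'} {X : Set (ℙ ℂ (V' × ℂ))} {D S : Set (ℙ ℂ V')}
  {Z : Set (ℙ ℂ (V' × ℂ) × ℙ ℂ (V' × ℂ))}

theorem mem_bicone_ramification {p : (V' × ℂ) × (V' × ℂ)} (hp : p ∈ ramified B X)
    (h0 : p.2 ≠ 0) : p ∈ bicone (ramification B X) := by
  obtain ⟨h1, h2, h3⟩ := mem_bicone_normalBundle.2 ⟨hp.1.1, h0, hp.1.2⟩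
  refine ⟨h1, h2, @subset_closure _ (zariskiBiproj (V' × ℂ)) _ _ ⟨h3, fun htop => hp.2 ?_⟩⟩
  obtain ⟨a, ha⟩ := Projectivization.exists_smul_eq_mk_rep ℂ p.1 h1
  obtain ⟨b, hb⟩ := Projectivization.exists_smul_eq_mk_rep ℂ p.2 h2
  rw [← tangentSpace_congr zcl_bicone_normalBundle_univ]
  simp only at htop
  rw [← ha, ← hb, Units.smul_def, Units.smul_def] at htop
  rw [eq_top_iff]
  rintro y -
  obtain ⟨t, ht, hty⟩ := htop.ge (Submodule.mem_top (x := (b : ℂ) • y))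
  refine ⟨((a : ℂ)⁻¹ • t.1, (b : ℂ)⁻¹ • t.2), ?_, ?_⟩
  · have := map_mem_tangentSpace (T := bicone (normalBundle B X))
      (LinearMap.prodMap ((a : ℂ)⁻¹ • LinearMap.id) ((b : ℂ)⁻¹ • LinearMap.id))
      (fun q hq => mem_bicone_smul hq (inv_ne_zero a.ne_zero) (inv_ne_zero b.ne_zero)) ht
    simpa [smul_smul] using this
  · simp only [LinearMap.snd_apply] at hty ⊢
    rw [hty, smul_smul, inv_mul_cancel₀ b.ne_zero, one_smul]

theorem eq_of_zcl_bicone_eq {E : Type u} [AddCommGroup E] [Module ℂ E] [FiniteDimensional ℂ E]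
    {S T : Set (ℙ ℂ E × ℙ ℂ E)} (hS : IsClosed[zariskiBiproj E] S)
    (hT : IsClosed[zariskiBiproj E] T) (h : zcl (bicone S) = zcl (bicone T)) : S = T := by
  rw [isClosed_zariskiBiproj_iff] at hS hT
  refine Set.Subset.antisymm (bicone_subset_bicone.1 fun v hv => ?_)
    (bicone_subset_bicone.1 fun v hv => ?_)
  · exact hT v (h ▸ subset_zcl _ hv) ⟨hv.1, hv.2.1⟩
  · exact hS v (h ▸ subset_zcl _ hv) ⟨hv.1, hv.2.1⟩

namespace IsDegenerateAtInfinity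

/-- The part of the component of the ramification locus over the general points. -/
theorem exists_open_part (hZ : IsDegenerateAtInfinity B X Z S D) :
    ∃ Z₀ : Set ((V' × ℂ) × (V' × ℂ)), Irr Z₀ ∧ zcl Z₀ = zcl (bicone Z) ∧ Z₀ ⊆ ramified B X ∧
      Z₀ ⊆ bicone Z ∧ Z₀ ⊆ normalOver B X ((fun x => (x, (0 : ℂ))) '' generalAtInfinity B X D) := by
  set Y := {p | p ∈ normalBundle B X ∧
      (tangentSpace (bicone (normalBundle B X)) (p.1.rep, p.2.rep)).map
        (LinearMap.snd ℂ (V' × ℂ) (V' × ℂ)) ≠ ⊤}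
  -- The ramification locus is defined as a closure; its component is still the closure of the
  -- actual ramification points it contains.
  have h1 : Z ⊆ @closure _ (zariskiBiproj (V' × ℂ)) (Z ∩ Y) :=
    component_subset_closure (isTorusQuotient_biprojMk (V' × ℂ)) hZ.component
  have h2 : zcl (bicone (Z ∩ Y)) = zcl (bicone Z) := by
    apply Set.Subset.antisymm (zcl_mono (bicone_subset_bicone.2 Set.inter_subset_left))
    rw [← zcl_bicone_closure (Z ∩ Y)]
    exact zcl_mono (bicone_subset_bicone.2 h1)
  have hr : bicone (Z ∩ Y) ⊆ ramified B X := fun p hp =>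
    IsSetting.bicone_ramification_subset (bicone_subset_bicone.2 Set.inter_subset_right hp)
  have hZ0 : bicone (Z ∩ Y) ⊆ bicone Z := bicone_subset_bicone.2 Set.inter_subset_left
  refine ⟨bicone (Z ∩ Y), (isIrreducible_zariskiBiproj_iff.1 hZ.component.1.1).of_zcl_eq h2.symm,
    h2, hr, hZ0, fun p hp => ⟨?_, (hr hp).1.2⟩⟩
  rw [image_generalAtInfinity]
  refine ⟨?_, (hr hp).1.1⟩
  rw [← hZ.base]
  exact pcone_subset_pcone.2 (@subset_closure _ (zariskiProj (V' × ℂ)) _)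
    ((pcone_image_fst Z).ge ⟨p, hZ0 hp, rfl⟩)

theorem nonempty_generalAtInfinity (hZ : IsDegenerateAtInfinity B X Z S D) :
    (generalAtInfinity B X D).Nonempty := by
  obtain ⟨Z₀, hi, -, -, -, hN⟩ := hZ.exists_open_part
  obtain ⟨p, hp⟩ := hi.1
  obtain ⟨x, hx, -⟩ := (hN hp).1
  exact ⟨x, hx⟩

/-- The component is cut out in the normal bundle by one equation near one of its points and is
contained in the restriction over `D`. The restriction is irreducible and proper by dimension, so
Krull's theorem leaves no room between the two. -/
theorem zcl_bicone_eq (hZ : IsDegenerateAtInfinity B X Z S D) (H : IsSetting B X) :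
    zcl (normalOver B X ((fun x => (x, (0 : ℂ))) '' generalAtInfinity B X D)) =
      zcl (bicone Z) := by
  have hD := hZ.base_component
  have hne := hZ.nonempty_generalAtInfinity
  obtain ⟨Z₀, hi, hzcl, hr, hZ0, hZN⟩ := hZ.exists_open_part
  obtain ⟨p₀, hp₀⟩ := hi.1
  have hp₀N := (hr hp₀).1
  set N := normalOver B X (general B X)
  set N' := normalOver B X ((fun x => (x, (0 : ℂ))) '' generalAtInfinity B X D)
  have hN : Irr N := H.irr_normalOver (H.irr_general ⟨_, hp₀N.1⟩) subset_rfl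
  have hN' : Irr N' := H.irr_normalOver_infinity hD hne
  have hNN : N' ⊆ N := normalOver_mono IsSetting.image_generalAtInfinity_subset
  obtain ⟨d, h, hd, hh, hh0, hdh⟩ := H.exists_ramification_equation hp₀N
  obtain ⟨k, hk, hk0, hkg⟩ := exists_general_nhd hp₀N.1
  obtain ⟨l, hl⟩ := Module.Projective.exists_dual_eq_one ℂ (hZ0 hp₀).2.1
  rw [← hzcl]
  refine zcl_eq_of_component (δ := d) hN hN' hi (hZN.trans (subset_zcl _))
    (hNN.trans (subset_zcl _)) (fun hsub => ?_) hd (Gen.vanish hi hd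
      ⟨h, hh, ⟨p₀, hp₀, hh0⟩, fun p hp hne => (hdh p (hr hp).1 hne).2 (hr hp).2⟩) ?_
  · have h1 := gdim_congr hN' ((zcl_mono hNN).antisymm (zcl_subset_zcl hsub))
    have h2 : gdim N' = Module.finrank ℂ V' + 1 := H.gdim_normalOver_infinity hD hne
    have h3 : gdim N = Module.finrank ℂ V' + 2 := by
      obtain ⟨p, hp⟩ := exists_isSmoothPt hN.1
      rw [← (isSmoothPt_iff.1 hp).2, H.finrank_tangentSpace_normalBundle hp.1]
    omega
  · intro T hT hTN hTd hZT
    let F : (V' × ℂ) × (V' × ℂ) → ℂ := fun p => h p * (k p.1 * l p.2)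
    have hF : IsPoly F :=
      isPoly_mul hh (isPoly_mul (hk.comp isPoly_fst) ((isPoly_linear l).comp isPoly_snd))
    have hF0 : F p₀ ≠ 0 := mul_ne_zero hh0 (mul_ne_zero hk0 (by rw [hl]; exact one_ne_zero))
    have hgen : Gen T (fun p => F p ≠ 0) := Gen.of_ne hF ⟨p₀, hZT hp₀, hF0⟩
    -- Where `F` does not vanish, a point in the closure of `N` lies over a general point, hence in
    -- `N`, and the equation `d = 0` means ramification there. Maximality of `Z` can then be applied
    -- to this open part of `T`.
    have hmem : ∀ p ∈ {p | p ∈ T ∧ F p ≠ 0}, p ∈ bicone (ramification B X) := by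
      rintro ⟨a, b⟩ ⟨hpT, hpF⟩
      have h1 : h (a, b) ≠ 0 := left_ne_zero_of_mul hpF
      have h2 : k a ≠ 0 := left_ne_zero_of_mul (right_ne_zero_of_mul hpF)
      have h3 : l b ≠ 0 := right_ne_zero_of_mul (right_ne_zero_of_mul hpF)
      have h4 : a ∈ general B X := hkg a (H.zcl_cone_subset
        (mem_zcl_of_map isPoly_fst (fun q hq => subset_zcl _ (mem_cone_of_general hq.1)) (hTN hpT))) h2
      have h5 : (a, b) ∈ N := ⟨h4, H.mem_normalSpace_of_annihilator subset_rfl h4 (hTN hpT)⟩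
      exact mem_bicone_ramification ⟨h5, (hdh _ h5 h1).1 (hTd _ hpT)⟩
        fun hb => h3 (by rw [show b = 0 from hb, map_zero])
    have h1 := IsComponent.subset_qlift (isTorusQuotient_biprojMk (V' × ℂ))
      (A := ramification B X) (@isClosed_closure _ (zariskiBiproj (V' × ℂ)) _) hZ.component
      (hT.of_gen hgen) (fun v hv => ⟨(hmem v hv).1, (hmem v hv).2.1⟩)
      (by rw [qlift_biprojMk]; exact hmem) (by
        rw [qlift_biprojMk, Gen.zcl_eq hT hgen]
        exact (subset_zcl _).trans (hzcl.symm.subset.trans (zcl_mono hZT)))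
    rw [qlift_biprojMk] at h1
    refine (subset_zcl T).trans ?_
    rw [← Gen.zcl_eq hT hgen, hzcl]
    exact zcl_mono h1

theorem eq_normalRestriction (hZ : IsDegenerateAtInfinity B X Z S D) (H : IsSetting B X) :
    Z = normalRestriction B X (atInfinity V' '' D) := by
  refine eq_of_zcl_bicone_eq ?_ (@isClosed_closure _ (zariskiBiproj (V' × ℂ)) _) ?_
  · exact component_isClosed (q := biprojMk (V' × ℂ)) hZ.component
  · rw [zcl_bicone_normalRestriction, hZ.zcl_bicone_eq H]

theorem isClosed_focal (hZ : IsDegenerateAtInfinity B X Z S D) : IsClosed[zariskiProj V'] S := by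
  rw [← isClosed_image_atInfinity, ← hZ.focal]
  exact @isClosed_closure _ (zariskiProj (V' × ℂ)) _

theorem zcl_snd_focalPairs (hZ : IsDegenerateAtInfinity B X Z S D) (H : IsSetting B X) :
    zcl (Prod.snd '' focalPairs B X D) = zcl (pcone S) := by
  rw [← focalImage_normalRestriction_eq_iff hZ.isClosed_focal, ← hZ.eq_normalRestriction H, hZ.focal]

/-- Being unramified is an open condition, while the restriction is the closure of ramified points.
-/
theorem mem_ramified (hZ : IsDegenerateAtInfinity B X Z S D) (H : IsSetting B X)
    {p : (V' × ℂ) × (V' × ℂ)}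
    (hp : p ∈ normalOver B X ((fun x => (x, (0 : ℂ))) '' generalAtInfinity B X D)) :
    p ∈ ramified B X := by
  by_contra hpr
  obtain ⟨Z₀, hi, hzcl, hr, hZ0, hZN⟩ := hZ.exists_open_part
  obtain ⟨f, hf, hne, h⟩ := H.gen_unramified IsSetting.image_generalAtInfinity_subset hp hpr
  rw [← exists_ne_zcl hf, hZ.zcl_bicone_eq H, ← hzcl, exists_ne_zcl hf] at hne
  obtain ⟨q, hq, hfq⟩ := hne
  exact h q (hZN hq) hfq (hr hq)

/-- If `S` were everything, tangent vectors of the focal pairs would already cover `V'` at a general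
pair. A tangent vector of `X` with nonzero last coordinate lifts to the normal bundle and supplies
the missing direction, so the projection would be unramified there. -/
theorem focal_ne_univ (hZ : IsDegenerateAtInfinity B X Z S D) (H : IsSetting B X) :
    S ≠ Set.univ := by
  rintro rfl
  have hD := hZ.base_component
  have hne := hZ.nonempty_generalAtInfinity
  have hP := H.irr_focalPairs hD hne
  obtain ⟨⟨x, O⟩, hp, hT⟩ := (gen_map_tangentSpace hP (isPoly_snd (E := V') (F := V'))).exists
  have e : pd (Prod.snd : V' × V' → V') (x, O) = LinearMap.snd ℂ V' V' :=
    pd_linear (LinearMap.snd ℂ V' V') (x, O)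
  have hu : zcl (Prod.snd '' focalPairs B X D) = zcl Set.univ := by
    rw [hZ.zcl_snd_focalPairs H, ← zcl_cone ⟨Projectivization.mk ℂ x hp.1.1.1, Set.mem_univ _⟩]
    congr 1
    exact Set.eq_univ_of_forall fun v _ => trivial
  rw [e, tangentSpace_congr hu, tangentSpace_univ] at hT
  have hx : x ∈ generalAtInfinity B X D := hp.1
  have hO : O - x ∈ normalDirections B X (x, 0) := hp.2
  have hN : ((x, (0 : ℂ)), (O, (0 : ℂ))) ∈
      normalOver B X ((fun x => (x, (0 : ℂ))) '' generalAtInfinity B X D) :=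
    ⟨⟨x, hx, rfl⟩, mem_normalSpace.2 ⟨1, O - x, hO, by simp⟩⟩
  refine (hZ.mem_ramified H hN).2 ?_
  obtain ⟨L, hL⟩ := H.exists_tangent_normalOver subset_rfl hx.2 (a := 1) hO
  have e2 : (1 : ℂ) • (x, (0 : ℂ)) + (O - x, 0) = (O, 0) := by simp
  rw [e2] at hL
  obtain ⟨v, hv, hv2⟩ := (mem_general.1 hx.2).2.1
  rw [← tangentSpace_congr (H.zcl_general ⟨_, hx.2⟩)] at hv
  rw [eq_top_iff]
  rintro y -
  set N := normalOver B X (general B X)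
  have h1 := hL v hv 0 (Submodule.zero_mem _)
  obtain ⟨⟨x', O'⟩, ht, hO'⟩ := hT.ge
    (Submodule.mem_top (x := y.1 - (y.2 * v.2⁻¹) • (v.1 + L v)))
  have h2 := map_mem_tangentSpace (T := N)
    (LinearMap.prodMap (LinearMap.inl ℂ V' ℂ) (LinearMap.inl ℂ V' ℂ)) (fun q hq =>
      ⟨hq.1.2, mem_normalSpace.2 ⟨1, q.2 - q.1, hq.2, by simp⟩⟩) ht
  refine ⟨_, Submodule.add_mem _ h2 (Submodule.smul_mem _ (y.2 * v.2⁻¹) h1), ?_⟩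
  simp only [LinearMap.snd_apply] at hO'
  ext
  · simp [hO']
  · simp [hv2]

end IsDegenerateAtInfinity

end Restriction

/-! ### From ramification to an admissible pair. -/

section Direct

variable {V' : Type u} [AddCommGroup V'] [Module ℂ V'] [FiniteDimensional ℂ V']
  {B : LinearMap.BilinForm ℂ V'} {X : Set (ℙ ℂ (V' × ℂ))} {D S : Set (ℙ ℂ V')}
  {Z : Set (ℙ ℂ (V' × ℂ) × ℙ ℂ (V' × ℂ))}

/-- Near a smooth point, the orthogonal spaces of the tangent spaces have polynomial sections. -/
theorem exists_orthogonal_field (hnd : B.Nondegenerate) {C : Set V'} {O₀ : V'}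
    (hO : IsSmoothPt C O₀) {w₀ : V'} (hw : w₀ ∈ B.orthogonal (tangentSpace C O₀)) :
    ∃ (w : V' → V') (d : V' → ℂ), IsPoly w ∧ IsPoly d ∧ w O₀ = w₀ ∧ d O₀ ≠ 0 ∧
      ∀ O ∈ C, d O ≠ 0 → w O ∈ B.orthogonal (tangentSpace C O) := by
  let b := Module.finBasis ℂ (tangentSpace C O₀)
  have hfield := fun i => exists_tangent_field hO (b i).2
  choose u hu hu0 huT using hfield
  have hb := linearIndependent_coe_basis b
  obtain ⟨k, hk, hk0, hkl⟩ := exists_isPoly_linearIndependent hu (p₀ := O₀) (by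
    simp only [hu0]
    exact hb)
  obtain ⟨e, he, he0, hes⟩ := hO.nhd
  have hli : LinearIndependent ℂ (fun i => (B (u i O₀) : Module.Dual ℂ V')) := by
    simp only [hu0]
    exact (LinearMap.linearIndependent_iff (B : V' →ₗ[ℂ] Module.Dual ℂ V') hnd.ker_eq_bot).2 hb
  obtain ⟨w, hwp, hw0, hw1, -⟩ := exists_poly_solution
    (φ := fun i x => (B (u i x) : Module.Dual ℂ V'))
    (fun i => (isPoly_linear (B : V' →ₗ[ℂ] Module.Dual ℂ V')).comp (hu i)) hli (v₀ := w₀)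
    (fun i => by rw [hu0]; exact LinearMap.BilinForm.mem_orthogonal_iff.1 hw _ (b i).2)
  refine ⟨w, fun O => k O * e O, hwp, isPoly_mul hk he, hw0, ?_, fun O hOC hne => ?_⟩
  · beta_reduce
    rw [hk0, he0]
    norm_num
  · have hspan := span_range_eq_of_card (hkl O (left_ne_zero_of_mul hne)) (fun i => huT i O hOC) (by
      rw [Fintype.card_fin, (isSmoothPt_iff.1 (hes O hOC (right_ne_zero_of_mul hne))).2,
        (isSmoothPt_iff.1 hO).2])
    rw [LinearMap.BilinForm.mem_orthogonal_iff, ← hspan]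
    intro v hv
    change B v (w O) = 0
    induction hv using Submodule.span_induction with
    | mem v hv => obtain ⟨i, rfl⟩ := hv; exact hw1 O i
    | zero => simp
    | add a b _ _ ha hb => simp [ha, hb]
    | smul c a _ ha => simp [ha]

/-- The map from focal pairs to the graph of the homogeneous function `⟨x, x⟩`. -/
def sqMap (B : LinearMap.BilinForm ℂ V') (p : V' × V') : V' × ℂ := (p.2, B p.1 p.1)

theorem isPoly_sqMap : IsPoly (sqMap B) := isPoly_snd.prodMk (isPoly_bilin B isPoly_fst isPoly_fst)

theorem pd_sqMap (hBs : B.IsSymm) (p v : V' × V') : pd (sqMap B) p v = (v.2, 2 * B p.1 v.1) := by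
  have hpd : HasPD (sqMap B) p _ := hasPD_prodMk (hasPD_linear (LinearMap.snd ℂ V' V') p)
    (hasPD_bilin B (hasPD_linear (LinearMap.fst ℂ V' V') p) (hasPD_linear (LinearMap.fst ℂ V' V') p))
  rw [hpd.pd_eq]
  refine Prod.ext rfl ?_
  simp only [LinearMap.prod_apply, Function.prod, LinearMap.add_apply, LinearMap.comp_apply,
    LinearMap.flip_apply, LinearMap.fst_apply, hBs.eq v.1]
  ring

/-- The graph of the function of the focal pairs. -/
def focalGraph (B : LinearMap.BilinForm ℂ V') (X : Set (ℙ ℂ (V' × ℂ))) (D : Set (ℙ ℂ V')) :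
    Set (V' × ℂ) := zcl (sqMap B '' focalPairs B X D)

theorem twistStable_focalGraph : IsTwistStable (focalGraph B X D) := by
  intro c hc p hp
  refine mem_zcl_of_map (isPoly_linear (twist V' c)) ?_ hp
  rintro _ ⟨q, hq, rfl⟩
  refine subset_zcl _ ⟨c • q, smul_mem_focalPairs hq hc, ?_⟩
  ext
  · rfl
  · simp [sqMap]
    ring

namespace IsSetting

/-- The infinitesimal relations satisfied by a focal pair. -/
theorem tangent_focalPairs (H : IsSetting B X) (hD : IsComponentAtInfinity X D) {p : V' × V'}
    (hp : p ∈ focalPairs B X D) {v : V' × V'} (hv : v ∈ tangentSpace (focalPairs B X D) p) :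
    B v.2 p.1 = B p.1 v.1 := by
  -- The Euler vector `x` is itself a tangent direction at infinity, hence orthogonal to the normal
  -- vector `O - x`.
  have hsq : ∀ q ∈ focalPairs B X D, B q.1 (q.2 - q.1) = 0 := by
    intro q hq
    refine mem_normalDirections.1 hq.2 _ ?_
    exact self_mem_tangentSpace_cone (mem_cone_of_general hq.1.2)
  have h1 : v.1 ∈ tangentDirections X (p.1, 0) := by
    rw [← H.tangentSpace_generalAtInfinity hD hp.1]
    exact map_mem_tangentSpace (LinearMap.fst ℂ V' V') (fun q hq => hq.1) hv
  have h2 := mem_normalDirections.1 hp.2 _ h1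
  have hpd : HasPD (fun q : V' × V' => B q.1 (q.2 - q.1)) p _ :=
    hasPD_bilin B (hasPD_linear (LinearMap.fst ℂ V' V') p)
      (hasPD_linear (LinearMap.snd ℂ V' V' - LinearMap.fst ℂ V' V') p)
  have h3 := mem_tangentSpace.1 hv _ (isPoly_bilin B isPoly_fst (isPoly_snd.sub isPoly_fst)) hsq
  rw [hpd.pd_eq] at h3
  simp only [LinearMap.add_apply, LinearMap.comp_apply, LinearMap.flip_apply, LinearMap.fst_apply,
    LinearMap.snd_apply, LinearMap.sub_apply, map_sub] at h2 h3
  rw [H.symm.eq]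
  linear_combination h3 - h2

theorem irr_focalGraph (H : IsSetting B X) (hD : IsComponentAtInfinity X D)
    (hne : (generalAtInfinity B X D).Nonempty) : Irr (focalGraph B X D) :=
  ((H.irr_focalPairs hD hne).image (isPoly_sqMap (B := B))).zcl

/-- At a general focal pair `(x, O)` the point `x` lies in the isotropic fibre at `O`. -/
theorem gen_mem_fibrePairs (H : IsSetting B X) (hD : IsComponentAtInfinity X D)
    (hne : (generalAtInfinity B X D).Nonempty) :
    Gen (focalPairs B X D) (fun p => (p.1, sqMap B p) ∈ fibrePairs B (focalGraph B X D)) := by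
  have hP := H.irr_focalPairs hD hne
  have hi := hP.image (isPoly_sqMap (B := B))
  refine ((gen_map_tangentSpace hP (isPoly_sqMap (B := B))).and hP
    (Gen.of_image (isPoly_sqMap (B := B)) (gen_isSmoothPt hi.1))).mono ?_
  rintro p hp ⟨hT, hs⟩
  have hs' : IsSmoothPt (focalGraph B X D) (sqMap B p) := hs.to_zcl hi
  refine ⟨hs', (twistStable_focalGraph.mem_isotropicFibre_iff hs'.1).2 fun v hv => ?_⟩
  -- Generic smoothness: every tangent vector of the graph at this point is `(dO, 2⟨x, dx⟩)` for a
  -- tangent vector of the focal pairs.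
  rw [focalGraph, tangentSpace_zcl, ← hT] at hv
  obtain ⟨t, ht, rfl⟩ := hv
  rw [pd_sqMap H.symm]
  dsimp only
  rw [H.tangent_focalPairs hD hp ht]
  ring

theorem nonempty_fibrePairs (H : IsSetting B X) (hD : IsComponentAtInfinity X D)
    (hne : (generalAtInfinity B X D).Nonempty) :
    (fibrePairs B (focalGraph B X D)).Nonempty := by
  obtain ⟨p, -, hp⟩ := (H.gen_mem_fibrePairs hD hne).exists
  exact ⟨_, hp⟩

/-- The focal pairs are dense in the total space of the isotropic fibres. -/
theorem zcl_fibrePairs (H : IsSetting B X) (hD : IsComponentAtInfinity X D)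
    (hne : (generalAtInfinity B X D).Nonempty) :
    zcl ((fun p => (p.1, sqMap B p)) '' focalPairs B X D) =
      zcl (fibrePairs B (focalGraph B X D)) := by
  have hP := H.irr_focalPairs hD hne
  have hRi := H.irr_focalGraph hD hne
  have hAne := H.nonempty_fibrePairs hD hne
  have hA := twistStable_focalGraph.irr_fibrePairs hRi H.nondeg hAne
  have hκ : IsPoly (fun p : V' × V' => (p.1, sqMap B p)) := isPoly_fst.prodMk isPoly_sqMap
  refine zcl_eq_of_gdim_le (hP.image hκ) hA ?_ ?_
  · rintro _ ⟨q, hq, rfl⟩ f hf h0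
    exact Gen.vanish hP (hf.comp hκ)
      ((H.gen_mem_fibrePairs hD hne).mono fun p _ hp => h0 _ hp) q hq
  -- Both sets have the dimension of `V'`: the map from focal pairs retains `x` and `O`, so it is
  -- injective on tangent vectors.
  · rw [twistStable_focalGraph.gdim_fibrePairs hRi H.nondeg hAne]
    refine (gdim_image hP hκ (P := fun n => n = Module.finrank ℂ V')
      (Gen.of_forall hP.1 fun q hq => ?_)).ge
    have hpd : HasPD (fun p : V' × V' => (p.1, sqMap B p)) q _ :=
      hasPD_prodMk (hasPD_linear (LinearMap.fst ℂ V' V') q) (isPoly_sqMap.hasPD q)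
    rw [hpd.pd_eq, ← H.finrank_tangentSpace_focalPairs hD hq]
    refine (Submodule.equivMapOfInjective _ ?_ _).finrank_eq.symm
    rw [← LinearMap.ker_eq_bot, LinearMap.ker_eq_bot']
    intro v hv
    have h1 : v.1 = 0 := congrArg Prod.fst hv
    have h2 : pd (sqMap B) q v = 0 := congrArg Prod.snd hv
    rw [pd_sqMap H.symm] at h2
    exact Prod.ext h1 (congrArg Prod.fst h2)

/-- The orthogonal spaces of the generic tangent spaces of the image are totally isotropic. -/
theorem gen_isotropic (H : IsSetting B X) (hD : IsComponentAtInfinity X D)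
    (hne : (generalAtInfinity B X D).Nonempty) {C : Set V'}
    (hC : zcl (Prod.fst '' focalGraph B X D) = zcl C)
    (hadm : ∀ q ∈ fibrePairs B (focalGraph B X D), B q.1 q.1 = q.2.2) :
    Gen (focalGraph B X D) (fun p => ∀ w ∈ B.orthogonal (tangentSpace C p.1),
      ∀ w' ∈ B.orthogonal (tangentSpace C p.1), B w w' = 0) := by
  have hRi := H.irr_focalGraph hD hne
  refine ((gen_map_tangentSpace hRi isPoly_fst).and hRi (twistStable_focalGraph.gen_exists_fibre
    H.nondeg (H.nonempty_fibrePairs hD hne))).mono ?_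
  rintro p hp ⟨hT, x, hx⟩
  have e : pd (Prod.fst : V' × ℂ → V') p = LinearMap.fst ℂ V' ℂ := pd_linear (LinearMap.fst ℂ V' ℂ) p
  rw [e, tangentSpace_congr hC] at hT
  rw [← hT]
  have hmem : ∀ w ∈ B.orthogonal ((tangentSpace (focalGraph B X D) p).map (LinearMap.fst ℂ V' ℂ)),
      (x + w, p) ∈ fibrePairs B (focalGraph B X D) := by
    refine fun w hw => ⟨hx.1, (twistStable_focalGraph.mem_isotropicFibre_iff hp).2 fun v hv => ?_⟩
    dsimp only at hv ⊢
    rw [map_add, hx.2.2 v hv, LinearMap.BilinForm.mem_orthogonal_iff.1 hw v.1 ⟨v, hv, rfl⟩, add_zero]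
  -- The fibre contains `x + w` and `x - w`; averaging `⟨x ± w, x ± w⟩ = ρ` and subtracting `⟨x, x⟩
  -- = ρ` leaves `⟨w, w⟩ = 0`. Polarization then gives total isotropy.
  have hq : ∀ w ∈ B.orthogonal ((tangentSpace (focalGraph B X D) p).map (LinearMap.fst ℂ V' ℂ)),
      B w w = 0 := by
    intro w hw
    have h0 := hadm _ hx
    have h1 := hadm _ (hmem w hw)
    have h2 := hadm _ (hmem _ (Submodule.neg_mem _ hw))
    simp only [map_add, map_neg, LinearMap.add_apply, LinearMap.neg_apply] at h0 h1 h2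
    linear_combination (h1 + h2) / 2 - h0
  intro w hw w' hw'
  have h1 := hq _ (Submodule.add_mem _ hw hw')
  simp only [map_add, LinearMap.add_apply, hq w hw, hq w' hw', H.symm.eq w' w] at h1
  linear_combination h1 / 2

end IsSetting

/-- Total isotropy of the orthogonal spaces spreads from the general to all smooth points. -/
theorem isotropic_of_gen (hnd : B.Nondegenerate) {R : Set (V' × ℂ)} (hR : Irr R) {C : Set V'}
    (hRC : Prod.fst '' R ⊆ C) (hC : C ⊆ zcl (Prod.fst '' R))
    (h : Gen R (fun p => ∀ w ∈ B.orthogonal (tangentSpace C p.1),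
      ∀ w' ∈ B.orthogonal (tangentSpace C p.1), B w w' = 0)) {O : V'} (hO : IsSmoothPt C O) :
    ∀ w ∈ B.orthogonal (tangentSpace C O), ∀ w' ∈ B.orthogonal (tangentSpace C O), B w w' = 0 := by
  intro w₀ hw₀ w₀' hw₀'
  obtain ⟨w, d, hw, hd, hw0, hd0, hwN⟩ := exists_orthogonal_field hnd hO hw₀
  obtain ⟨w', d', hw', hd', hw0', hd0', hwN'⟩ := exists_orthogonal_field hnd hO hw₀'
  -- The factors `d` and `d'` vanish where the fields may fail to be orthogonal to the tangent
  -- space; the product is zero at general points of the dense image, hence on `C`, and both factors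
  -- are nonzero at `O`.
  have hF : IsPoly (fun O => d O * d' O * B (w O) (w' O)) :=
    isPoly_mul (isPoly_mul hd hd') (isPoly_bilin B hw hw')
  have h0 := hC hO.1 _ hF (by
    rintro _ ⟨p, hp, rfl⟩
    refine Gen.vanish hR (hF.comp isPoly_fst) (h.mono fun q hq hqi => ?_) p hp
    by_cases hz : d q.1 * d' q.1 = 0
    · rw [hz, zero_mul]
    · have hqC := hRC ⟨q, hq, rfl⟩
      rw [hqi _ (hwN _ hqC (left_ne_zero_of_mul hz)) _ (hwN' _ hqC (right_ne_zero_of_mul hz)),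
        mul_zero])
  beta_reduce at h0
  rw [hw0, hw0'] at h0
  exact (mul_eq_zero.1 h0).resolve_left (mul_ne_zero hd0 hd0')

/-- A component at infinity which is the base of a component of the ramification locus with image
at infinity is obtained by the inverse focal construction. -/
theorem IsDegenerateAtInfinity.isIsotropicInverseFocal (hZ : IsDegenerateAtInfinity B X Z S D)
    (H : IsSetting B X) : IsIsotropicInverseFocal B S (focalGraph B X D) D := by
  have hD := hZ.base_component
  have hne := hZ.nonempty_generalAtInfinity
  have hS := hZ.zcl_snd_focalPairs H
  have hSc := hZ.isClosed_focal
  have hSi := H.irr_pcone_focal hD hne hS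
  have hP := H.irr_focalPairs hD hne
  have hRi := H.irr_focalGraph hD hne
  have hSne : S.Nonempty := by
    obtain ⟨v, hv⟩ := hSi.1
    exact ⟨_, hv.2⟩
  have hfst : zcl (Prod.fst '' focalGraph B X D) = cone S := by
    have h := zcl_image_congr (isPoly_fst (E := V') (F := ℂ)) (zcl_zcl (sqMap B '' focalPairs B X D))
    rw [Set.image_image] at h
    refine h.trans ?_
    change zcl (Prod.snd '' focalPairs B X D) = _
    rw [hS, ← zcl_cone hSne]
    exact (zcl_cone_subset hSc hSne).antisymm (subset_zcl _)
  have hκ := H.zcl_fibrePairs hD hne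
  have hκ' : fibrePairs B (focalGraph B X D) ⊆
      zcl ((fun p => (p.1, sqMap B p)) '' focalPairs B X D) := hκ ▸ subset_zcl _
  -- The relation `⟨x, x⟩ = ρ` is tautological on the focal pairs, which are dense in the total
  -- space of the fibres.
  have hadm : ∀ q ∈ fibrePairs B (focalGraph B X D), B q.1 q.1 = q.2.2 := by
    intro q hq
    refine sub_eq_zero.1 (hκ' hq (fun q => B q.1 q.1 - q.2.2) ((isPoly_bilin B isPoly_fst
      isPoly_fst).sub (isPoly_snd (E := V') (F := V' × ℂ)).snd) ?_)
    rintro _ ⟨p, hp, rfl⟩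
    exact sub_self _
  refine ⟨hSc, isIrreducible_zariskiProj_iff.2 hSi, hZ.focal_ne_univ H, fun O _ hO =>
    isotropic_of_gen H.nondeg hRi (hfst ▸ subset_zcl _) hfst.ge (H.gen_isotropic hD hne
      (by rw [hfst, ← hfst, zcl_zcl]) hadm) hO, ⟨?_, ?_, ?_, ?_, ?_⟩,
    fun p hp x hx => hadm (x, p) ⟨hp, hx⟩, ?_⟩
  · rw [isClosed_zariski_iff]
    exact (zcl_zcl _).subset
  · exact isIrreducible_zariski_iff.2 hRi
  · rw [closure_zariski, hfst]
  · intro h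
    obtain ⟨q, hq⟩ := H.nonempty_fibrePairs hD hne
    -- If the graph were the full product it would contain vertical lines, and the vertical vector
    -- would be tangent at a point with nonempty fibre.
    have h1 : ((0 : V'), (1 : ℂ)) ∈ tangentSpace (focalGraph B X D) q.2 :=
      mem_tangentSpace_of_line fun t => by
        rw [h]
        refine ⟨?_, trivial⟩
        have := (h ▸ hq.1.1 : q.2 ∈ cone S ×ˢ Set.univ).1
        simpa using this
    have := congrArg Prod.snd (IsTwistStable.fst_injective hq h1 rfl)
    exact one_ne_zero this
  · exact fun c O r hc h => twistStable_focalGraph c hc (O, r) h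
  · refine eq_of_zcl_pcone_eq (H.isClosed_component hD) (@isClosed_closure _ (zariskiProj V') _) ?_
    apply Set.Subset.antisymm
    · rw [← IsSetting.zcl_generalAtInfinity hD hne]
      refine zcl_subset_zcl fun x hx => ?_
      refine subset_zcl _ ((mem_pcone_sweep twistStable_focalGraph).2 ⟨hx.1.1, fun f hf h0 => ?_⟩)
      -- Every general point `x` of `D` occurs in the diagonal focal pair `(x, x)`, and a polynomial
      -- that vanishes at the first members of general focal pairs vanishes at all of them.
      refine Gen.vanish hP (hf.comp isPoly_fst) ((H.gen_mem_fibrePairs hD hne).mono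
        fun p hp hp' => h0 _ ⟨⟨_, hp', rfl⟩, hp.1.1.1⟩) _ (diag_mem_focalPairs hx)
    · refine zcl_subset_zcl fun v hv => ?_
      refine zcl_subset_zcl ?_ ((mem_pcone_sweep twistStable_focalGraph).1 hv).2
      rintro _ ⟨⟨q, hq, rfl⟩, -⟩
      rw [← IsSetting.zcl_generalAtInfinity hD hne]
      refine mem_zcl_of_map isPoly_fst ?_ (hκ' hq)
      rintro _ ⟨p, hp, rfl⟩
      exact subset_zcl _ hp.1

end Direct

end Focal

theorem mainTheorem9 {V' : Type*} [AddCommGroup V'] [Module ℂ V'] [FiniteDimensional ℂ V']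
    (B : LinearMap.BilinForm ℂ V') (hBs : B.IsSymm) (hB : B.Nondegenerate)
    (X : Set (ℙ ℂ (V' × ℂ)))
    (hXc : IsClosed[Focal.zariskiProj (V' × ℂ)] X)
    (hXi : @IsIrreducible _ (Focal.zariskiProj (V' × ℂ)) X)
    (hXinf : ¬ X ⊆ Set.range (Focal.atInfinity V')) :
    (∀ (Z : Set (ℙ ℂ (V' × ℂ) × ℙ ℂ (V' × ℂ))) (S D : Set (ℙ ℂ V')),
      Focal.IsDegenerateAtInfinity B X Z S D →
        Z = Focal.normalRestriction B X (Focal.atInfinity V' '' D) ∧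
        Focal.IsProjIsotropicallyDegenerate B D ∧
        ∃ R : Set (V' × ℂ), Focal.IsIsotropicInverseFocal B S R D) ∧
    (∀ (S D : Set (ℙ ℂ V')) (R : Set (V' × ℂ)),
      Focal.IsComponentAtInfinity X D →
      (Focal.atInfinity V' '' D ∩ Focal.orthGeneral B X).Nonempty →
      ¬ Focal.IsIsotropicallyFocallyDegenerate B X →
      Focal.IsIsotropicInverseFocal B S R D →
        Focal.IsDegenerateAtInfinity B X
          (Focal.normalRestriction B X (Focal.atInfinity V' '' D)) S D ∧
        ¬ Focal.IsHypersurface (Focal.atInfinity V' '' S)) := by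
  have H : Focal.IsSetting B X := ⟨hBs, hB, hXc, hXi⟩
  exact ⟨fun Z S D hZ => ⟨hZ.eq_normalRestriction H, ⟨S, _, hZ.isIsotropicInverseFocal H⟩,
      _, hZ.isIsotropicInverseFocal H⟩,
    fun S D R hD hne hdom hI => H.isDegenerateAtInfinity hD hne hdom hI⟩
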